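/- Let $N\ge 4$ and let $\Sigma$ be a smooth manifold of dimension $N-1$ (Hausdorff, $\sigma$-compact, without boundary). Let $\mathcal V\to\Sigma$ be a smooth vector bundle of rank $N$ with a smooth fibrewise Lorentzian inner product $\eta$ of signature $(N-1,1)$, and let $e\colon T\Sigma\to\mathcal V$ be a smooth injective bundle map (coframe) whose induced metric $g=\eta(e,e)$ is light-like: there is a nowhere vanishing smooth vector field $X$ with $\iota_Xg=0$. Write $\Omega^{i,j}_\partial=\Omega^i(\Sigma,\bigwedge^j\mathcal V)$ (smooth forms), products being wedge products in both the form part and the internal part; $W_k^{(i,j)}\colon\Omega_\partial^{i,j}\to\Omega_\partial^{i+k,j+k}$, $A\mapsto A\wedge e^{k}$; and, for a bundle map $\phi\colon T\Sigma\to\mathcal V$, let $[A,\phi]\in\Omega_\partial^{i+1,j-1}$ be the contraction of the last internal index of $A\in\Omega_\partial^{i,j}$ with $\phi$ by means of $\eta$, antisymmetrized in the form indices. Let $H\subset T\Sigma$ be a smooth subbundle complementary to $\langle X\rangle$, with local frames $Y^1,\dots,Y^{N-2}$. Let $\beta$ be the one-form with $\iota_X\beta=1$ such that $\widetilde e:=e-\beta\,\iota_Xe$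 satisfies $\iota_{Y^1}\cdots\iota_{Y^{N-2}}(\widetilde e\wedge e^{N-4}\wedge v)=0$ for all $v\in\Omega_\partial^{1,2}$ with $e^{N-3}\wedge v=0$. Put $$\mathcal S=\{\tau\in\Omega_\partial^{N-3,N-1}:\ \tau\wedge e=0,\ [\tau,\widetilde e]=0\}.$$ Let $e_n$ be a smooth section of $\mathcal V$, transversal to $e(T\Sigma)$ at every point and $\eta$-orthogonal to $e(H)$. Choose an arbitrary Riemannian metric on $\Sigma$ and extend it to $\mathcal V$ by a smooth positive definite fibre metric for which $e$ is isometric and $e_n$ is orthogonal to $e(T\Sigma)$; this gives a fibre metric on $\bigwedge^2T^*\Sigma\otimes\mathcal V$. Let $J\subset\Omega_\partial^{2,1}$ be the pointwise orthogonal complement of $\{[v,e]: v\in\operatorname{Ker}W_{N-3}^{(1,2)}\}$, let $\mathcal T=\operatorname{Ker}W_{N-3}^{(2,1)}\cap J$, and for $\alpha\in\Omega^{2,1}_\partial$ let $p_{\mathcal T}(\alpha)$ be the pointwise orthogonal projection of $\alpha$ to $\mathcal T$, i.e. the $\theta\in\mathcal T$ such that $\alpha-\theta$ is orthogonal to every element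 of $\mathcal T$ at every point. Elements of $\Omega_\partial^{N-1,N}$ are identified with densities on $\Sigma$ by means of the volume of $\eta$, with $(e(\partial_1),\dots,e(\partial_{N-1}),e_n)$ counted as a positive frame of $\mathcal V$ when $(\partial_1,\dots,\partial_{N-1})$ is a positive frame of $T\Sigma$, and integrated over $\Sigma$. **Claim.** If $\alpha\in\Omega_\partial^{2,1}$ and $\int_\Sigma\tau\wedge\alpha=0$ for all compactly supported $\tau\in\mathcal S$ (for compact $\Sigma$: for all $\tau\in\mathcal S$), then the projection $p_{\mathcal T}(\alpha)$ exists and $p_{\mathcal T}(\alpha)=0$. In particular $\mathcal S$ acts as a dual of $\mathcal T$: an element $\theta\in\mathcal T$ with $\int_\Sigma\tau\wedge\theta=0$ for all compactly supported $\tau\in\mathcal S$ is zero. -/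

import Mathlib

open Bundle Set MeasureTheory
open scoped Manifold ContDiff Topology

noncomputable section

/-! ### Products of alternating maps -/

namespace PalatiniCartan

section Algebra

variable {T : Type*} [AddCommGroup T] [Module ℝ T]
variable {A B C : Type*} [AddCommGroup A] [Module ℝ A] [AddCommGroup B] [Module ℝ B]
  [AddCommGroup C] [Module ℝ C]

/-- The exterior product of an `A`-valued `i`-form and a `B`-valued `k`-form on `T`, the values being
multiplied through the bilinear map `f` (a signed sum over shuffles). -/
def altProd (i k : ℕ) (f : A →ₗ[ℝ] B →ₗ[ℝ] C) :
    (T [⋀^Fin i]→ₗ[ℝ] A) →ₗ[ℝ] (T [⋀^Fin k]→ₗ[ℝ] B) →ₗ[ℝ] (T [⋀^Fin (i + k)]→ₗ[ℝ] C) :=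
  (TensorProduct.mk ℝ (T [⋀^Fin i]→ₗ[ℝ] A) (T [⋀^Fin k]→ₗ[ℝ] B)).compr₂
    ((AlternatingMap.domDomCongrₗ ℝ finSumFinEquiv).toLinearMap ∘ₗ
      LinearMap.compAlternatingMapₗ ℝ (TensorProduct.lift f) ∘ₗ AlternatingMap.domCoprod')

/-- A linear map on `T`, regarded as an alternating map of one argument. -/
def oneForm (φ : T →ₗ[ℝ] A) : T [⋀^Fin 1]→ₗ[ℝ] A :=
  AlternatingMap.ofSubsingleton ℝ T A (0 : Fin 1) φ

variable {U : Type*} [AddCommGroup U] [Module ℝ U]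

/-- The coefficient `c` in `w = c • b₀ ∧ ⋯ ∧ bₙ₋₁`; it is unique if `b` is linearly independent,
and exists for every `w` of degree `n` if `b` is a basis. -/
def topCoeff {n : ℕ} (b : Fin n → U) (w : ExteriorAlgebra ℝ U) : ℝ :=
  open Classical in
  if h : ∃ c : ℝ, w = c • ExteriorAlgebra.ιMulti ℝ n b then h.choose else 0

/-- The inner product on `⋀² T* ⊗ U` that inner products `p` on `T` and `q` on `U` induce:
`½ ∑ p^{ac} p^{bd} q(α_{ab}, α'_{cd})`, where `(p^{ac})` is the inverse of the Gram matrix of `p`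
in the basis `u` of `T` (the choice of the basis is immaterial). The elements of `⋀² T* ⊗ U` are the
alternating maps with values in the degree one part of the exterior algebra of `U`. -/
def twoFormInner {n : ℕ} (u : Module.Basis (Fin n) ℝ T) (p : T → T → ℝ) (q : U →ₗ[ℝ] U →ₗ[ℝ] ℝ)
    (α α' : T [⋀^Fin 2]→ₗ[ℝ] ExteriorAlgebra ℝ U) : ℝ :=
  let G : Matrix (Fin n) (Fin n) ℝ := (Matrix.of fun a c => p (u a) (u c))⁻¹
  (1 / 2 : ℝ) * ∑ a, ∑ b, ∑ c, ∑ d, G a c * G b d *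
    q (ExteriorAlgebra.ιInv (α ![u a, u b])) (ExteriorAlgebra.ιInv (α' ![u c, u d]))

theorem twoFormInner_add {n : ℕ} (u : Module.Basis (Fin n) ℝ T) (p : T → T → ℝ)
    (q : U →ₗ[ℝ] U →ₗ[ℝ] ℝ) (a b r : T [⋀^Fin 2]→ₗ[ℝ] ExteriorAlgebra ℝ U) :
    twoFormInner u p q (a + b) r = twoFormInner u p q a r + twoFormInner u p q b r := by
  simp only [twoFormInner, AlternatingMap.add_apply, map_add, LinearMap.add_apply, mul_add,
    Finset.sum_add_distrib]

theorem twoFormInner_smul {n : ℕ} (u : Module.Basis (Fin n) ℝ T) (p : T → T → ℝ)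
    (q : U →ₗ[ℝ] U →ₗ[ℝ] ℝ) (c : ℝ) (a r : T [⋀^Fin 2]→ₗ[ℝ] ExteriorAlgebra ℝ U) :
    twoFormInner u p q (c • a) r = c * twoFormInner u p q a r := by
  simp only [twoFormInner, AlternatingMap.smul_apply, map_smul, LinearMap.smul_apply, smul_eq_mul,
    Finset.mul_sum]
  refine Finset.sum_congr rfl fun _ _ => Finset.sum_congr rfl fun _ _ =>
    Finset.sum_congr rfl fun _ _ => Finset.sum_congr rfl fun _ _ => by ring

end Algebra

/-! ### Differential forms on `M` with values in the exterior powers of a vector bundle -/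

/-- The model space of an `(N - 1)`-dimensional manifold, `N = m + 4`. -/
abbrev BaseModel (m : ℕ) : Type := EuclideanSpace ℝ (Fin (m + 3))

/-- The model fibre of a bundle of rank `N = m + 4`. -/
abbrev FibreModel (m : ℕ) : Type := EuclideanSpace ℝ (Fin (m + 4))

variable (m : ℕ) {M : Type*} [TopologicalSpace M] [ChartedSpace (BaseModel m) M]
  [IsManifold (𝓡 (m + 3)) ∞ M]
  (V : M → Type*) [∀ x, AddCommGroup (V x)] [∀ x, Module ℝ (V x)] [∀ x, TopologicalSpace (V x)]
  [TopologicalSpace (TotalSpace (FibreModel m) V)] [FiberBundle (FibreModel m) V]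
  [VectorBundle ℝ (FibreModel m) V]

/-- Fields of alternating `i`-forms on `M` with values in the exterior algebra of `V`, with no
condition on regularity or on the degree of the values. -/
abbrev FormField (i : ℕ) :=
  ∀ x : M, TangentSpace (𝓡 (m + 3)) x [⋀^Fin i]→ₗ[ℝ] ExteriorAlgebra ℝ (V x)

variable {m V}

/-- Smoothness: in the local trivializations of `TM` and of `V` all components are smooth
functions. -/
def IsSmoothField {i : ℕ} (φ : FormField m V i) : Prop :=
  ∀ (x₀ : M) (v : Fin i → BaseModel m)
    (l : ExteriorAlgebra ℝ (FibreModel m) →ₗ[ℝ] ℝ),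
    ContMDiffOn (𝓡 (m + 3)) 𝓘(ℝ, ℝ) ∞
      (fun x => l (ExteriorAlgebra.map
        ((trivializationAt (FibreModel m) V x₀).linearMapAt ℝ x)
        (φ x fun k => (trivializationAt (BaseModel m)
          (TangentSpace (𝓡 (m + 3)) : M → Type _) x₀).symmL ℝ x (v k))))
      ((trivializationAt (BaseModel m) (TangentSpace (𝓡 (m + 3)) : M → Type _) x₀).baseSet ∩
        (trivializationAt (FibreModel m) V x₀).baseSet)

variable (m V) in
/-- `Ω^{i,j}`: the smooth `i`-forms on `M` with values in `⋀^j V`. -/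
def Omega (i j : ℕ) : Submodule ℝ (FormField m V i) where
  carrier := {φ | (∀ x v, φ x v ∈ ⋀[ℝ]^j (V x)) ∧ IsSmoothField φ}
  zero_mem' := by
    refine ⟨fun x v => by simp, fun x₀ v l => ?_⟩
    simpa using contMDiffOn_const
  add_mem' := by
    rintro a b ⟨ha, ha'⟩ ⟨hb, hb'⟩
    refine ⟨fun x v => by simpa using add_mem (ha x v) (hb x v), fun x₀ v l => ?_⟩
    refine ((ha' x₀ v l).add (hb' x₀ v l)).congr fun x _ => ?_
    simp
  smul_mem' := by
    rintro c a ⟨ha, ha'⟩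
    refine ⟨fun x v => by simpa using Submodule.smul_mem _ c (ha x v), fun x₀ v l => ?_⟩
    have h := contMDiffOn_const (I := 𝓡 (m + 3)) (I' := 𝓘(ℝ, ℝ)) (n := ∞) (c := c)
      (s := (trivializationAt (BaseModel m) (TangentSpace (𝓡 (m + 3)) : M → Type _) x₀).baseSet ∩
        (trivializationAt (FibreModel m) V x₀).baseSet)
    refine (h.mul (ha' x₀ v l)).congr fun x _ => ?_
    simp

/-- The wedge product of an element of `Ω^{i,j}` with an element of `Ω^{k,l}`, taken on the form
part and on the internal part. The sign makes it graded commutative for the total degree: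
`α β = (-1)^{(i+j)(k+l)} β α`. -/
def wedge (i j k : ℕ) : FormField m V i →ₗ[ℝ] FormField m V k →ₗ[ℝ] FormField m V (i + k) :=
  LinearMap.mk₂ ℝ (fun α β x => (-1 : ℝ) ^ (j * k) •
      altProd i k (LinearMap.mul ℝ (ExteriorAlgebra ℝ (V x))) (α x) (β x))
    (fun _ _ _ => by
      ext1 x; simp only [Pi.add_apply, map_add, LinearMap.add_apply, smul_add])
    (fun _ _ _ => by
      ext1 x; simp only [Pi.smul_apply, map_smul, LinearMap.smul_apply]; rw [smul_comm])
    (fun _ _ _ => by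
      ext1 x; simp only [Pi.add_apply, map_add, smul_add])
    (fun _ _ _ => by
      ext1 x; simp only [Pi.smul_apply, map_smul]; rw [smul_comm])

/-- A field of linear maps `T_xM → V_x`, as a field of forms (a candidate element of
`Ω^{1,1}`). -/
def vecForm (φ : ∀ x : M, TangentSpace (𝓡 (m + 3)) x →ₗ[ℝ] V x) : FormField m V 1 :=
  fun x => oneForm (ExteriorAlgebra.ι ℝ ∘ₗ φ x)

/-- A field of linear forms on `TM`, as a field of forms (a candidate element of `Ω^{1,0}`). -/
def scalarForm (β : ∀ x : M, TangentSpace (𝓡 (m + 3)) x →ₗ[ℝ] ℝ) : FormField m V 1 :=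
  fun x => oneForm (Algebra.linearMap ℝ (ExteriorAlgebra ℝ (V x)) ∘ₗ β x)

/-- `X ↦ X ∧ e ∧ ⋯ ∧ e` (`k` factors) on forms of bidegree `(i, j)`. -/
def wedgePow (e : ∀ x : M, TangentSpace (𝓡 (m + 3)) x →ₗ[ℝ] V x) (i j : ℕ) :
    (k : ℕ) → FormField m V i →ₗ[ℝ] FormField m V (i + k)
  | 0 => LinearMap.id
  | k + 1 => (wedge (i + k) (j + k) 1).flip (vecForm e) ∘ₗ wedgePow e i j k

/-- The bracket `X ↦ [X, φ]` of `i`-forms with values in the exterior algebra of `V` with a field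
of linear maps `φ : TM → V`: an internal index of `X` (the last one) is contracted with `φ` by means
of the inner product `η`, and the form indices are antisymmetrized. -/
def bracket (η : ∀ x : M, V x →ₗ[ℝ] V x →ₗ[ℝ] ℝ)
    (φ : ∀ x : M, TangentSpace (𝓡 (m + 3)) x →ₗ[ℝ] V x) (i : ℕ) :
    FormField m V i →ₗ[ℝ] FormField m V (i + 1) :=
  LinearMap.pi fun x =>
    ((altProd i 1 (CliffordAlgebra.contractRight :
        ExteriorAlgebra ℝ (V x) →ₗ[ℝ] Module.Dual ℝ (V x) →ₗ[ℝ] ExteriorAlgebra ℝ (V x))).flip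
      (oneForm (η x ∘ₗ φ x))) ∘ₗ LinearMap.proj x

/-! ### Boundary fields -/

section Boundary

variable [∀ x, IsTopologicalAddGroup (V x)] [∀ x, ContinuousSMul ℝ (V x)]

variable (m V) in
/-- A smooth Lorentzian inner product `η` on the fibres of `V` (signature `(N - 1, 1)`), and a
boundary coframe `e`: a smooth injective bundle map `TM → V`. -/
structure BoundaryCoframe where
  /-- the Lorentzian inner product on the fibres -/
  η : ∀ x : M, V x →L[ℝ] V x →L[ℝ] ℝ
  η_symm : ∀ x u w, η x u w = η x w u
  η_lorentz : ∀ x, ∃ b : Module.Basis (Fin (m + 4)) ℝ (V x), ∀ i j,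
    η x (b i) (b j) = if i = j then (if i = 0 then -1 else 1) else 0
  η_smooth : ContMDiff (𝓡 (m + 3))
    ((𝓡 (m + 3)).prod 𝓘(ℝ, FibreModel m →L[ℝ] FibreModel m →L[ℝ] ℝ)) ∞
    (fun x => TotalSpace.mk' (FibreModel m →L[ℝ] FibreModel m →L[ℝ] ℝ) x (η x))
  /-- the coframe -/
  e : ∀ x : M, TangentSpace (𝓡 (m + 3)) x →ₗ[ℝ] V x
  e_smooth : vecForm e ∈ Omega m V 1 1
  e_injective : ∀ x, Function.Injective (e x)

namespace BoundaryCoframe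

variable (C : BoundaryCoframe m V)

/-- `η` as a field of bilinear forms. -/
def ηlin (x : M) : V x →ₗ[ℝ] V x →ₗ[ℝ] ℝ :=
  ContinuousLinearMap.coeLM ℝ ∘ₗ (C.η x).toLinearMap

/-- The induced (possibly degenerate) boundary metric `g = η(e, e)`. -/
def g (x : M) (u w : TangentSpace (𝓡 (m + 3)) x) : ℝ := C.η x (C.e x u) (C.e x w)

/-- The kernel of `W_k : Ω^{i,j} → Ω^{i+k,j+k}`, `X ↦ X ∧ e^k`. -/
def kerW (i j k : ℕ) : Submodule ℝ (FormField m V i) :=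
  Omega m V i j ⊓ LinearMap.ker (wedgePow C.e i j k)

/-- The image of `Ker (W_{N-3} : Ω^{1,2} → Ω^{N-2,N-1})` under `v ↦ [v, e]`. -/
def imRho : Submodule ℝ (FormField m V 2) :=
  (C.kerW 1 2 (m + 1)).map (bracket C.ηlin C.e 1)

end BoundaryCoframe

/-- The data from which `ẽ` is built, for a light-like boundary metric: a nowhere vanishing null
vector field `X` with `ι_X g = 0`, smooth local frames `Y¹, …, Y^{N-2}` that complete `X` to a frame
of `TM` (only the subbundle `H` which they span matters), and the one-form `β` that is normalized by
`ι_X β = 1` and by the vanishing of `ι_{Y¹} ⋯ ι_{Y^{N-2}} (ẽ ∧ e^{N-4} ∧ v)` for all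
`v ∈ Ω^{1,2}` with `e^{N-3} ∧ v = 0`, where `ẽ = e - β ι_X e`. -/
structure NullSplitting (C : BoundaryCoframe m V) where
  /-- the null vector field -/
  X : ∀ x : M, TangentSpace (𝓡 (m + 3)) x
  X_smooth : ContMDiff (𝓡 (m + 3)) (𝓡 (m + 3)).tangent ∞
    (fun x => (⟨x, X x⟩ : TangentBundle (𝓡 (m + 3)) M))
  X_ne_zero : ∀ x, X x ≠ 0
  X_null : ∀ x u, C.g x (X x) u = 0
  /-- the span of the vector fields `Yⁱ` -/
  H : ∀ x : M, Submodule ℝ (TangentSpace (𝓡 (m + 3)) x)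
  H_isCompl : ∀ x, IsCompl (Submodule.span ℝ {X x}) (H x)
  H_smooth : ∀ x₀ : M, ∃ U ∈ 𝓝 x₀, ∃ Y : Fin (m + 2) → ∀ x : M, TangentSpace (𝓡 (m + 3)) x,
    (∀ i, ContMDiffOn (𝓡 (m + 3)) (𝓡 (m + 3)).tangent ∞
      (fun x => (⟨x, Y i x⟩ : TangentBundle (𝓡 (m + 3)) M)) U) ∧
    ∀ x ∈ U, Submodule.span ℝ (range fun i => Y i x) = H x
  /-- the one-form dual to `X` -/
  β : ∀ x : M, TangentSpace (𝓡 (m + 3)) x →ₗ[ℝ] ℝ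
  β_smooth : scalarForm β ∈ Omega m V 1 0
  β_X : ∀ x, β x (X x) = 1
  β_normalized : ∀ v ∈ C.kerW 1 2 (m + 1), ∀ (x : M)
    (u : Fin (1 + m + 1) → TangentSpace (𝓡 (m + 3)) x), (∀ k, u k ∈ H x) →
    wedge (1 + m) (1 + m) 1
      (wedgePow C.e 1 1 m (vecForm fun y => C.e y - (β y).smulRight (C.e y (X y)))) v x u = 0

namespace NullSplitting

variable {C : BoundaryCoframe m V} (P : NullSplitting C)

/-- `ẽ = e - β ι_X e`. -/
def eTilde (x : M) : TangentSpace (𝓡 (m + 3)) x →ₗ[ℝ] V x :=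
  C.e x - (P.β x).smulRight (C.e x (P.X x))

/-- `𝒮 = Ker (W_1 : Ω^{N-3,N-1} → Ω^{N-2,N}) ∩ Ker (τ ↦ [τ, ẽ])`. -/
def S : Submodule ℝ (FormField m V (m + 1)) :=
  C.kerW (m + 1) (m + 3) 1 ⊓ LinearMap.ker (bracket C.ηlin P.eTilde (m + 1))

end NullSplitting

/-- A section `e_n` of `V` that completes `e(TM)` to `V` and is `η`-orthogonal to `e(H)`, and
a Riemannian metric on `M` (arbitrary) together with its extension to the fibres of `V`,
for which `e` is isometric and `e_n` is orthogonal to `e(TM)`. -/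
structure AdaptedMetric {C : BoundaryCoframe m V} (P : NullSplitting C) where
  /-- the transversal section -/
  en : ∀ x : M, V x
  en_smooth : ContMDiff (𝓡 (m + 3)) ((𝓡 (m + 3)).prod 𝓘(ℝ, FibreModel m)) ∞
    (fun x => TotalSpace.mk' (FibreModel m) x (en x))
  en_transversal : ∀ x, en x ∉ LinearMap.range (C.e x)
  en_orthogonal : ∀ x, ∀ u ∈ P.H x, C.η x (en x) (C.e x u) = 0
  /-- the Riemannian metric on `M` -/
  base : ContMDiffRiemannianMetric (𝓡 (m + 3)) ∞ (BaseModel m)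
    (TangentSpace (𝓡 (m + 3)) : M → Type _)
  /-- its extension to the fibres of `V` -/
  fibre : ContMDiffRiemannianMetric (𝓡 (m + 3)) ∞ (FibreModel m) V
  fibre_e : ∀ x u w, fibre.inner x (C.e x u) (C.e x w) = base.inner x u w
  fibre_en : ∀ x u, fibre.inner x (C.e x u) (en x) = 0

namespace AdaptedMetric

variable {C : BoundaryCoframe m V} {P : NullSplitting C} (Q : AdaptedMetric P)

/-- The pointwise inner product of elements of `Ω^{2,1}`. -/
def inner (α α' : FormField m V 2) (x : M) : ℝ :=
  twoFormInner (T := TangentSpace (𝓡 (m + 3)) x)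
    (EuclideanSpace.basisFun (Fin (m + 3)) ℝ).toBasis (fun u w => Q.base.inner x u w) 
    (ContinuousLinearMap.coeLM ℝ ∘ₗ (Q.fibre.inner x).toLinearMap) (α x) (α' x)

/-- `J`: the orthogonal complement in `Ω^{2,1}` of the image of
`Ker (W_{N-3} : Ω^{1,2} → Ω^{N-2,N-1})` under `v ↦ [v, e]`. -/
def J : Submodule ℝ (FormField m V 2) where
  carrier := {α | α ∈ Omega m V 2 1 ∧ ∀ ρ ∈ C.imRho, ∀ x, Q.inner α ρ x = 0}
  zero_mem' := ⟨zero_mem _, fun ρ _ x => by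
    have h : Q.inner ((0 : ℝ) • 0) ρ x = 0 * Q.inner 0 ρ x := twoFormInner_smul _ _ _ _ _ _
    simpa using h⟩
  add_mem' := by
    rintro a b ⟨ha, ha'⟩ ⟨hb, hb'⟩
    refine ⟨add_mem ha hb, fun ρ hρ x => ?_⟩
    have h : Q.inner (a + b) ρ x = Q.inner a ρ x + Q.inner b ρ x := twoFormInner_add _ _ _ _ _ _
    rw [h, ha' ρ hρ x, hb' ρ hρ x, add_zero]
  smul_mem' := by
    rintro c a ⟨ha, ha'⟩
    refine ⟨Submodule.smul_mem _ c ha, fun ρ hρ x => ?_⟩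
    have h : Q.inner (c • a) ρ x = c * Q.inner a ρ x := twoFormInner_smul _ _ _ _ _ _
    rw [h, ha' ρ hρ x, mul_zero]

/-- `𝒯 = Ker (W_{N-3} : Ω^{2,1} → Ω^{N-1,N-2}) ∩ J`. -/
def T : Submodule ℝ (FormField m V 2) := C.kerW 2 1 (m + 1) ⊓ Q.J

/-- `θ = p_𝒯(α)`: `θ` is the orthogonal projection of `α ∈ Ω^{2,1}` to `𝒯`. -/
def IsProjT (α θ : FormField m V 2) : Prop :=
  θ ∈ Q.T ∧ ∀ θ' ∈ Q.T, ∀ x, Q.inner (α - θ) θ' x = 0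

/-! The integral over `M` of elements of `Ω^{N-1,N}`. -/

/-- Let `c : ℝ` be such that `φ(∂₁, …, ∂_{N-1}) = c • e(∂₁) ∧ ⋯ ∧ e(∂_{N-1}) ∧ e_n`, where `∂` is the
coordinate frame of the chart at `i`. The density of `φ ∈ Ω^{N-1,N}` in this chart is `c` times the
`η`-volume of `(e(∂₁), …, e(∂_{N-1}), e_n)`. This is the identification of `Ω^{N-1,N}` with the
densities on `M` for which `(e(∂₁), …, e(∂_{N-1}), e_n)` is a positive frame of `V` whenever `∂` is
a positive frame of `TM`; a change of the orientation of the chart changes neither the density nor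
the sign of its integral. -/
def density (φ : FormField m V (m + 3)) (i x : M) : ℝ :=
  let d : Fin (m + 3) → TangentSpace (𝓡 (m + 3)) x := fun k =>
    (trivializationAt (BaseModel m) (TangentSpace (𝓡 (m + 3)) : M → Type _) i).symmL ℝ x
      (EuclideanSpace.single k (1 : ℝ))
  let f : Fin (m + 4) → V x := Fin.snoc (fun k => C.e x (d k)) (Q.en x)
  topCoeff f (φ x d) * √|(Matrix.of fun a b => C.η x (f a) (f b)).det|

variable [T2Space M] [SigmaCompactSpace M]

/-- The integral over `M` of a compactly supported element of `Ω^{N-1,N}`: its density is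
integrated in charts, by means of a smooth partition of unity subordinate to the atlas. -/
def integral (φ : FormField m V (m + 3)) : ℝ :=
  let ρ := (SmoothPartitionOfUnity.exists_isSubordinate_chartAt_source (𝓡 (m + 3)) M).choose
  ∑ᶠ i : M, ∫ y in (chartAt (BaseModel m) i).target,
    ρ i ((chartAt (BaseModel m) i).symm y) * Q.density φ i ((chartAt (BaseModel m) i).symm y)

end AdaptedMetric

/-- The support of a field of forms is relatively compact. -/
def CompactlySupported {i : ℕ} (φ : FormField m V i) : Prop := IsCompact (closure {x | φ x ≠ 0})

end Boundary

end PalatiniCartan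

end

/-! Fix θ ∈ 𝒯. Raising its indices with the auxiliary metrics gives a tensor K^{cdA}, antisymmetric
in c and d, for which ∑ K^{cdA} α_{cdA} is a positive multiple of the pointwise inner product ⟨α,
θ⟩. Contracting the volume elements of T and V with K turns it into the form τ = ∑ K^{cdA} (ι_d ι_c
vol_T) ⊗ (vol_V ⌊ f^A) of bidegree (N-3, N-1), and τ ∧ α is the same multiple of ⟨α, θ⟩ times the
volume (`dualForm_wedge_two`). The heart of the matter is that τ lies in 𝒮.

The equation τ ∧ e = 0 holds once K is trace-free. The condition θ ∧ e^{N-3} = 0 forces θ to take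
values in e(TΣ) and to be trace-free (`two_form_of_symb_mul_eq_zero`), and raising the indices
preserves this (`dualTensor_trace`).

The equation [τ, ẽ] = 0 holds once ∑_d K^{cdA} η(ẽ_d, f_B) is symmetric in A and B. For tangential A
and B, ẽ may be replaced by e because X is null, and the symmetry is the orthogonality of θ to the
brackets [v, e], tested on trace-free v (`dualTensor_symm`). If A or B belongs to e_n, both sides
vanish: K has no e_n component, and η(ẽ, e_n) = 0. The latter holds because the normalization of β
makes β vanish on H (`beta_eq_zero`), so that ẽ takes values in e(H).

Both conditions are pointwise, so τ may be multiplied by functions. With a bump function χ and the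
test form χ⟨α, θ⟩τ, the hypothesis says that the integral of a positive multiple of χ⟨α, θ⟩²
vanishes. Hence α is orthogonal to 𝒯 at every point (`inner_eq_zero_of_integral`), so 0 is a
projection of α, and by positive definiteness it is the only one.

The algebra takes place in ⋀(T* ⊕ V). There the coframe becomes an even, hence central, element E
with ι_t E = e(t), and identities follow by contracting products that vanish for reasons of degree.
-/

set_option linter.unusedSectionVars false

noncomputable section

namespace PalatiniCartan

/-! ### Exterior algebras: degrees, signs, naturality of contractions -/

section ExteriorGeneralities

variable {U U' : Type*} [AddCommGroup U] [Module ℝ U] [AddCommGroup U'] [Module ℝ U']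

theorem ι_mem_exteriorPower_one (u : U) : ExteriorAlgebra.ι ℝ u ∈ ⋀[ℝ]^1 U := by
  change _ ∈ LinearMap.range (ExteriorAlgebra.ι ℝ : U →ₗ[ℝ] _) ^ 1
  rw [pow_one]; exact LinearMap.mem_range_self _ _

theorem mul_mem_exteriorPower {i j : ℕ} {x y : ExteriorAlgebra ℝ U} (hx : x ∈ ⋀[ℝ]^i U)
    (hy : y ∈ ⋀[ℝ]^j U) : x * y ∈ ⋀[ℝ]^(i + j) U := by
  change x * y ∈ LinearMap.range (ExteriorAlgebra.ι ℝ : U →ₗ[ℝ] _) ^ (i + j)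
  rw [pow_add]; exact Submodule.mul_mem_mul hx hy

theorem map_mem_exteriorPower (f : U →ₗ[ℝ] U') {j : ℕ} {x : ExteriorAlgebra ℝ U}
    (hx : x ∈ ⋀[ℝ]^j U) : ExteriorAlgebra.map f x ∈ ⋀[ℝ]^j U' := by
  rw [← ExteriorAlgebra.ιMulti_span_fixedDegree] at hx
  induction hx using Submodule.span_induction with
  | mem x h =>
    obtain ⟨v, rfl⟩ := h
    rw [ExteriorAlgebra.map_apply_ιMulti]
    exact ExteriorAlgebra.ιMulti_range ℝ j (mem_range_self _)
  | zero => simp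
  | add x y _ _ hx hy => rw [map_add]; exact add_mem hx hy
  | smul c x _ hx => rw [map_smul]; exact Submodule.smul_mem _ c hx

theorem ιMulti_mem_exteriorPower {j : ℕ} (v : Fin j → U) :
    ExteriorAlgebra.ιMulti ℝ j v ∈ ⋀[ℝ]^j U :=
  ExteriorAlgebra.ιMulti_range ℝ j (mem_range_self _)

theorem ι_mul_ι_comm (u w : U) : ExteriorAlgebra.ι ℝ u * ExteriorAlgebra.ι ℝ w =
    -(ExteriorAlgebra.ι ℝ w * ExteriorAlgebra.ι ℝ u) :=
  eq_neg_of_add_eq_zero_left (ExteriorAlgebra.ι_add_mul_swap u w)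

theorem mul_ι_of_mem {j : ℕ} {x : ExteriorAlgebra ℝ U} (hx : x ∈ ⋀[ℝ]^j U) (u : U) :
    x * ExteriorAlgebra.ι ℝ u = (-1 : ℝ) ^ j • (ExteriorAlgebra.ι ℝ u * x) := by
  rw [← ExteriorAlgebra.ιMulti_span_fixedDegree] at hx
  induction hx using Submodule.span_induction with
  | mem x h =>
    obtain ⟨v, rfl⟩ := h
    induction j with
    | zero => simp [ExteriorAlgebra.ιMulti_zero_apply]
    | succ j ih =>
      rw [ExteriorAlgebra.ιMulti_succ_apply, mul_assoc, ih, mul_smul_comm, ← mul_assoc,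
        ι_mul_ι_comm, pow_succ, mul_smul, neg_one_smul, neg_mul, mul_assoc]
  | zero => simp
  | add x y _ _ hx hy => rw [add_mul, hx, hy, mul_add, smul_add]
  | smul c x _ hx => rw [smul_mul_assoc, hx, mul_smul_comm, smul_comm]

theorem mul_ιMulti_of_mem {j k : ℕ} {x : ExteriorAlgebra ℝ U} (hx : x ∈ ⋀[ℝ]^j U)
    (v : Fin k → U) : x * ExteriorAlgebra.ιMulti ℝ k v =
      (-1 : ℝ) ^ (j * k) • (ExteriorAlgebra.ιMulti ℝ k v * x) := by
  induction k with
  | zero => simp [ExteriorAlgebra.ιMulti_zero_apply]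
  | succ k ih =>
    rw [ExteriorAlgebra.ιMulti_succ_apply, ← mul_assoc, mul_ι_of_mem hx, smul_mul_assoc,
      mul_assoc, ih, mul_smul_comm, smul_smul, ← mul_assoc]
    congr 2
    ring

/-- The contraction of the last factors of a product of vectors with a linear form. -/
theorem contractRight_mem_exteriorPower {j : ℕ} {x : ExteriorAlgebra ℝ U}
    (hx : x ∈ ⋀[ℝ]^(j + 1) U) (d : Module.Dual ℝ U) :
    CliffordAlgebra.contractRight x d ∈ ⋀[ℝ]^j U := by
  change x ∈ LinearMap.range (ExteriorAlgebra.ι ℝ : U →ₗ[ℝ] _) ^ (j + 1) at hx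
  rw [pow_succ] at hx
  induction hx using Submodule.mul_induction_on' with
  | mem_mul_mem y hy w hw =>
    obtain ⟨u, rfl⟩ := hw
    have h : CliffordAlgebra.contractRight (y * ExteriorAlgebra.ι ℝ u) d =
      d u • y - CliffordAlgebra.contractRight y d * ExteriorAlgebra.ι ℝ u :=
        CliffordAlgebra.contractRight_mul_ι _ _ _
    rw [h]
    refine sub_mem (Submodule.smul_mem _ _ hy) ?_
    -- Contraction lowers the degree of y as well; this needs an induction of its own, starting from
    -- scalars, whose contraction is zero.
    clear h
    induction j generalizing y u with
    | zero =>
      rw [pow_zero, Submodule.mem_one] at hy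
      obtain ⟨r, rfl⟩ := hy
      have : CliffordAlgebra.contractRight (algebraMap ℝ (ExteriorAlgebra ℝ U) r) d = 0 :=
        CliffordAlgebra.contractRight_algebraMap (Q := (0 : QuadraticForm ℝ U)) d r
      rw [this]; simp
    | succ j ih =>
      refine mul_mem_exteriorPower ?_ (ι_mem_exteriorPower_one u)
      change y ∈ LinearMap.range (ExteriorAlgebra.ι ℝ : U →ₗ[ℝ] _) ^ (j + 1) at hy
      rw [pow_succ] at hy
      induction hy using Submodule.mul_induction_on' with
      | mem_mul_mem z hz w hw =>
        obtain ⟨u', rfl⟩ := hw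
        have h : CliffordAlgebra.contractRight (z * ExteriorAlgebra.ι ℝ u') d =
          d u' • z - CliffordAlgebra.contractRight z d * ExteriorAlgebra.ι ℝ u' :=
            CliffordAlgebra.contractRight_mul_ι _ _ _
        rw [h]
        exact sub_mem (Submodule.smul_mem _ _ hz) (ih z hz u')
      | add a _ b _ ha hb => rw [map_add]; exact add_mem ha hb
  | add a _ b _ ha hb => rw [map_add]; exact add_mem ha hb

theorem contractRight_map (f : U →ₗ[ℝ] U') (x : ExteriorAlgebra ℝ U) (d : Module.Dual ℝ U') :
    CliffordAlgebra.contractRight (ExteriorAlgebra.map f x) d =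
      ExteriorAlgebra.map f (CliffordAlgebra.contractRight x (d ∘ₗ f)) := by
  induction x using CliffordAlgebra.right_induction with
  | algebraMap r =>
    have h1 := CliffordAlgebra.contractRight_algebraMap (Q := (0 : QuadraticForm ℝ U')) d r
    have h2 := CliffordAlgebra.contractRight_algebraMap (Q := (0 : QuadraticForm ℝ U)) (d ∘ₗ f) r
    rw [AlgHom.commutes, h1, h2, map_zero]
  | add x y hx hy => simp only [map_add, LinearMap.add_apply, hx, hy]
  | mul_ι u x hx =>
    have h1 := CliffordAlgebra.contractRight_mul_ι (Q := (0 : QuadraticForm ℝ U')) d (f u)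
      (ExteriorAlgebra.map f x)
    have h2 := CliffordAlgebra.contractRight_mul_ι (Q := (0 : QuadraticForm ℝ U)) (d ∘ₗ f) u x
    have h3 : ExteriorAlgebra.map f (x * CliffordAlgebra.ι 0 u) =
      ExteriorAlgebra.map f x * CliffordAlgebra.ι 0 (f u) := by
      rw [map_mul]; congr 1; exact ExteriorAlgebra.map_apply_ι f u
    have h4 : ExteriorAlgebra.map f (CliffordAlgebra.ι 0 u) = CliffordAlgebra.ι 0 (f u) :=
      ExteriorAlgebra.map_apply_ι f u
    rw [h3, h1, h2, map_sub, map_smul, map_mul, hx, h4]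
    rfl

theorem contractLeft_map (f : U →ₗ[ℝ] U') (x : ExteriorAlgebra ℝ U) (d : Module.Dual ℝ U') :
    CliffordAlgebra.contractLeft d (ExteriorAlgebra.map f x) =
      ExteriorAlgebra.map f (CliffordAlgebra.contractLeft (d ∘ₗ f) x) := by
  induction x using CliffordAlgebra.left_induction with
  | algebraMap r =>
    have h1 := CliffordAlgebra.contractLeft_algebraMap (Q := (0 : QuadraticForm ℝ U')) d r
    have h2 := CliffordAlgebra.contractLeft_algebraMap (Q := (0 : QuadraticForm ℝ U)) (d ∘ₗ f) r
    rw [AlgHom.commutes, h1, h2, map_zero]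
  | add x y hx hy => simp only [map_add, hx, hy]
  | ι_mul x u hx =>
    have h1 := CliffordAlgebra.contractLeft_ι_mul (Q := (0 : QuadraticForm ℝ U')) d (f u)
      (ExteriorAlgebra.map f x)
    have h2 := CliffordAlgebra.contractLeft_ι_mul (Q := (0 : QuadraticForm ℝ U)) (d ∘ₗ f) u x
    have h4 : ExteriorAlgebra.map f (CliffordAlgebra.ι 0 u) = CliffordAlgebra.ι 0 (f u) :=
      ExteriorAlgebra.map_apply_ι f u
    rw [map_mul, h4, h1, h2, map_sub, map_smul, map_mul, hx, h4]
    rfl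

end ExteriorGeneralities

/-! ### Products of alternating maps as sums over permutations -/

section AltProd

variable {T : Type*} [AddCommGroup T] [Module ℝ T]
variable {A B C : Type*} [AddCommGroup A] [Module ℝ A] [AddCommGroup B] [Module ℝ B]
  [AddCommGroup C] [Module ℝ C]

/-- The coproduct of alternating maps is a sum over shuffles, that is, over cosets of permutations.
The factor i! k! replaces it by a sum over all permutations, free of coset representatives. -/
theorem factorial_smul_altProd_apply (i k : ℕ) (f : A →ₗ[ℝ] B →ₗ[ℝ] C)
    (α : T [⋀^Fin i]→ₗ[ℝ] A) (β : T [⋀^Fin k]→ₗ[ℝ] B) (t : Fin (i + k) → T) :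
    ((i.factorial * k.factorial : ℕ) : ℝ) • altProd i k f α β t =
      ∑ σ : Equiv.Perm (Fin i ⊕ Fin k), (Equiv.Perm.sign σ : ℤ) •
        f (α fun a => t (finSumFinEquiv (σ (Sum.inl a))))
          (β fun a => t (finSumFinEquiv (σ (Sum.inr a)))) := by
  have h := MultilinearMap.domCoprod_alternization_eq α β
  have h' := congrArg (fun ψ => TensorProduct.lift f (ψ fun a => t (finSumFinEquiv a))) h
  simp only [Fintype.card_fin, AlternatingMap.smul_apply, map_nsmul] at h'
  rw [Nat.cast_smul_eq_nsmul]
  refine Eq.trans ?_ (h'.symm.trans ?_)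
  · rfl
  · rw [MultilinearMap.alternatization_apply, map_sum]
    refine Finset.sum_congr rfl fun σ _ => ?_
    rw [Units.smul_def, map_zsmul]
    rfl

theorem altProd_mem (i k : ℕ) (f : A →ₗ[ℝ] B →ₗ[ℝ] C) (S : Submodule ℝ C)
    {α : T [⋀^Fin i]→ₗ[ℝ] A} {β : T [⋀^Fin k]→ₗ[ℝ] B}
    (h : ∀ s t, f (α s) (β t) ∈ S) (t : Fin (i + k) → T) : altProd i k f α β t ∈ S := by
  have hne : ((i.factorial * k.factorial : ℕ) : ℝ) ≠ 0 := by positivity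
  rw [← Submodule.smul_mem_iff S hne, factorial_smul_altProd_apply]
  exact sum_mem fun σ _ => S.smul_of_tower_mem _ (h _ _)

theorem altProd_one_one_apply (f : A →ₗ[ℝ] B →ₗ[ℝ] C) (α : T [⋀^Fin 1]→ₗ[ℝ] A)
    (φ : T →ₗ[ℝ] B) (t : Fin 2 → T) :
    altProd 1 1 f α (oneForm φ) t =
      f (α fun _ => t 0) (φ (t 1)) - f (α fun _ => t 1) (φ (t 0)) := by
  have h := factorial_smul_altProd_apply 1 1 f α (oneForm φ) t
  simp only [Nat.factorial_one, mul_one, Nat.cast_one, one_smul] at h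
  rw [h, ← (Equiv.permCongr finSumFinEquiv.symm).sum_comp]
  have hu : (Finset.univ : Finset (Equiv.Perm (Fin (1 + 1)))) = {1, Equiv.swap 0 1} := by decide
  rw [hu, Finset.sum_pair (by decide)]
  have hs : Equiv.Perm.sign (Equiv.swap (0 : Fin (1 + 1)) 1) = -1 := by decide
  simp only [Equiv.Perm.sign_permCongr, hs, Equiv.permCongr_apply, Equiv.symm_symm, map_one,
    oneForm, Units.val_one, one_smul, Units.val_neg, neg_smul, ← sub_eq_add_neg,
    Equiv.Perm.one_apply, Equiv.apply_symm_apply]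
  have e0 : ∀ a : Fin 1, finSumFinEquiv (Sum.inl a : Fin 1 ⊕ Fin 1) = 0 := by decide
  have e1 : ∀ a : Fin 1, finSumFinEquiv (Sum.inr a : Fin 1 ⊕ Fin 1) = 1 := by decide
  simp only [e0, e1, Equiv.swap_apply_left, Equiv.swap_apply_right]
  rfl

end AltProd

/-! ### Symbols: forms on T with values in ⋀V as elements of ⋀(T* ⊕ V) -/

section Symbol

variable {n : ℕ} {T V : Type*} [AddCommGroup T] [Module ℝ T] [AddCommGroup V] [Module ℝ V]

/-- The exterior algebra of `T* ⊕ V`, in which forms on `T` with values in `⋀ V` are multiplied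
with the signs of the total degree. -/
abbrev SymbolAlgebra (T V : Type*) [AddCommGroup T] [Module ℝ T] [AddCommGroup V] [Module ℝ V] :
    Type _ := ExteriorAlgebra ℝ (Module.Dual ℝ T × V)

/-- A linear form on `T` as an element of the symbol algebra. -/
def covec (φ : Module.Dual ℝ T) : SymbolAlgebra T V := ExteriorAlgebra.ι ℝ (φ, (0 : V))

/-- A vector of `V` as an element of the symbol algebra. -/
def vec (v : V) : SymbolAlgebra T V := ExteriorAlgebra.ι ℝ ((0 : Module.Dual ℝ T), v)

variable (T V) in
/-- The inclusion of `⋀ V` in the symbol algebra. -/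
def internal : ExteriorAlgebra ℝ V →ₐ[ℝ] SymbolAlgebra T V :=
  ExteriorAlgebra.map (LinearMap.inr ℝ (Module.Dual ℝ T) V)

/-- The contraction of the form part with a vector of `T`. -/
def contr (t : T) : SymbolAlgebra T V →ₗ[ℝ] SymbolAlgebra T V :=
  CliffordAlgebra.contractLeft (Module.Dual.eval ℝ T t ∘ₗ LinearMap.fst ℝ (Module.Dual ℝ T) V)

@[simp] theorem internal_ι (v : V) : internal T V (ExteriorAlgebra.ι ℝ v) = vec v :=
  ExteriorAlgebra.map_apply_ι _ _

theorem internal_injective : Function.Injective (internal T V) :=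
  ExteriorAlgebra.map_injective ⟨LinearMap.snd ℝ _ _, by ext; simp⟩

@[simp] theorem contr_covec_mul (t : T) (φ : Module.Dual ℝ T) (x : SymbolAlgebra T V) :
    contr t (covec φ * x) = φ t • x - covec φ * contr t x :=
  CliffordAlgebra.contractLeft_ι_mul _ _ _

@[simp] theorem contr_vec_mul (t : T) (v : V) (x : SymbolAlgebra T V) :
    contr t (vec v * x) = -(vec v * contr t x) := by
  refine (CliffordAlgebra.contractLeft_ι_mul _ _ _).trans ?_
  simp [contr, vec]

@[simp] theorem contr_internal (t : T) (a : ExteriorAlgebra ℝ V) :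
    contr t (internal T V a) = 0 := by
  rw [contr, internal, contractLeft_map]
  have : (Module.Dual.eval ℝ T t ∘ₗ LinearMap.fst ℝ (Module.Dual ℝ T) V) ∘ₗ
    LinearMap.inr ℝ (Module.Dual ℝ T) V = 0 := by ext; simp
  rw [this]; simp

@[simp] theorem contr_one (t : T) : contr t (1 : SymbolAlgebra T V) = 0 :=
  CliffordAlgebra.contractLeft_one (Q := (0 : QuadraticForm ℝ (Module.Dual ℝ T × V))) _

theorem covec_mul_covec (φ ψ : Module.Dual ℝ T) :
    (covec φ * covec ψ : SymbolAlgebra T V) = -(covec ψ * covec φ) := ι_mul_ι_comm _ _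

theorem vec_mul_vec (v w : V) : (vec v * vec w : SymbolAlgebra T V) = -(vec w * vec v) :=
  ι_mul_ι_comm _ _

theorem vec_mul_covec (v : V) (φ : Module.Dual ℝ T) :
    (vec v * covec φ : SymbolAlgebra T V) = -(covec φ * vec v) := ι_mul_ι_comm _ _

@[simp] theorem vec_mul_self (v : V) : (vec v * vec v : SymbolAlgebra T V) = 0 :=
  ExteriorAlgebra.ι_sq_zero _

theorem vec_add (v w : V) : (vec (v + w) : SymbolAlgebra T V) = vec v + vec w := by
  simp only [← internal_ι, map_add]

theorem vec_smul (c : ℝ) (v : V) : (vec (c • v) : SymbolAlgebra T V) = c • vec v := by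
  simp only [← internal_ι, map_smul]

/-- A product of basis one-forms. -/
def covecProd (b : Module.Basis (Fin n) ℝ T) {i : ℕ} (c : Fin i → Fin n) : SymbolAlgebra T V :=
  ExteriorAlgebra.ιMulti ℝ i fun k => (b.coord (c k), (0 : V))

variable (b : Module.Basis (Fin n) ℝ T)

theorem covecProd_cons {i : ℕ} (a : Fin n) (c : Fin i → Fin n) :
    (covecProd b (Fin.cons a c : Fin (i + 1) → Fin n) : SymbolAlgebra T V) =
      covec (b.coord a) * covecProd b c := by
  rw [covecProd, ExteriorAlgebra.ιMulti_succ_apply]; rfl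

theorem covecProd_mem {i : ℕ} (c : Fin i → Fin n) :
    (covecProd b c : SymbolAlgebra T V) ∈ ⋀[ℝ]^i (Module.Dual ℝ T × V) :=
  ιMulti_mem_exteriorPower _

theorem covecProd_eq_zero {i : ℕ} (c : Fin i → Fin n) (h : ¬Function.Injective c) :
    (covecProd b c : SymbolAlgebra T V) = 0 := by
  refine ExteriorAlgebra.ιMulti_eq_zero_of_not_inj fun h' => h fun x y hxy => h' ?_
  simp only [hxy]

/-- The symbol of a form on `T` with values in `⋀ V`. -/
def symb {i : ℕ} : (T [⋀^Fin i]→ₗ[ℝ] ExteriorAlgebra ℝ V) →ₗ[ℝ] SymbolAlgebra T V where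
  toFun A := (i.factorial : ℝ)⁻¹ • ∑ c : Fin i → Fin n, covecProd b c * internal T V (A (b ∘ c))
  map_add' A B := by
    simp only [AlternatingMap.add_apply, map_add, mul_add, Finset.sum_add_distrib, smul_add]
  map_smul' r A := by
    simp only [AlternatingMap.smul_apply, map_smul, mul_smul_comm, ← Finset.smul_sum]
    rw [smul_comm, RingHom.id_apply]

theorem symb_apply {i : ℕ} (A : T [⋀^Fin i]→ₗ[ℝ] ExteriorAlgebra ℝ V) : symb b A =
    (i.factorial : ℝ)⁻¹ • ∑ c : Fin i → Fin n, covecProd b c * internal T V (A (b ∘ c)) := rfl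

theorem symb_zero (A : T [⋀^Fin 0]→ₗ[ℝ] ExteriorAlgebra ℝ V) (t : Fin 0 → T) :
    symb b A = internal T V (A t) := by
  rw [symb_apply]
  simp [covecProd, ExteriorAlgebra.ιMulti_zero_apply, Subsingleton.elim _ t]

/-- Splitting off the first index gives a recursion on the form degree, on which the induction for
`contr_symb` rests. -/
theorem symb_succ {i : ℕ} (A : T [⋀^Fin (i + 1)]→ₗ[ℝ] ExteriorAlgebra ℝ V) : symb b A =
    ((i + 1 : ℝ))⁻¹ • ∑ a, covec (b.coord a) * symb b (A.curryLeft (b a)) := by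
  simp only [symb_apply]
  rw [← (Fin.consEquiv fun _ => Fin n).sum_comp, Fintype.sum_prod_type, Nat.factorial_succ,
    Nat.cast_mul, mul_inv, mul_smul]
  push_cast
  congr 1
  rw [Finset.smul_sum]
  refine Finset.sum_congr rfl fun a _ => ?_
  rw [mul_smul_comm, Finset.mul_sum]
  congr 1
  refine Finset.sum_congr rfl fun c _ => ?_
  rw [← mul_assoc, ← covecProd_cons]
  simp only [Fin.consEquiv, AlternatingMap.curryLeft_apply_apply]
  congr 3
  funext k
  refine Fin.cases ?_ (fun _ => ?_) k <;> simp [Matrix.vecCons]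

theorem contr_symb_zero (t : T) (A : T [⋀^Fin 0]→ₗ[ℝ] ExteriorAlgebra ℝ V) :
    contr t (symb b A) = 0 := by
  rw [symb_zero b A 0, contr_internal]

theorem contr_symb {i : ℕ} (t : T) (A : T [⋀^Fin (i + 1)]→ₗ[ℝ] ExteriorAlgebra ℝ V) :
    contr t (symb b A) = symb b (A.curryLeft t) := by
  have key : ∀ {i : ℕ} (A : T [⋀^Fin (i + 1)]→ₗ[ℝ] ExteriorAlgebra ℝ V),
      ∑ a, (b.coord a t) • symb b (A.curryLeft (b a)) = symb b (A.curryLeft t) := by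
    intro i A
    conv_rhs => rw [← b.sum_repr t]
    simp only [map_sum, map_smul, Module.Basis.coord_apply]
  induction i with
  | zero =>
    rw [symb_succ, map_smul, map_sum]
    simp only [contr_covec_mul, contr_symb_zero, mul_zero, sub_zero, key]
    simp
  | succ i ih =>
    rw [symb_succ, map_smul, map_sum]
    simp only [contr_covec_mul, ih, Finset.sum_sub_distrib, key]
    -- Exchanging the first two arguments costs a sign, so the second term of the Leibniz rule
    -- contributes i + 1 further copies of the symbol of `A.curryLeft t`.
    have h : ∀ a, (A.curryLeft (b a)).curryLeft t = -(A.curryLeft t).curryLeft (b a) := by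
      intro a
      ext v
      simp only [AlternatingMap.curryLeft_apply_apply, AlternatingMap.neg_apply]
      have := A.map_swap (Matrix.vecCons (b a) (Matrix.vecCons t v)) (i := 0) (j := 1) (by simp)
      rw [← neg_eq_iff_eq_neg, ← this]
      congr 1
      funext k
      refine Fin.cases ?_ (fun k => Fin.cases ?_ (fun k => ?_) k) k
      · simp
      · simp
      · simp [Equiv.swap_apply_of_ne_of_ne, Fin.ext_iff]
    simp only [h, map_neg, mul_neg, Finset.sum_neg_distrib, sub_neg_eq_add]
    have h2 := symb_succ b (A.curryLeft t)
    have h3 : ∑ a, covec (b.coord a) * symb b ((A.curryLeft t).curryLeft (b a)) =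
        ((i : ℝ) + 1) • symb b (A.curryLeft t) := by
      rw [h2, smul_smul, mul_inv_cancel₀ (by positivity), one_smul]
    rw [h3]
    have h4 : symb b (A.curryLeft t) + ((i : ℝ) + 1) • symb b (A.curryLeft t) =
      (((i + 1 : ℕ) : ℝ) + 1) • symb b (A.curryLeft t) := by
      push_cast; module
    rw [h4, smul_smul, inv_mul_cancel₀ (by positivity), one_smul]

/-- Contractions of the symbol recover the values of the form by `contr_symb`. Equality of forms may
therefore be checked in the symbol algebra. -/
theorem symb_injective {i : ℕ} : Function.Injective
    (symb b : (T [⋀^Fin i]→ₗ[ℝ] ExteriorAlgebra ℝ V) →ₗ[ℝ] SymbolAlgebra T V) := by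
  rw [injective_iff_map_eq_zero]
  intro A h
  induction i with
  | zero =>
    ext t
    rw [symb_zero b A t] at h
    simpa using internal_injective (h.trans (map_zero _).symm)
  | succ i ih =>
    ext t
    have h2 : A.curryLeft (t 0) = 0 := ih _ (by rw [← contr_symb, h, map_zero])
    have := congrArg (fun B => B (Matrix.vecTail t)) h2
    rw [AlternatingMap.curryLeft_apply_apply] at this
    rwa [show t = Matrix.vecCons (t 0) (Matrix.vecTail t) from (Matrix.cons_head_tail t).symm]

/-- In the sum over permutations σ, relabelling the summation indices by σ permutes the product of
covectors, and the sign of this permutation cancels the one in the sum. All (i + k)! terms agree,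
which absorbs the factorial in the symbol. -/
theorem symb_altProd {A B : Type*} [AddCommGroup A] [Module ℝ A] [AddCommGroup B] [Module ℝ B]
    {i k : ℕ} (f : A →ₗ[ℝ] B →ₗ[ℝ] ExteriorAlgebra ℝ V) (α : T [⋀^Fin i]→ₗ[ℝ] A)
    (β : T [⋀^Fin k]→ₗ[ℝ] B) : symb b (altProd i k f α β) =
      ((i.factorial : ℝ)⁻¹ * (k.factorial : ℝ)⁻¹) • ∑ c : Fin i → Fin n, ∑ d : Fin k → Fin n,
        covecProd b c * covecProd b d * internal T V (f (α (b ∘ c)) (β (b ∘ d))) := by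
  have hn : ((i.factorial * k.factorial : ℕ) : ℝ) ≠ 0 := by positivity
  have key : ((i.factorial * k.factorial : ℕ) : ℝ) • symb b (altProd i k f α β) =
      ∑ c : Fin i → Fin n, ∑ d : Fin k → Fin n,
        covecProd b c * covecProd b d * internal T V (f (α (b ∘ c)) (β (b ∘ d))) := by
    rw [symb_apply, smul_comm, Finset.smul_sum]
    simp only [← mul_smul_comm, ← map_smul, factorial_smul_altProd_apply]
    have h : ∀ σ : Equiv.Perm (Fin i ⊕ Fin k), ∑ c : Fin (i + k) → Fin n,
        covecProd b c * internal T V ((Equiv.Perm.sign σ : ℤ) •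
          f (α fun a => (b ∘ c) (finSumFinEquiv (σ (Sum.inl a))))
            (β fun a => (b ∘ c) (finSumFinEquiv (σ (Sum.inr a))))) =
        ∑ c : Fin i → Fin n, ∑ d : Fin k → Fin n,
          covecProd b c * covecProd b d * internal T V (f (α (b ∘ c)) (β (b ∘ d))) := by
      intro σ
      let E : ((Fin i → Fin n) × (Fin k → Fin n)) ≃ (Fin (i + k) → Fin n) :=
        (Equiv.sumArrowEquivProdArrow (Fin i) (Fin k) (Fin n)).symm.trans
          ((σ.trans finSumFinEquiv).arrowCongr (Equiv.refl (Fin n)))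
      rw [← E.sum_comp, Fintype.sum_prod_type]
      refine Finset.sum_congr rfl fun c _ => Finset.sum_congr rfl fun d _ => ?_
      have hE : ∀ s, E (c, d) (finSumFinEquiv (σ s)) = Sum.elim c d s := by
        intro s
        simp [E, Equiv.sumArrowEquivProdArrow]
      have hP : (covecProd b (E (c, d)) : SymbolAlgebra T V) =
          (Equiv.Perm.sign σ : ℤ) • (covecProd b c * covecProd b d) := by
        have h1 : (covecProd b (Fin.append c d) : SymbolAlgebra T V) =
            covecProd b c * covecProd b d := by
          rw [covecProd, covecProd, covecProd, ExteriorAlgebra.ιMulti_mul_ιMulti]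
          congr 1
          funext s
          refine Fin.addCases (fun s => ?_) (fun s => ?_) s <;> simp
        rw [← h1, covecProd, covecProd, ← Equiv.Perm.sign_permCongr finSumFinEquiv σ,
          ← Units.smul_def, AlternatingMap.map_congr_perm _ _ (finSumFinEquiv.permCongr σ)]
        congr 2
        funext s
        simp only [Function.comp_apply, Equiv.permCongr_apply, hE]
        congr 3
        refine Fin.addCases (fun s => ?_) (fun s => ?_) s <;> simp
      simp only [Function.comp_def, hE, hP, Sum.elim_inl, Sum.elim_inr, map_zsmul]
      rw [mul_smul_comm, smul_mul_assoc, smul_smul]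
      have : (Equiv.Perm.sign σ : ℤ) * (Equiv.Perm.sign σ : ℤ) = 1 := by
        rw [← Units.val_mul, Int.units_mul_self, Units.val_one]
      rw [this, one_smul]
    simp only [map_sum, Finset.mul_sum]
    rw [Finset.sum_comm, Finset.sum_congr rfl fun σ _ => h σ, Finset.sum_const, Finset.card_univ,
      Fintype.card_perm, Fintype.card_sum, Fintype.card_fin, Fintype.card_fin, ← Nat.cast_smul_eq_nsmul ℝ, smul_smul,
      inv_mul_cancel₀ (by positivity), one_smul]
  rw [← key, smul_smul]
  push_cast
  rw [← mul_inv, inv_mul_cancel₀ (by exact_mod_cast hn), one_smul]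

end Symbol

/-! ### The coframe E as an element of the symbol algebra, and its powers -/

section Symbol

variable {n : ℕ} {T V : Type*} [AddCommGroup T] [Module ℝ T] [AddCommGroup V] [Module ℝ V]
variable (b : Module.Basis (Fin n) ℝ T)

theorem internal_mem {j : ℕ} {a : ExteriorAlgebra ℝ V} (ha : a ∈ ⋀[ℝ]^j V) :
    internal T V a ∈ ⋀[ℝ]^j (Module.Dual ℝ T × V) := map_mem_exteriorPower _ ha

theorem internal_mul_covecProd {j k : ℕ} {a : ExteriorAlgebra ℝ V} (ha : a ∈ ⋀[ℝ]^j V)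
    (c : Fin k → Fin n) : internal T V a * covecProd b c =
      (-1 : ℝ) ^ (j * k) • (covecProd b c * internal T V a) :=
  mul_ιMulti_of_mem (internal_mem ha) _

/-- The symbol is multiplicative. -/
theorem symb_mul {i j k : ℕ} {α : T [⋀^Fin i]→ₗ[ℝ] ExteriorAlgebra ℝ V}
    (hα : ∀ t, α t ∈ ⋀[ℝ]^j V) (β : T [⋀^Fin k]→ₗ[ℝ] ExteriorAlgebra ℝ V) :
    symb b ((-1 : ℝ) ^ (j * k) • altProd i k (LinearMap.mul ℝ (ExteriorAlgebra ℝ V)) α β) =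
      symb b α * symb b β := by
  rw [map_smul, symb_altProd, symb_apply, symb_apply, smul_mul_smul_comm, smul_comm,
    Finset.sum_mul_sum, Finset.smul_sum]
  congr 1
  refine Finset.sum_congr rfl fun c _ => ?_
  rw [Finset.smul_sum]
  refine Finset.sum_congr rfl fun d _ => ?_
  have h := internal_mul_covecProd b (hα (b ∘ c)) d
  calc _ = covecProd b c * ((-1 : ℝ) ^ (j * k) • (covecProd b d * internal T V (α (b ∘ c)))) *
        internal T V (β (b ∘ d)) := by
        rw [LinearMap.mul_apply', map_mul]
        simp only [smul_mul_assoc, mul_smul_comm, mul_assoc]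
    _ = _ := by rw [← h]; simp only [mul_assoc]

/-- The symbol of a linear map `T → V`. -/
def coframeSymb (e : T →ₗ[ℝ] V) : SymbolAlgebra T V := ∑ c, covec (b.coord c) * vec (e (b c))

theorem sum_smul_covec (φ : Module.Dual ℝ T) :
    ∑ c, φ (b c) • covec (b.coord c) = (covec φ : SymbolAlgebra T V) := by
  have h : φ = ∑ c, φ (b c) • b.coord c := b.ext fun k => by
    simp
  conv_rhs => rw [h]
  have h2 : ∀ ψ : Module.Dual ℝ T, (covec ψ : SymbolAlgebra T V) =
    (ExteriorAlgebra.ι ℝ ∘ₗ LinearMap.inl ℝ (Module.Dual ℝ T) V) ψ := fun ψ => rfl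
  simp only [h2, map_sum, map_smul]

theorem covecProd_one (d : Fin 1 → Fin n) :
    (covecProd b d : SymbolAlgebra T V) = covec (b.coord (d 0)) := by
  simp [covecProd, ExteriorAlgebra.ιMulti_apply, covec]

theorem covecProd_two (d : Fin 2 → Fin n) : (covecProd b d : SymbolAlgebra T V) =
    covec (b.coord (d 0)) * covec (b.coord (d 1)) := by
  simp [covecProd, ExteriorAlgebra.ιMulti_apply, covec, Matrix.vecTail]

theorem symb_oneForm (φ : T →ₗ[ℝ] ExteriorAlgebra ℝ V) :
    symb b (oneForm φ) = ∑ c, covec (b.coord c) * internal T V (φ (b c)) := by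
  rw [symb_apply, ← (Equiv.funUnique (Fin 1) (Fin n)).symm.sum_comp]
  simp only [Nat.factorial_one, Nat.cast_one, inv_one, one_smul]
  refine Finset.sum_congr rfl fun c _ => ?_
  rw [covecProd_one]
  rfl

theorem symb_oneForm_ι (e : T →ₗ[ℝ] V) :
    symb b (oneForm (ExteriorAlgebra.ι ℝ ∘ₗ e)) = coframeSymb b e := by
  simp [symb_oneForm, coframeSymb]

theorem symb_two (α : T [⋀^Fin 2]→ₗ[ℝ] ExteriorAlgebra ℝ V) : symb b α =
    (2 : ℝ)⁻¹ • ∑ c, ∑ d, covec (b.coord c) * covec (b.coord d) *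
      internal T V (α ![b c, b d]) := by
  rw [symb_apply, ← (finTwoArrowEquiv (Fin n)).symm.sum_comp, Fintype.sum_prod_type]
  simp only [Nat.factorial_two, Nat.cast_ofNat]
  congr 1
  refine Finset.sum_congr rfl fun c _ => Finset.sum_congr rfl fun d _ => ?_
  rw [covecProd_two]
  congr 3
  funext k
  fin_cases k <;> rfl

/-- Every term contains more than n basis covectors, so one of them is repeated. -/
theorem covec_mul_symb_eq_zero {i : ℕ} (hi : n ≤ i) (φ : Module.Dual ℝ T)
    (A : T [⋀^Fin i]→ₗ[ℝ] ExteriorAlgebra ℝ V) : covec φ * symb b A = 0 := by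
  rw [← sum_smul_covec b φ, Finset.sum_mul]
  refine Finset.sum_eq_zero fun a _ => ?_
  rw [symb_apply, mul_smul_comm, Finset.mul_sum, Finset.sum_eq_zero, smul_zero, ]
  intro c _
  rw [← mul_assoc, smul_mul_assoc, ← covecProd_cons, covecProd_eq_zero, smul_zero, zero_mul]
  intro h
  have := Fintype.card_le_of_injective _ h
  simp at this
  omega

variable (e : T →ₗ[ℝ] V)

/-- E is a sum of products of two odd elements, hence even, and commutes with everything. -/
theorem vec_mul_coframeSymb (v : V) :
    vec v * coframeSymb b e = coframeSymb b e * vec v := by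
  rw [coframeSymb, Finset.mul_sum, Finset.sum_mul]
  refine Finset.sum_congr rfl fun c _ => ?_
  rw [← mul_assoc, vec_mul_covec, neg_mul, mul_assoc, mul_assoc, vec_mul_vec, mul_neg, neg_neg]

theorem covec_mul_coframeSymb (φ : Module.Dual ℝ T) :
    covec φ * coframeSymb b e = coframeSymb b e * covec φ := by
  rw [coframeSymb, Finset.mul_sum, Finset.sum_mul]
  refine Finset.sum_congr rfl fun c _ => ?_
  rw [← mul_assoc, covec_mul_covec, neg_mul, mul_assoc, mul_assoc, vec_mul_covec, mul_neg]

theorem vec_mul_coframeSymb_pow (k : ℕ) (v : V) :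
    vec v * coframeSymb b e ^ k = coframeSymb b e ^ k * vec v :=
  (Commute.pow_right (vec_mul_coframeSymb b e v) k)

theorem covec_mul_coframeSymb_pow (k : ℕ) (φ : Module.Dual ℝ T) :
    covec φ * coframeSymb b e ^ k = coframeSymb b e ^ k * covec φ :=
  (Commute.pow_right (covec_mul_coframeSymb b e φ) k)

theorem contr_coframeSymb_mul (t : T) (x : SymbolAlgebra T V) :
    contr t (coframeSymb b e * x) = vec (e t) * x + coframeSymb b e * contr t x := by
  have h : vec (e t) = ∑ c, b.coord c t • (vec (e (b c)) : SymbolAlgebra T V) := by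
    conv_lhs => rw [← b.sum_repr t]
    simp only [← internal_ι, map_sum, map_smul, Module.Basis.coord_apply]
  rw [h, coframeSymb, Finset.sum_mul, Finset.sum_mul, Finset.sum_mul, map_sum,
    ← Finset.sum_add_distrib]
  refine Finset.sum_congr rfl fun c _ => ?_
  simp only [mul_assoc, contr_covec_mul, contr_vec_mul, mul_neg, sub_neg_eq_add, smul_mul_assoc]

/-- The Leibniz rule for an odd derivation applied to a power of the central element E, with ι_t E =
e(t). All reductions of powers of E below are instances of it. -/
theorem contr_coframeSymb_pow_mul (k : ℕ) (t : T) (x : SymbolAlgebra T V) :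
    contr t (coframeSymb b e ^ (k + 1) * x) =
      ((k : ℝ) + 1) • (coframeSymb b e ^ k * (vec (e t) * x)) +
        coframeSymb b e ^ (k + 1) * contr t x := by
  induction k generalizing x with
  | zero => simp [contr_coframeSymb_mul]
  | succ k ih =>
    rw [pow_succ', mul_assoc, contr_coframeSymb_mul, ih, mul_add, mul_smul_comm]
    simp only [← mul_assoc, ← pow_succ', vec_mul_coframeSymb_pow]
    push_cast
    module

/-- Exhibits E^k as the symbol of a k-form, so that `covec_mul_symb_eq_zero` applies to E^n. -/
theorem exists_symb_eq_coframeSymb_pow (k : ℕ) :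
    ∃ A : T [⋀^Fin k]→ₗ[ℝ] ExteriorAlgebra ℝ V, symb b A = coframeSymb b e ^ k := by
  suffices h : ∃ A : T [⋀^Fin k]→ₗ[ℝ] ExteriorAlgebra ℝ V,
      (∀ t, A t ∈ ⋀[ℝ]^k V) ∧ symb b A = coframeSymb b e ^ k from h.imp fun _ h => h.2
  induction k with
  | zero =>
    refine ⟨AlternatingMap.constOfIsEmpty ℝ T (Fin 0) 1, fun t => ?_, ?_⟩
    · change (1 : ExteriorAlgebra ℝ V) ∈ LinearMap.range (ExteriorAlgebra.ι ℝ : V →ₗ[ℝ] _) ^ 0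
      rw [pow_zero]; exact Submodule.one_le.mp le_rfl
    · rw [symb_zero b _ 0]; simp
  | succ k ih =>
    obtain ⟨A, hA, hA'⟩ := ih
    refine ⟨_, ?_, (symb_mul b hA (oneForm (ExteriorAlgebra.ι ℝ ∘ₗ e))).trans ?_⟩
    · intro t
      refine Submodule.smul_mem _ _ (altProd_mem _ _ _ _ (fun s t => ?_) _)
      exact mul_mem_exteriorPower (hA _) (ι_mem_exteriorPower_one _)
    · rw [hA', symb_oneForm_ι, pow_succ]

theorem covec_mul_coframeSymb_pow_eq_zero (φ : Module.Dual ℝ T) :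
    coframeSymb b e ^ n * covec φ = 0 := by
  obtain ⟨A, hA⟩ := exists_symb_eq_coframeSymb_pow b e n
  rw [← covec_mul_coframeSymb_pow, ← hA, covec_mul_symb_eq_zero b le_rfl]

/-- E^{n+1} vanishes since E^n already kills covectors, and its contraction with t is (n + 1) E^n
e(t). -/
theorem coframeSymb_pow_mul_vec_eq_zero (t : T) : coframeSymb b e ^ n * vec (e t) = 0 := by
  have h : coframeSymb b e ^ (n + 1) * 1 = 0 := by
    rw [pow_succ, mul_one]
    conv_lhs => rw [coframeSymb, Finset.mul_sum]
    refine Finset.sum_eq_zero fun c _ => ?_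
    rw [← mul_assoc]
    exact mul_eq_zero_of_left (covec_mul_coframeSymb_pow_eq_zero b e _) _
  have h2 := congrArg (contr t) h
  rw [contr_coframeSymb_pow_mul, map_zero, contr_one, mul_zero, add_zero, mul_one] at h2
  exact (smul_eq_zero.mp h2).resolve_left (by positivity)

/-- Contraction of a product with a power of the coframe that vanishes. -/
theorem coframeSymb_pow_mul_vec_mul {p : ℕ} {x : SymbolAlgebra T V}
    (hx : coframeSymb b e ^ (p + 1) * x = 0) (t : T) :
    ((p : ℝ) + 1) • (coframeSymb b e ^ p * (vec (e t) * x)) =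
      -(coframeSymb b e ^ (p + 1) * contr t x) := by
  have h := congrArg (contr t) hx
  rw [contr_coframeSymb_pow_mul, map_zero] at h
  exact eq_neg_of_add_eq_zero_left h

theorem coframeSymb_pow_mul_covec_mul {p : ℕ} {x : SymbolAlgebra T V} {r : ℝ} {q : ℕ}
    (hx : coframeSymb b e ^ p * x = r • coframeSymb b e ^ n) (φ : Module.Dual ℝ T)
    (hq : q = p) : coframeSymb b e ^ q * (covec φ * x) = 0 := by
  subst hq
  rw [← mul_assoc, ← covec_mul_coframeSymb_pow, mul_assoc, hx, mul_smul_comm,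
    covec_mul_coframeSymb_pow, covec_mul_coframeSymb_pow_eq_zero, smul_zero]

/-- This is E^n φ = 0 contracted with t. Multiplying by a further covector gives zero again, and the
next contraction lowers the power of E by one. In this way two or three covectors against as many
tangential vectors become a determinant times E^n. -/
theorem coframeSymb_pow_mul_pair {p : ℕ} (hn : n = p + 1) (φ : Module.Dual ℝ T) (t : T) :
    coframeSymb b e ^ p * (covec φ * vec (e t)) =
      (((p : ℝ) + 1)⁻¹ * φ t) • coframeSymb b e ^ n := by
  subst hn
  have h := coframeSymb_pow_mul_vec_mul b e (p := p) (x := covec φ)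
    (covec_mul_coframeSymb_pow_eq_zero b e φ) t
  have h2 : contr t (covec φ : SymbolAlgebra T V) = φ t • 1 := by
    simpa using contr_covec_mul t φ (1 : SymbolAlgebra T V)
  rw [h2, vec_mul_covec, mul_neg, smul_neg, neg_inj, mul_smul_comm, mul_one] at h
  rw [mul_smul, ← h, smul_smul, inv_mul_cancel₀ (by positivity), one_smul]

theorem coframeSymb_pow_mul_quadruple {p : ℕ} (hn : n = p + 2) (φ ψ : Module.Dual ℝ T) (s t : T) :
    coframeSymb b e ^ p * (covec φ * (covec ψ * (vec (e s) * vec (e t)))) =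
      (((p : ℝ) + 1)⁻¹ * ((p : ℝ) + 2)⁻¹ * (φ t * ψ s - φ s * ψ t)) • coframeSymb b e ^ n := by
  have h1 := coframeSymb_pow_mul_pair b e (p := p + 1) (by omega)
  have h := coframeSymb_pow_mul_vec_mul b e (p := p) (x := covec φ * (covec ψ * vec (e s)))
    (coframeSymb_pow_mul_covec_mul b e (h1 ψ s) φ rfl) t
  have h2 : contr t (vec (e s) : SymbolAlgebra T V) = 0 := by
    simpa using contr_vec_mul t (e s) (1 : SymbolAlgebra T V)
  have h3 : (vec (e t) * (covec φ * (covec ψ * vec (e s))) : SymbolAlgebra T V) =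
      -(covec φ * (covec ψ * (vec (e s) * vec (e t)))) := by
    rw [← mul_assoc, vec_mul_covec, neg_mul, mul_assoc, ← mul_assoc (vec (e t)), vec_mul_covec,
      neg_mul, mul_assoc, vec_mul_vec (e t)]
    simp only [mul_neg, neg_neg]
  simp only [h3, contr_covec_mul, h2, mul_zero, sub_zero, mul_sub, mul_smul_comm, h1, mul_neg,
    smul_neg, neg_inj] at h
  rw [mul_assoc, mul_smul, ← inv_smul_eq_iff₀ (by positivity) |>.mpr h.symm]
  congr 1
  push_cast
  module

theorem coframeSymb_pow_mul_sextuple {p : ℕ} (hn : n = p + 3) (φ ψ χ : Module.Dual ℝ T)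
    (s t u : T) : coframeSymb b e ^ p *
      (covec φ * (covec ψ * (covec χ * (vec (e s) * (vec (e t) * vec (e u)))))) =
      (((p : ℝ) + 1)⁻¹ * ((p : ℝ) + 2)⁻¹ * ((p : ℝ) + 3)⁻¹ *
        (φ u * (ψ t * χ s - ψ s * χ t) - ψ u * (φ t * χ s - φ s * χ t) +
          χ u * (φ t * ψ s - φ s * ψ t))) • coframeSymb b e ^ n := by
  have h1 := coframeSymb_pow_mul_quadruple b e (p := p + 1) (by omega)
  have h := coframeSymb_pow_mul_vec_mul b e (p := p)
    (x := covec φ * (covec ψ * (covec χ * (vec (e s) * vec (e t)))))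
    (coframeSymb_pow_mul_covec_mul b e (h1 ψ χ s t) φ rfl) u
  have h2 : contr u (vec (e s) * vec (e t) : SymbolAlgebra T V) = 0 := by
    have := contr_vec_mul u (e t) (1 : SymbolAlgebra T V)
    rw [contr_vec_mul, ← mul_one (vec (e t)), this]; simp
  have h3 : (vec (e u) * (covec φ * (covec ψ * (covec χ * (vec (e s) * vec (e t))))) :
      SymbolAlgebra T V) =
      -(covec φ * (covec ψ * (covec χ * (vec (e s) * (vec (e t) * vec (e u)))))) := by
    rw [← mul_assoc, vec_mul_covec, neg_mul, mul_assoc, ← mul_assoc (vec (e u)), vec_mul_covec,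
      neg_mul, mul_assoc, ← mul_assoc (vec (e u)), vec_mul_covec, neg_mul, mul_assoc,
      ← mul_assoc (vec (e u)), vec_mul_vec (e u), neg_mul, mul_assoc, vec_mul_vec (e u)]
    simp only [mul_neg, neg_neg]
  simp only [h3, contr_covec_mul, h2, mul_zero, sub_zero, mul_sub, mul_smul_comm, h1, mul_neg,
    smul_neg, neg_inj] at h
  rw [show ∀ a b c d : ℝ, a * b * c * d = a * (b * c * d) by intros; ring, mul_smul,
    ← inv_smul_eq_iff₀ (by positivity) |>.mpr h.symm]
  congr 1
  push_cast
  have e1 : (p : ℝ) + 1 + 1 = p + 2 := by ring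
  have e2 : (p : ℝ) + 1 + 2 = p + 3 := by ring
  rw [e1, e2]
  module

/-- The identity for one pair, contracted once more, now with one vector left over. It computes the
trace part of φ ⊗ e(s) ∧ e(t). -/
theorem coframeSymb_pow_mul_triple {p : ℕ} (hn : n = p + 2) (φ : Module.Dual ℝ T) (s t : T) :
    coframeSymb b e ^ p * (covec φ * (vec (e s) * vec (e t))) =
      ((p : ℝ) + 1)⁻¹ • (coframeSymb b e ^ (p + 1) * (φ s • vec (e t) - φ t • vec (e s))) := by
  subst hn
  have h1 := coframeSymb_pow_mul_pair b e (p := p + 1) (by omega) φ s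
  have h2 : contr t (vec (e s) : SymbolAlgebra T V) = 0 := by
    simpa using contr_vec_mul t (e s) (1 : SymbolAlgebra T V)
  have h := congrArg (contr t) h1
  have h3 : (vec (e t) * (covec φ * vec (e s)) : SymbolAlgebra T V) =
      covec φ * (vec (e s) * vec (e t)) := by
    rw [← mul_assoc, vec_mul_covec, neg_mul, mul_assoc, vec_mul_vec (e t)]
    simp only [mul_neg, neg_neg]
  have h4 := contr_coframeSymb_pow_mul b e (p + 1) t 1
  rw [contr_one, mul_zero, add_zero, mul_one, mul_one] at h4
  rw [contr_coframeSymb_pow_mul, h3, contr_covec_mul, h2, mul_zero, sub_zero, map_smul, h4,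
    smul_smul] at h
  rw [eq_comm, inv_smul_eq_iff₀ (by positivity), mul_sub, mul_smul_comm, mul_smul_comm,
    sub_eq_iff_eq_add, ← mul_smul_comm (φ t), h]
  congr 1
  push_cast
  have : (p : ℝ) + 1 + 1 ≠ 0 := by positivity
  field_simp

theorem ιMulti_succ_last {U : Type*} [AddCommGroup U] [Module ℝ U] {k : ℕ} (u : Fin (k + 1) → U) :
    ExteriorAlgebra.ιMulti ℝ (k + 1) u =
      ExteriorAlgebra.ιMulti ℝ k (Fin.init u) * ExteriorAlgebra.ι ℝ (u (Fin.last k)) := by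
  rw [ExteriorAlgebra.ιMulti_apply, ExteriorAlgebra.ιMulti_apply, List.ofFn_succ', List.concat_eq_append,
    List.prod_append, List.prod_singleton]
  rfl

theorem ιMulti_basis_ne_zero {U : Type*} [AddCommGroup U] [Module ℝ U] {k : ℕ}
    (f : Module.Basis (Fin k) ℝ U) : ExteriorAlgebra.ιMulti ℝ k f ≠ 0 := by
  intro h
  have h2 : exteriorPower.ιMulti ℝ k f = 0 := Subtype.ext h
  have h3 := exteriorPower.alternatingMapLinearEquiv_apply_ιMulti f.det f
  rw [h2, map_zero, f.det_self] at h3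
  exact zero_ne_one h3

/-- Each contraction with a vector of u exchanges one factor E for a factor e(u), up to a nonzero
integer. -/
theorem ιMulti_mul_eq_zero_of_coframeSymb_pow_mul {k : ℕ} (a : ExteriorAlgebra ℝ V)
    (h : coframeSymb b e ^ k * internal T V a = 0) (u : Fin k → T) :
    ExteriorAlgebra.ιMulti ℝ k (e ∘ u) * a = 0 := by
  induction k generalizing a with
  | zero =>
    rw [pow_zero, one_mul] at h
    rw [internal_injective (h.trans (map_zero _).symm), mul_zero]
  | succ k ih =>
    have h2 := congrArg (contr (u (Fin.last k))) h
    rw [contr_coframeSymb_pow_mul, contr_internal, mul_zero, add_zero, map_zero, ← internal_ι,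
      ← map_mul] at h2
    rw [ιMulti_succ_last, mul_assoc]
    exact ih _ ((smul_eq_zero.mp h2).resolve_left (by positivity)) (Fin.init u)

/-- Contracting with the whole basis would otherwise annihilate the top product of the basis f of V.
Coefficients of E^n w, with w the last vector of f, can thus be compared. -/
theorem coframeSymb_pow_mul_vec_ne_zero (f : Module.Basis (Fin (n + 1)) ℝ V)
    (hf : ∀ c, f (Fin.castSucc c) = e (b c)) :
    coframeSymb b e ^ n * vec (f (Fin.last n)) ≠ 0 := by
  rw [← internal_ι]
  intro h
  have h2 := ιMulti_mul_eq_zero_of_coframeSymb_pow_mul b e _ h b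
  refine ιMulti_basis_ne_zero f ?_
  rw [ιMulti_succ_last, ← h2]
  congr 2
  funext c
  exact hf c

end Symbol

/-! ### Kernels of multiplication by powers of the coframe at a point -/

section Pointwise

variable {n : ℕ} {T V : Type*} [AddCommGroup T] [Module ℝ T] [AddCommGroup V] [Module ℝ V]
variable (b : Module.Basis (Fin n) ℝ T) (e : T →ₗ[ℝ] V) (f : Module.Basis (Fin (n + 1)) ℝ V)

/-- The decomposition of `V` by a basis whose first vectors are the images of a basis of `T`. -/
theorem exists_eq_add_smul_last (hf : ∀ c, f (Fin.castSucc c) = e (b c)) (v : V) :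
    ∃ t : T, v = e t + f.coord (Fin.last n) v • f (Fin.last n) := by
  refine ⟨∑ c, f.coord (Fin.castSucc c) v • b c, ?_⟩
  conv_lhs => rw [← f.sum_repr v, Fin.sum_univ_castSucc]
  simp [hf]

/-- The elements of the kernel of `θ ↦ θ ∧ e^{n-2}`: they are `T`-valued and trace-free. -/
theorem two_form_of_symb_mul_eq_zero {p : ℕ} (hn : n = p + 2)
    (he : Function.Injective e) (hf : ∀ c, f (Fin.castSucc c) = e (b c))
    (θ : T [⋀^Fin 2]→ₗ[ℝ] ExteriorAlgebra ℝ V) (hθ : ∀ t, θ t ∈ ⋀[ℝ]^1 V)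
    (h : symb b θ * coframeSymb b e ^ p = 0) :
    ∃ τ : Fin n → Fin n → T, (∀ c d, θ ![b c, b d] = ExteriorAlgebra.ι ℝ (e (τ c d))) ∧
      ∀ d, ∑ c, b.coord c (τ c d) = 0 := by
  have hθ' : ∀ c d, ∃ v, ExteriorAlgebra.ι ℝ v = θ ![b c, b d] := by
    intro c d
    have := hθ ![b c, b d]
    change _ ∈ LinearMap.range (ExteriorAlgebra.ι ℝ : V →ₗ[ℝ] _) ^ 1 at this
    rwa [pow_one] at this
  choose v hv using hθ'
  choose τ hτ using fun c d => exists_eq_add_smul_last b e f hf (v c d)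
  set ν : Fin n → Fin n → ℝ := fun c d => f.coord (Fin.last n) (v c d) with hν
  set w := f (Fin.last n)
  have hanti : ∀ c d, v d c = -v c d := by
    intro c d
    rw [← ExteriorAlgebra.ι_inj ℝ, map_neg, hv, hv,
      ← θ.map_swap ![b c, b d] (i := 0) (j := 1) (by simp)]
    congr 1
    funext k
    fin_cases k <;> simp
  have hνa : ∀ c d, ν d c = -ν c d := fun c d => by simp only [hν, hanti c d, map_neg]
  set E := coframeSymb b e with hE
  have hEw : E ^ n * vec w ≠ 0 := coframeSymb_pow_mul_vec_ne_zero b e f hf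
  -- With E^p moved to the left, any x may be multiplied from the right. Well-chosen x serve as
  -- probes that isolate single components of θ.
  have h' : ∀ x, ∑ c, ∑ d, E ^ p * (covec (b.coord c) * (covec (b.coord d) *
      (vec (e (τ c d)) * x + ν c d • (vec w * x)))) = 0 := by
    intro x
    have h1 : E ^ p * symb b θ = 0 := by
      rw [← h, symb_two, smul_mul_assoc, mul_smul_comm, Finset.mul_sum, Finset.sum_mul]
      congr 1
      refine Finset.sum_congr rfl fun c _ => ?_
      rw [Finset.mul_sum, Finset.sum_mul]
      refine Finset.sum_congr rfl fun d _ => ?_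
      rw [← hv, internal_ι, mul_assoc, mul_assoc, mul_assoc, vec_mul_coframeSymb_pow,
        ← mul_assoc (covec (b.coord d)), covec_mul_coframeSymb_pow, mul_assoc, ← mul_assoc,
        ← mul_assoc, ← mul_assoc, covec_mul_coframeSymb_pow]
      simp only [mul_assoc, ← hE]
    rw [symb_two, mul_smul_comm, smul_eq_zero] at h1
    have h2 := congrArg (· * x) (h1.resolve_left (by norm_num))
    simp only [zero_mul, Finset.mul_sum, Finset.sum_mul] at h2
    rw [← h2]
    refine Finset.sum_congr rfl fun c _ => Finset.sum_congr rfl fun d _ => ?_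
    rw [← hv, internal_ι]
    conv_rhs => rw [hτ c d, vec_add, vec_smul]
    simp only [mul_assoc, add_mul, smul_mul_assoc]
    rfl
  have q := fun φ ψ s t => coframeSymb_pow_mul_quadruple b e hn φ ψ s t
  rw [← hE] at q
  set k := ((p : ℝ) + 1)⁻¹ * ((p : ℝ) + 2)⁻¹ with hk
  have hk0 : k ≠ 0 := by positivity
  -- The probe e_s e_t: the tangential components die because E^n e(τ) = 0, and the transversal ones
  -- remain as the coefficient of E^n w.
  have hν0 : ∀ s t, ν s t = 0 := by
    intro s t
    have h1 := h' (vec (e (b s)) * vec (e (b t)))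
    have h2 : ∀ c d, E ^ p * (covec (b.coord c) * (covec (b.coord d) *
        (vec (e (τ c d)) * (vec (e (b s)) * vec (e (b t))) +
          ν c d • (vec w * (vec (e (b s)) * vec (e (b t))))))) =
        ν c d • ((k * (b.coord c (b t) * b.coord d (b s) - b.coord c (b s) * b.coord d (b t))) •
          (E ^ n * vec w)) := by
      intro c d
      have h3 : (vec (e (τ c d)) * (vec (e (b s)) * vec (e (b t))) : SymbolAlgebra T V) =
          vec (e (b s)) * vec (e (b t)) * vec (e (τ c d)) := by
        rw [← mul_assoc, vec_mul_vec, neg_mul, mul_assoc, vec_mul_vec _ (e (b t)), mul_neg,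
          neg_neg, mul_assoc]
      have h4 : (vec w * (vec (e (b s)) * vec (e (b t))) : SymbolAlgebra T V) =
          vec (e (b s)) * vec (e (b t)) * vec w := by
        rw [← mul_assoc, vec_mul_vec, neg_mul, mul_assoc, vec_mul_vec _ (e (b t)), mul_neg,
          neg_neg, mul_assoc]
      have h5 : ∀ y : SymbolAlgebra T V, E ^ p * (covec (b.coord c) * (covec (b.coord d) *
          (vec (e (b s)) * vec (e (b t)) * y))) = (k * (b.coord c (b t) * b.coord d (b s) -
            b.coord c (b s) * b.coord d (b t))) • (E ^ n * y) := by
        intro y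
        rw [← smul_mul_assoc, ← q]
        simp only [mul_assoc]
      rw [h3, h4, mul_add, mul_add, mul_add, h5, mul_smul_comm, mul_smul_comm, mul_smul_comm, h5,
        coframeSymb_pow_mul_vec_eq_zero, smul_zero, zero_add]
    simp only [h2, smul_smul, ← Finset.sum_smul] at h1
    have h3 := (smul_eq_zero.mp h1).resolve_right hEw
    simp only [Module.Basis.coord_apply, Module.Basis.repr_self, Finsupp.single_apply, mul_sub,
      Finset.sum_sub_distrib] at h3
    simp at h3
    have h4 := hνa s t
    have h5 : k * ν s t = 0 := by
      rw [h4] at h3; linarith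
    exact (mul_eq_zero.mp h5).resolve_left hk0
  refine ⟨τ, fun c d => ?_, fun s => ?_⟩
  · rw [← hv]
    conv_lhs => rw [hτ c d]
    have : f.coord (Fin.last n) (v c d) = 0 := hν0 c d
    rw [this, zero_smul, add_zero]
  -- Once the transversal components are gone, the probe e_s w isolates the trace of τ as the
  -- coefficient of E^n w.
  · have h1 := h' (vec (e (b s)) * vec w)
    have h2 : ∀ c d, E ^ p * (covec (b.coord c) * (covec (b.coord d) *
        (vec (e (τ c d)) * (vec (e (b s)) * vec w) + ν c d • (vec w * (vec (e (b s)) * vec w))))) =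
        (k * (b.coord c (b s) * b.coord d (τ c d) - b.coord c (τ c d) * b.coord d (b s))) •
          (E ^ n * vec w) := by
      intro c d
      rw [hν0, zero_smul, add_zero, ← smul_mul_assoc, ← q]
      simp only [mul_assoc]
    simp only [h2, ← Finset.sum_smul] at h1
    have h3 := (smul_eq_zero.mp h1).resolve_right hEw
    -- Traces over the first and over the second index both occur. They differ by a sign, since
    -- antisymmetry passes from θ to τ by injectivity of e.
    have hτa : ∀ c d, e (τ d c) = - e (τ c d) := by
      intro c d
      have h4 := hτ c d
      have h5 := hτ d c
      have h6 : f.coord (Fin.last n) (v c d) = 0 := hν0 c d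
      have h7 : f.coord (Fin.last n) (v d c) = 0 := hν0 d c
      rw [h6, zero_smul, add_zero] at h4
      rw [h7, zero_smul, add_zero] at h5
      rw [← h4, ← h5, hanti]
    have hτa' : ∀ c d, τ d c = - τ c d := fun c d => he (by rw [hτa, map_neg])
    simp only [mul_sub, Finset.sum_sub_distrib, Module.Basis.coord_apply, Module.Basis.repr_self,
      Finsupp.single_apply] at h3
    simp [← Finset.mul_sum] at h3
    simp only [Module.Basis.coord_apply]
    have h8 : ∑ d, b.repr (τ s d) d = - ∑ c, b.repr (τ c s) c := by
      rw [← Finset.sum_neg_distrib]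
      refine Finset.sum_congr rfl fun d _ => ?_
      rw [hτa' d s, map_neg, Finsupp.neg_apply]
    rw [h8] at h3
    have : k * (∑ c, b.repr (τ c s) c) = 0 := by linarith
    exact (mul_eq_zero.mp this).resolve_left hk0

/-- The trace-free part of `λ ⊗ e(s) ∧ e(t)`, as a linear map `T → ⋀² V`. -/
def traceFree (n : ℕ) (e : T →ₗ[ℝ] V) (φ : Module.Dual ℝ T) (s t : T) :
    T →ₗ[ℝ] ExteriorAlgebra ℝ V :=
  φ.smulRight (ExteriorAlgebra.ι ℝ (e s) * ExteriorAlgebra.ι ℝ (e t)) -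
    ((n : ℝ) - 1)⁻¹ •
      (φ s • ((LinearMap.mulRight ℝ (ExteriorAlgebra.ι ℝ (e t))) ∘ₗ ExteriorAlgebra.ι ℝ ∘ₗ e) -
       φ t • ((LinearMap.mulRight ℝ (ExteriorAlgebra.ι ℝ (e s))) ∘ₗ ExteriorAlgebra.ι ℝ ∘ₗ e))

theorem traceFree_apply (n : ℕ) (φ : Module.Dual ℝ T) (s t y : T) :
    traceFree n e φ s t y = φ y • (ExteriorAlgebra.ι ℝ (e s) * ExteriorAlgebra.ι ℝ (e t)) -
      ((n : ℝ) - 1)⁻¹ • (φ s • (ExteriorAlgebra.ι ℝ (e y) * ExteriorAlgebra.ι ℝ (e t)) -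
        φ t • (ExteriorAlgebra.ι ℝ (e y) * ExteriorAlgebra.ι ℝ (e s))) := rfl

theorem traceFree_mem (n : ℕ) (φ : Module.Dual ℝ T) (s t y : T) :
    traceFree n e φ s t y ∈ ⋀[ℝ]^2 V := by
  rw [traceFree_apply]
  have h : ∀ u w : V, ExteriorAlgebra.ι ℝ u * ExteriorAlgebra.ι ℝ w ∈ ⋀[ℝ]^2 V := fun u w =>
    mul_mem_exteriorPower (ι_mem_exteriorPower_one u) (ι_mem_exteriorPower_one w)
  exact sub_mem (Submodule.smul_mem _ _ (h _ _)) (Submodule.smul_mem _ _ (sub_mem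
    (Submodule.smul_mem _ _ (h _ _)) (Submodule.smul_mem _ _ (h _ _))))

theorem symb_traceFree (φ : Module.Dual ℝ T) (s t : T) :
    symb b (oneForm (traceFree n e φ s t)) = covec φ * (vec (e s) * vec (e t)) -
      ((n : ℝ) - 1)⁻¹ • (φ s • (coframeSymb b e * vec (e t)) -
        φ t • (coframeSymb b e * vec (e s))) := by
  rw [symb_oneForm]
  simp only [traceFree_apply, map_sub, map_smul, map_mul, internal_ι, mul_sub, mul_smul_comm,
    Finset.sum_sub_distrib, ← Finset.smul_sum]
  congr 1
  · simp only [← smul_mul_assoc, ← Finset.sum_mul, sum_smul_covec]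
  · simp only [coframeSymb, Finset.sum_mul, mul_assoc]

/-- By `coframeSymb_pow_mul_triple`, the correction with the constant 1/(n - 1) = 1/(p + 1) cancels
the leading term exactly. These elements are the test elements v of Ker W_{N-3} used both for β and
for 𝒥. -/
theorem symb_traceFree_mul {p : ℕ} (hn : n = p + 2) (φ : Module.Dual ℝ T) (s t : T) :
    symb b (oneForm (traceFree n e φ s t)) * coframeSymb b e ^ p = 0 := by
  have h1 : symb b (oneForm (traceFree n e φ s t)) * coframeSymb b e ^ p =
      coframeSymb b e ^ p * symb b (oneForm (traceFree n e φ s t)) := by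
    rw [symb_traceFree]
    have c1 := fun v => Commute.pow_right (vec_mul_coframeSymb b e v) p
    have c2 := fun v => Commute.pow_right (covec_mul_coframeSymb (V := V) b e v) p
    have c3 := Commute.pow_right (Commute.refl (coframeSymb b e)) p
    exact Commute.sub_left ((c2 _).mul_left ((c1 _).mul_left (c1 _)))
      (Commute.smul_left (Commute.sub_left (Commute.smul_left (c3.mul_left (c1 _)) _)
        (Commute.smul_left (c3.mul_left (c1 _)) _)) _)
  have h2 : (n : ℝ) - 1 = p + 1 := by rw [hn]; push_cast; ring
  rw [h1, symb_traceFree, mul_sub, coframeSymb_pow_mul_triple b e hn, h2, mul_smul_comm, mul_sub,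
    mul_sub, mul_smul_comm, mul_smul_comm, mul_smul_comm, mul_smul_comm, ← mul_assoc, ← mul_assoc,
    ← pow_succ, sub_self]

/-- A form that vanishes on the kernel of a basis one-form. -/
theorem covec_mul_symb_eq_zero_of_vanish {i : ℕ} (A : T [⋀^Fin i]→ₗ[ℝ] ExteriorAlgebra ℝ V)
    (c₀ : Fin n) (h : ∀ c : Fin i → Fin n, (∀ k, c k ≠ c₀) → A (b ∘ c) = 0) :
    covec (b.coord c₀) * symb b A = 0 := by
  rw [symb_apply, mul_smul_comm, Finset.mul_sum, Finset.sum_eq_zero, smul_zero]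
  intro c _
  by_cases hc : ∀ k, c k ≠ c₀
  · rw [h c hc, map_zero, mul_zero, mul_zero]
  · push Not at hc
    obtain ⟨k, hk⟩ := hc
    rw [← mul_assoc, ← covecProd_cons, covecProd_eq_zero, zero_mul]
    intro h'
    have : (0 : Fin (i + 1)) = k.succ := h' (by simp [hk])
    exact absurd this (Fin.succ_ne_zero _).symm

/-- The normalization of `β`: the components of `β` transversal to `c₀` vanish. -/
theorem eq_zero_of_covec_mul_eq_zero {p : ℕ} (hn : n = p + 3)
    (f : Module.Basis (Fin (n + 1)) ℝ V) (hf : ∀ c, f (Fin.castSucc c) = e (b c))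
    (c₀ : Fin n) (β : Module.Dual ℝ T)
    (h : ∀ φ s t, covec (b.coord c₀) * (coframeSymb b (e - β.smulRight (e (b c₀))) *
      coframeSymb b e ^ p * symb b (oneForm (traceFree n e φ s t))) = 0)
    (j : Fin n) (hj : j ≠ c₀) : β (b j) = 0 := by
  -- A third index exists because n = N - 1 is at least 3.
  obtain ⟨k, hk0, hkj⟩ : ∃ k : Fin n, k ≠ c₀ ∧ k ≠ j := by
    have hcard : 2 < Fintype.card (Fin n) := by simp [hn]
    obtain ⟨k, hk⟩ := Finset.exists_mem_notMem_of_card_lt_card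
      (s := {c₀, j}) (t := (Finset.univ : Finset (Fin n)))
      (lt_of_le_of_lt (Finset.card_le_two) (by simpa using hcard))
    refine ⟨k, ?_, ?_⟩ <;> rintro rfl <;> simp at hk
  set E := coframeSymb b e with hE
  have hEt : coframeSymb b (e - β.smulRight (e (b c₀))) = E - covec β * vec (e (b c₀)) := by
    rw [← sum_smul_covec b β, hE, coframeSymb, coframeSymb, Finset.sum_mul,
      ← Finset.sum_sub_distrib]
    refine Finset.sum_congr rfl fun c _ => ?_
    rw [LinearMap.sub_apply, LinearMap.smulRight_apply, ← internal_ι, map_sub, map_sub, mul_sub,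
      internal_ι, internal_ι, vec_smul, mul_smul_comm, smul_mul_assoc]
  have hker := fun φ s t => symb_traceFree_mul b e (p := p + 1) (by omega) φ s t
  -- In ẽ = e - β e(b c₀) the term e drops out, since trace-free elements are killed by E^{p+1}.
  -- Only the term with β is left.
  have key : ∀ φ s t, E ^ p * (covec (b.coord c₀) * (covec β * (vec (e (b c₀)) *
      symb b (oneForm (traceFree n e φ s t))))) = 0 := by
    intro φ s t
    have h1 := h φ s t
    have h2 : E * E ^ p * symb b (oneForm (traceFree n e φ s t)) = 0 := by
      rw [← hker φ s t, ← pow_succ', symb_traceFree]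
      have c1 := fun v => Commute.pow_right (vec_mul_coframeSymb b e v) (p + 1)
      have c2 := fun v => Commute.pow_right (covec_mul_coframeSymb (V := V) b e v) (p + 1)
      have c3 := Commute.pow_right (Commute.refl (coframeSymb b e)) (p + 1)
      exact (Commute.sub_left ((c2 _).mul_left ((c1 _).mul_left (c1 _)))
        (Commute.smul_left (Commute.sub_left (Commute.smul_left (c3.mul_left (c1 _)) _)
          (Commute.smul_left (c3.mul_left (c1 _)) _)) _)).symm
    rw [hEt, sub_mul, sub_mul, h2, zero_sub, mul_neg, neg_eq_zero] at h1
    rw [← h1, mul_assoc (covec β), vec_mul_coframeSymb_pow, ← mul_assoc (covec β),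
      ← mul_assoc (covec β), covec_mul_coframeSymb_pow]
    simp only [← mul_assoc]
    rw [covec_mul_coframeSymb_pow]
  -- Both trace corrections equal E e(b j)/(n - 1), so the difference of the two test elements
  -- consists of monomials.
  have hdiff : symb b (oneForm (traceFree n e (b.coord k) (b k) (b j))) -
      symb b (oneForm (traceFree n e (b.coord c₀) (b c₀) (b j))) =
      covec (b.coord k) * (vec (e (b k)) * vec (e (b j))) -
        covec (b.coord c₀) * (vec (e (b c₀)) * vec (e (b j))) := by
    simp only [symb_traceFree, Module.Basis.coord_apply, Module.Basis.repr_self,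
      Finsupp.single_eq_same, Finsupp.single_eq_of_ne hkj, Finsupp.single_eq_of_ne hj.symm,
      one_smul, zero_smul, sub_zero]
    abel
  have h1 := (key (b.coord k) (b k) (b j)).trans (key (b.coord c₀) (b c₀) (b j)).symm
  rw [← sub_eq_zero, ← mul_sub, ← mul_sub, ← mul_sub, ← mul_sub, hdiff, mul_sub, mul_sub, mul_sub,
    mul_sub] at h1
  -- The monomial with index c₀ would contain the vector e(b c₀) twice.
  have h2 : (covec (b.coord c₀) * (covec β * (vec (e (b c₀)) * (covec (b.coord c₀) *
      (vec (e (b c₀)) * vec (e (b j)))))) : SymbolAlgebra T V) = 0 := by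
    rw [← mul_assoc (vec _) (covec _), vec_mul_covec, neg_mul, mul_assoc, ← mul_assoc (vec _),
      vec_mul_self]
    simp
  have h3 : (covec (b.coord c₀) * (covec β * (vec (e (b c₀)) * (covec (b.coord k) *
      (vec (e (b k)) * vec (e (b j)))))) : SymbolAlgebra T V) =
      -(covec (b.coord c₀) * (covec β * (covec (b.coord k) * (vec (e (b c₀)) *
      (vec (e (b k)) * vec (e (b j))))))) := by
    rw [← mul_assoc (vec _) (covec _), vec_mul_covec, neg_mul, mul_assoc]
    simp
  rw [h2, h3, mul_zero, sub_zero, mul_neg, neg_eq_zero, coframeSymb_pow_mul_sextuple b e hn,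
    smul_eq_zero] at h1
  have hE0 : E ^ n ≠ 0 := by
    intro h0
    refine coframeSymb_pow_mul_vec_ne_zero b e f hf ?_
    rw [← hE, h0, zero_mul]
  -- Of the determinant in `coframeSymb_pow_mul_sextuple` only the term with β(b j) survives.
  have h4 := h1.resolve_right hE0
  simp only [Module.Basis.coord_apply, Module.Basis.repr_self, Finsupp.single_eq_same,
    Finsupp.single_eq_of_ne hkj, Finsupp.single_eq_of_ne hj.symm, Finsupp.single_eq_of_ne hk0,
    Finsupp.single_eq_of_ne hk0.symm] at h4
  have hk : ((p : ℝ) + 1)⁻¹ * ((p : ℝ) + 2)⁻¹ * ((p : ℝ) + 3)⁻¹ ≠ 0 := by positivity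
  have h5 := (mul_eq_zero.mp h4).resolve_left hk
  linarith

end Pointwise

/-! ### The (N-3)-form dual to a tensor K, and its products -/

section DualForm

variable {n : ℕ} {T V : Type*} [AddCommGroup T] [Module ℝ T] [AddCommGroup V] [Module ℝ V]

/-- The form `s ⊗ a`. -/
def tensorForm {A : Type*} [AddCommGroup A] [Module ℝ A] {i : ℕ} (s : T [⋀^Fin i]→ₗ[ℝ] ℝ) (a : A) :
    T [⋀^Fin i]→ₗ[ℝ] A := (LinearMap.toSpanSingleton ℝ A a).compAlternatingMap s

@[simp] theorem tensorForm_apply {A : Type*} [AddCommGroup A] [Module ℝ A] {i : ℕ}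
    (s : T [⋀^Fin i]→ₗ[ℝ] ℝ) (a : A) (t : Fin i → T) : tensorForm s a t = s t • a := rfl

section

variable (b : Module.Basis (Fin n) ℝ T)

variable (V) in
/-- The symbol of a scalar form. -/
def scalarSymb {i : ℕ} (s : T [⋀^Fin i]→ₗ[ℝ] ℝ) : SymbolAlgebra T V :=
  symb b (tensorForm s (1 : ExteriorAlgebra ℝ V))

theorem scalarSymb_eq {i : ℕ} (s : T [⋀^Fin i]→ₗ[ℝ] ℝ) : scalarSymb V b s =
    (i.factorial : ℝ)⁻¹ • ∑ c : Fin i → Fin n, s (b ∘ c) • covecProd b c := by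
  rw [scalarSymb, symb_apply]
  simp

theorem scalarSymb_mem {i : ℕ} (s : T [⋀^Fin i]→ₗ[ℝ] ℝ) :
    scalarSymb V b s ∈ ⋀[ℝ]^i (Module.Dual ℝ T × V) := by
  rw [scalarSymb_eq]
  exact Submodule.smul_mem _ _ (sum_mem fun c _ => Submodule.smul_mem _ _ (covecProd_mem b c))

theorem scalarSymb_mul_covec {i : ℕ} (s : T [⋀^Fin i]→ₗ[ℝ] ℝ) (φ : Module.Dual ℝ T) :
    scalarSymb V b s * covec φ = (-1 : ℝ) ^ i • (covec φ * scalarSymb V b s) :=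
  mul_ι_of_mem (scalarSymb_mem b s) _

theorem contr_scalarSymb {i : ℕ} (s : T [⋀^Fin (i + 1)]→ₗ[ℝ] ℝ) (t : T) :
    contr t (scalarSymb V b s) = scalarSymb V b (s.curryLeft t) := by
  rw [scalarSymb, contr_symb]; rfl

theorem symb_tensorForm {i : ℕ} (s : T [⋀^Fin i]→ₗ[ℝ] ℝ) (a : ExteriorAlgebra ℝ V) :
    symb b (tensorForm s a) = scalarSymb V b s * internal T V a := by
  rw [scalarSymb_eq, symb_apply, smul_mul_assoc, Finset.sum_mul]
  simp

variable {A B : Type*} [AddCommGroup A] [Module ℝ A] [AddCommGroup B] [Module ℝ B]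
  (g : A →ₗ[ℝ] B →ₗ[ℝ] ExteriorAlgebra ℝ V)

theorem symb_altProd_tensorForm {i k : ℕ} (s : T [⋀^Fin i]→ₗ[ℝ] ℝ) (a : A)
    (β : T [⋀^Fin k]→ₗ[ℝ] B) : symb b (altProd i k g (tensorForm s a) β) =
      scalarSymb V b s * symb b ((g a).compAlternatingMap β) := by
  rw [symb_altProd, scalarSymb_eq, symb_apply, smul_mul_smul_comm, Finset.sum_mul_sum]
  congr 1
  refine Finset.sum_congr rfl fun c _ => Finset.sum_congr rfl fun d _ => ?_
  simp [mul_assoc]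

end

variable {p : ℕ} (b : Module.Basis (Fin (p + 2)) ℝ T) (f : Module.Basis (Fin (p + 3)) ℝ V)

/-- The contraction of the volume form of a basis with two of its vectors. -/
def detContr (c d : Fin (p + 2)) : T [⋀^Fin p]→ₗ[ℝ] ℝ := (b.det.curryLeft (b c)).curryLeft (b d)

/-- The volume element of a basis with one of its vectors deleted. -/
def volContr (A : Fin (p + 3)) : ExteriorAlgebra ℝ V :=
  CliffordAlgebra.contractRight (ExteriorAlgebra.ιMulti ℝ (p + 3) f) (f.coord A)

theorem volContr_mem (A : Fin (p + 3)) : volContr f A ∈ ⋀[ℝ]^(p + 2) V :=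
  contractRight_mem_exteriorPower (ιMulti_mem_exteriorPower _) _

theorem ιMulti_mul_ι_eq_zero (v : V) :
    ExteriorAlgebra.ιMulti ℝ (p + 3) f * ExteriorAlgebra.ι ℝ v = 0 := by
  have h : ExteriorAlgebra.ιMulti ℝ (p + 3) f * ExteriorAlgebra.ι ℝ v =
      ExteriorAlgebra.ιMulti ℝ (p + 3 + 1) (Fin.snoc f v : Fin (p + 3 + 1) → V) := by
    rw [ιMulti_succ_last (k := p + 3), Fin.init_snoc, Fin.snoc_last]
  rw [h]
  refine AlternatingMap.map_linearDependent _ _ fun hl => ?_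
  have := Module.Finite.of_basis f
  have h1 := hl.fintype_card_le_finrank (R := ℝ)
  rw [Module.finrank_eq_card_basis f] at h1
  simp at h1

/-- The contraction of vol_V · v = 0. Multiplication by v therefore evaluates the coordinate f^A on
v. -/
theorem volContr_mul_ι (A : Fin (p + 3)) (v : V) : volContr f A * ExteriorAlgebra.ι ℝ v =
    f.coord A v • ExteriorAlgebra.ιMulti ℝ (p + 3) f := by
  have h := CliffordAlgebra.contractRight_mul_ι (Q := (0 : QuadraticForm ℝ V)) (f.coord A) v
    (ExteriorAlgebra.ιMulti ℝ (p + 3) f)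
  have h2 : ExteriorAlgebra.ιMulti ℝ (p + 3) f * CliffordAlgebra.ι 0 v = 0 :=
    ιMulti_mul_ι_eq_zero f v
  rw [h2] at h
  simp only [map_zero, LinearMap.zero_apply] at h
  exact (sub_eq_zero.mp h.symm).symm

/-- The counterpart on T: covectors kill the volume form, and they move past the two contractions by
the Leibniz rule. -/
theorem covec_mul_contr_det (c d : Fin (p + 2)) (φ : Module.Dual ℝ T) :
    covec φ * scalarSymb V b (detContr b c d) =
      φ (b d) • scalarSymb V b (b.det.curryLeft (b c)) -
        φ (b c) • scalarSymb V b (b.det.curryLeft (b d)) := by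
  have h : ∀ (t : T) (x : SymbolAlgebra T V), covec φ * contr t x =
      φ t • x - contr t (covec φ * x) := fun t x => by
    rw [contr_covec_mul]; abel
  have hd : covec φ * scalarSymb V b b.det = 0 := covec_mul_symb_eq_zero b le_rfl _ _
  rw [detContr, ← contr_scalarSymb, h, ← contr_scalarSymb, h, hd, map_zero, sub_zero, map_smul,
    contr_scalarSymb, contr_scalarSymb]

/-- The form `∑ K^{cdA} (ι_d ι_c vol_T) ⊗ (vol_V ⌊ f^A)` that is dual to a tensor `K`. -/
def dualForm (K : Fin (p + 2) → Fin (p + 2) → Fin (p + 3) → ℝ) :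
    T [⋀^Fin p]→ₗ[ℝ] ExteriorAlgebra ℝ V :=
  ∑ c, ∑ d, ∑ A, K c d A • tensorForm (detContr b c d) (volContr f A)

variable {K : Fin (p + 2) → Fin (p + 2) → Fin (p + 3) → ℝ}

theorem alternatingMap_sum_apply {ι A : Type*} [AddCommGroup A] [Module ℝ A] {i : ℕ} (s : Finset ι)
    (g : ι → T [⋀^Fin i]→ₗ[ℝ] A) (t : Fin i → T) : (∑ k ∈ s, g k) t = ∑ k ∈ s, g k t :=
  map_sum (⟨⟨fun a : T [⋀^Fin i]→ₗ[ℝ] A => a t, rfl⟩, fun _ _ => rfl⟩ :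
    (T [⋀^Fin i]→ₗ[ℝ] A) →+ A) g s

theorem dualForm_mem (t : Fin p → T) : dualForm b f K t ∈ ⋀[ℝ]^(p + 2) V := by
  simp only [dualForm, alternatingMap_sum_apply, AlternatingMap.smul_apply, tensorForm_apply]
  exact sum_mem fun c _ => sum_mem fun d _ => sum_mem fun A _ =>
    Submodule.smul_mem _ _ (Submodule.smul_mem _ _ (volContr_mem f A))

theorem symb_altProd_dualForm {B : Type*} [AddCommGroup B] [Module ℝ B] {k : ℕ}
    (g : ExteriorAlgebra ℝ V →ₗ[ℝ] B →ₗ[ℝ] ExteriorAlgebra ℝ V) (β : T [⋀^Fin k]→ₗ[ℝ] B) :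
    symb b (altProd p k g (dualForm b f K) β) = ∑ c, ∑ d, ∑ A, K c d A •
      (scalarSymb V b (detContr b c d) * symb b ((g (volContr f A)).compAlternatingMap β)) := by
  simp only [dualForm, map_sum, LinearMap.sum_apply, map_smul, LinearMap.smul_apply,
    symb_altProd_tensorForm]

/-- The two terms of `covec_mul_contr_det` become equal after exchanging c and d, by antisymmetry of
K; hence the factor 2. The sign comes from moving a covector past a p-form. Vanishing of the product
is thereby reduced to one condition for each c. -/
theorem symb_altProd_dualForm_one {B : Type*} [AddCommGroup B] [Module ℝ B]
    (g : ExteriorAlgebra ℝ V →ₗ[ℝ] B →ₗ[ℝ] ExteriorAlgebra ℝ V) (φ : T →ₗ[ℝ] B)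
    (hK : ∀ c d A, K d c A = -K c d A) :
    symb b (altProd p 1 g (dualForm b f K) (oneForm φ)) = ((-1 : ℝ) ^ p * 2) •
      ∑ c, scalarSymb V b (b.det.curryLeft (b c)) *
        internal T V (∑ d, ∑ A, K c d A • g (volContr f A) (φ (b d))) := by
  have h1 : ∀ a, (g a).compAlternatingMap (oneForm φ) = oneForm (g a ∘ₗ φ) := fun a => rfl
  simp only [symb_altProd_dualForm, h1, symb_oneForm, Finset.mul_sum, ← mul_assoc,
    scalarSymb_mul_covec, covec_mul_contr_det, LinearMap.comp_apply]
  have h2 : ∀ c d A, K c d A • ∑ k, ((-1 : ℝ) ^ p • (b.coord k (b d) • scalarSymb V b (b.det.curryLeft (b c)) -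
        b.coord k (b c) • scalarSymb V b (b.det.curryLeft (b d)))) *
        internal T V (g (volContr f A) (φ (b k))) =
      (-1 : ℝ) ^ p • (scalarSymb V b (b.det.curryLeft (b c)) *
          internal T V (K c d A • g (volContr f A) (φ (b d))) +
        scalarSymb V b (b.det.curryLeft (b d)) *
          internal T V (K d c A • g (volContr f A) (φ (b c)))) := by
    intro c d A
    simp only [Module.Basis.coord_apply, Module.Basis.repr_self, smul_sub, sub_mul,
      Finset.sum_sub_distrib, Finsupp.single_apply, ite_smul, one_smul, zero_smul, smul_ite,
      smul_zero, ite_mul, zero_mul, Finset.sum_ite_eq, Finset.mem_univ, if_true, hK c d, map_smul,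
      neg_smul, map_neg, mul_neg, mul_smul_comm, smul_mul_assoc]
    module
  simp only [h2, ← Finset.smul_sum, Finset.sum_add_distrib]
  rw [mul_smul]
  congr 1
  rw [Finset.sum_comm (f := fun c d => ∑ A, scalarSymb V b (b.det.curryLeft (b d)) *
          internal T V (K d c A • g (volContr f A) (φ (b c)))), ← two_smul ℝ]
  simp only [map_sum, Finset.mul_sum]

theorem altProd_dualForm_eq_zero {B : Type*} [AddCommGroup B] [Module ℝ B]
    (g : ExteriorAlgebra ℝ V →ₗ[ℝ] B →ₗ[ℝ] ExteriorAlgebra ℝ V) (φ : T →ₗ[ℝ] B)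
    (hK : ∀ c d A, K d c A = -K c d A)
    (h : ∀ c, ∑ d, ∑ A, K c d A • g (volContr f A) (φ (b d)) = 0) :
    altProd p 1 g (dualForm b f K) (oneForm φ) = 0 := by
  refine symb_injective b ?_
  rw [symb_altProd_dualForm_one b f g φ hK, map_zero]
  simp [h]

/-- The condition `τ ∧ e = 0` for the form dual to `K`. -/
theorem dualForm_wedge_eq_zero (e : T →ₗ[ℝ] V) (hf : ∀ c, f (Fin.castSucc c) = e (b c))
    (hK : ∀ c d A, K d c A = -K c d A) (htr : ∀ d, ∑ c, K c d (Fin.castSucc c) = 0) :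
    altProd p 1 (LinearMap.mul ℝ (ExteriorAlgebra ℝ V)) (dualForm b f K)
      (oneForm (ExteriorAlgebra.ι ℝ ∘ₗ e)) = 0 := by
  refine altProd_dualForm_eq_zero b f _ _ hK fun c => ?_
  simp only [LinearMap.mul_apply', LinearMap.comp_apply, volContr_mul_ι, ← hf, smul_smul,
    ← Finset.sum_smul, Module.Basis.coord_apply, Module.Basis.repr_self, Finsupp.single_apply]
  have h : ∑ d, K c d (Fin.castSucc d) = 0 := by
    simp only [hK _ c, Finset.sum_neg_distrib, htr, neg_zero]
  simp [h]

/-- The condition `[τ, φ] = 0` for the form dual to `K`. -/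
theorem dualForm_bracket_eq_zero (μ : T →ₗ[ℝ] Module.Dual ℝ V)
    (hK : ∀ c d A, K d c A = -K c d A)
    (hs : ∀ c A B, ∑ d, K c d A * μ (b d) (f B) = ∑ d, K c d B * μ (b d) (f A)) :
    altProd p 1 (CliffordAlgebra.contractRight :
        ExteriorAlgebra ℝ V →ₗ[ℝ] Module.Dual ℝ V →ₗ[ℝ] ExteriorAlgebra ℝ V) (dualForm b f K)
      (oneForm μ) = 0 := by
  refine altProd_dualForm_eq_zero b f _ _ hK fun c => ?_
  have h1 : ∀ d, μ (b d) = ∑ B, μ (b d) (f B) • f.coord B := fun d => f.ext fun B => by simp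
  set R : Fin (p + 3) → Fin (p + 3) → ExteriorAlgebra ℝ V := fun A B =>
    CliffordAlgebra.contractRight (volContr f A) (f.coord B) with hR
  -- Contractions anticommute, so only the part of the coefficients antisymmetric in A and B counts,
  -- and it vanishes by `hs`.
  have hanti : ∀ A B, R B A = -R A B := fun A B =>
    CliffordAlgebra.contractRight_comm (Q := (0 : QuadraticForm ℝ V)) _ _ _
  have h2 : ∑ d, ∑ A, K c d A • (CliffordAlgebra.contractRight :
        ExteriorAlgebra ℝ V →ₗ[ℝ] Module.Dual ℝ V →ₗ[ℝ] ExteriorAlgebra ℝ V) (volContr f A) (μ (b d)) =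
      ∑ A, ∑ B, (∑ d, K c d A * μ (b d) (f B)) • R A B := by
    rw [Finset.sum_comm]
    refine Finset.sum_congr rfl fun A _ => ?_
    simp only [Finset.sum_smul]
    rw [Finset.sum_comm]
    refine Finset.sum_congr rfl fun d _ => ?_
    conv_lhs => rw [h1 d]
    simp only [map_sum, map_smul, Finset.smul_sum, smul_smul, hR]
  rw [h2]
  have h3 : ∑ A, ∑ B, (∑ d, K c d A * μ (b d) (f B)) • R A B =
      -∑ A, ∑ B, (∑ d, K c d A * μ (b d) (f B)) • R A B := by
    conv_lhs => rw [Finset.sum_comm]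
    simp only [← Finset.sum_neg_distrib]
    refine Finset.sum_congr rfl fun A _ => Finset.sum_congr rfl fun B _ => ?_
    rw [hs c B A, hanti A B, smul_neg]
  have h4 := eq_neg_iff_add_eq_zero.mp h3
  rw [← two_smul ℝ] at h4
  exact (smul_eq_zero.mp h4).resolve_left two_ne_zero

/-- The pairing of the form dual to `K` with a two-form. -/
theorem dualForm_wedge_two (α : T [⋀^Fin 2]→ₗ[ℝ] ExteriorAlgebra ℝ V) (hα : ∀ t, α t ∈ ⋀[ℝ]^1 V) :
    altProd p 2 (LinearMap.mul ℝ (ExteriorAlgebra ℝ V)) (dualForm b f K) α =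
      (∑ c, ∑ d, ∑ A, K c d A * f.coord A (ExteriorAlgebra.ιInv (α ![b c, b d]))) •
        tensorForm b.det (ExteriorAlgebra.ιMulti ℝ (p + 3) f) := by
  have hv : ∀ c d, α ![b c, b d] = ExteriorAlgebra.ι ℝ (ExteriorAlgebra.ιInv (α ![b c, b d])) := by
    intro c d
    have := hα ![b c, b d]
    change _ ∈ LinearMap.range (ExteriorAlgebra.ι ℝ : V →ₗ[ℝ] _) ^ 1 at this
    rw [pow_one] at this
    obtain ⟨v, hv⟩ := this
    rw [← hv, ExteriorAlgebra.ι_leftInverse]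
  set v : Fin (p + 2) → Fin (p + 2) → V := fun c d => ExteriorAlgebra.ιInv (α ![b c, b d])
  have hanti : ∀ c d, v d c = -v c d := by
    intro c d
    rw [← ExteriorAlgebra.ι_inj ℝ, map_neg, ← hv, ← hv,
      ← α.map_swap ![b c, b d] (i := 0) (j := 1) (by simp)]
    congr 1
    funext k
    fin_cases k <;> simp
  refine symb_injective b ?_
  rw [symb_altProd_dualForm, map_smul, symb_tensorForm]
  set vol := ExteriorAlgebra.ιMulti ℝ (p + 3) f with hvol
  have h1 : ∀ c d A, scalarSymb V b (detContr b c d) * symb b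
      (((LinearMap.mul ℝ (ExteriorAlgebra ℝ V)) (volContr f A)).compAlternatingMap α) =
      f.coord A (v c d) • (scalarSymb V b b.det * internal T V vol) := by
    intro c d A
    rw [symb_two, mul_smul_comm, Finset.mul_sum]
    have h2 : ∀ k l, scalarSymb V b (detContr b c d) * (covec (b.coord k) * covec (b.coord l) *
        internal T V ((((LinearMap.mul ℝ (ExteriorAlgebra ℝ V)) (volContr f
        A)).compAlternatingMap α) ![b k, b l])) = (f.coord A (v k l) *
          (b.coord l (b d) * b.coord k (b c) - b.coord l (b c) * b.coord k (b d))) •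
            (scalarSymb V b b.det * internal T V vol) := by
      intro k l
      have h3 : ((LinearMap.mul ℝ (ExteriorAlgebra ℝ V)) (volContr f
        A)).compAlternatingMap α ![b k, b l] = f.coord A (v k l) • vol := by
        rw [LinearMap.compAlternatingMap_apply, hv, LinearMap.mul_apply', volContr_mul_ι]
      have h4 : scalarSymb V b (detContr b c d) * (covec (b.coord k) * covec (b.coord l)) =
          covec (b.coord k) * (covec (b.coord l) * scalarSymb V b (detContr b c d)) := by
        rw [← mul_assoc, scalarSymb_mul_covec, smul_mul_assoc, mul_assoc, scalarSymb_mul_covec,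
          mul_smul_comm, smul_smul, ← mul_pow]
        simp
      have h5 : ∀ (φ : Module.Dual ℝ T) (t : T),
          covec φ * scalarSymb V b (b.det.curryLeft t) = φ t • scalarSymb V b b.det := by
        intro φ t
        have h6 := contr_covec_mul t φ (scalarSymb V b b.det)
        have h7 : covec φ * scalarSymb V b b.det = 0 := covec_mul_symb_eq_zero b le_rfl _ _
        rw [h7, map_zero, contr_scalarSymb] at h6
        exact (sub_eq_zero.mp h6.symm).symm
      rw [h3, ← mul_assoc, h4, covec_mul_contr_det, mul_sub, mul_smul_comm, mul_smul_comm, h5, h5,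
        map_smul, mul_smul_comm, smul_smul, smul_smul, ← sub_smul, smul_mul_assoc, smul_smul]
    simp only [Finset.mul_sum, h2, ← Finset.sum_smul, smul_smul]
    congr 1
    simp [mul_sub, Finset.sum_sub_distrib, Finsupp.single_apply]
    -- Antisymmetry of α makes the two remaining terms equal, which compensates the factor 1/2 of
    -- `symb_two`.
    rw [hanti c d]
    simp
    ring
  simp only [h1, smul_smul, ← Finset.sum_smul]
  rfl

end DualForm

/-! ### Inner products of two-forms and independence of the basis -/

section Metric

variable {n : ℕ} {T V : Type*} [AddCommGroup T] [Module ℝ T] [AddCommGroup V] [Module ℝ V]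

/-- The Gram matrix of a bilinear form. -/
def gram (b : Fin n → T) (h : T →ₗ[ℝ] T →ₗ[ℝ] ℝ) : Matrix (Fin n) (Fin n) ℝ :=
  Matrix.of fun a c => h (b a) (b c)

theorem gram_transpose (b : Fin n → T) {h : T →ₗ[ℝ] T →ₗ[ℝ] ℝ} (hs : ∀ s t, h s t = h t s) :
    (gram b h).transpose = gram b h := by
  ext i j; simp [gram, hs (b j)]

/-- The sum is the trace of G⁻¹Bᵀ. With a transition matrix P every Gram matrix becomes Pᵀ(·)P, so
the product is conjugated and its trace is unchanged. -/
theorem sum_inv_gram_basis_change (b b' : Module.Basis (Fin n) ℝ T) (h : T →ₗ[ℝ] T →ₗ[ℝ] ℝ)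
    (B : T →ₗ[ℝ] T →ₗ[ℝ] ℝ) : ∑ a, ∑ c, (gram b' h)⁻¹ a c * B (b' a) (b' c) =
      ∑ a, ∑ c, (gram b h)⁻¹ a c * B (b a) (b c) := by
  set P := b.toMatrix b' with hP
  have hG : ∀ D : T →ₗ[ℝ] T →ₗ[ℝ] ℝ, gram b' D = P.transpose * gram b D * P := by
    intro D
    ext a c
    have ha : b' a = ∑ i, P i a • b i := by simp [hP, Module.Basis.toMatrix_apply, b.sum_repr]
    have hc : b' c = ∑ i, P i c • b i := by simp [hP, Module.Basis.toMatrix_apply, b.sum_repr]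
    simp only [gram, Matrix.of_apply, Matrix.mul_apply, Matrix.transpose_apply]
    rw [ha, hc]
    simp only [map_sum, map_smul, LinearMap.sum_apply, LinearMap.smul_apply, smul_eq_mul,
      Finset.mul_sum, Finset.sum_mul]
    refine Finset.sum_congr rfl fun i _ => Finset.sum_congr rfl fun j _ => by ring
  have htr : ∀ (A D : Matrix (Fin n) (Fin n) ℝ), ∑ a, ∑ c, A a c * D a c =
      (A * D.transpose).trace := by
    intro A D; simp [Matrix.trace, Matrix.mul_apply]
  have hPu : IsUnit P.det := by
    have := b.toMatrix_mul_toMatrix_flip b'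
    exact Matrix.isUnit_det_of_right_inverse this
  have hPu' : IsUnit P.transpose.det := by rwa [Matrix.det_transpose]
  have e1 := htr (gram b' h)⁻¹ (gram b' B)
  have e2 := htr (gram b h)⁻¹ (gram b B)
  simp only [gram, Matrix.of_apply] at e1 e2 ⊢
  rw [e1, e2]
  change ((gram b' h)⁻¹ * (gram b' B).transpose).trace = ((gram b h)⁻¹ * (gram b B).transpose).trace
  rw [hG h, hG B, Matrix.mul_inv_rev, Matrix.mul_inv_rev, Matrix.transpose_mul,
    Matrix.transpose_mul, Matrix.transpose_transpose]
  calc _ = (P⁻¹ * ((gram b h)⁻¹ * ((P.transpose)⁻¹ * P.transpose) * (gram b B).transpose * P)).trace := by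
        simp only [Matrix.mul_assoc]
    _ = _ := by
      rw [Matrix.nonsing_inv_mul _ hPu', Matrix.mul_one, Matrix.trace_mul_comm, Matrix.mul_assoc,
        Matrix.mul_nonsing_inv _ hPu, Matrix.mul_one]

variable (b : Module.Basis (Fin n) ℝ T) (h : T →ₗ[ℝ] T →ₗ[ℝ] ℝ) (q : V →ₗ[ℝ] V →ₗ[ℝ] ℝ)

theorem twoFormInner_eq (α α' : T [⋀^Fin 2]→ₗ[ℝ] ExteriorAlgebra ℝ V) :
    twoFormInner b (fun u w => h u w) q α α' = (1 / 2 : ℝ) * ∑ a, ∑ d, ∑ c, ∑ k,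
      (gram b h)⁻¹ a c * (gram b h)⁻¹ d k *
        q (ExteriorAlgebra.ιInv (α ![b a, b d])) (ExteriorAlgebra.ιInv (α' ![b c, b k])) := rfl

theorem twoFormInner_comm (hs : ∀ s t, h s t = h t s) (hq : ∀ v w, q v w = q w v)
    (α α' : T [⋀^Fin 2]→ₗ[ℝ] ExteriorAlgebra ℝ V) :
    twoFormInner b (fun u w => h u w) q α α' = twoFormInner b (fun u w => h u w) q α' α := by
  have hG : ∀ a c, (gram b h)⁻¹ a c = (gram b h)⁻¹ c a := by
    intro a c
    have : ((gram b h)⁻¹).transpose = (gram b h)⁻¹ := by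
      rw [Matrix.transpose_nonsing_inv, gram_transpose b hs]
    conv_lhs => rw [← this]
    rfl
  rw [twoFormInner_eq, twoFormInner_eq]
  congr 1
  simp only [← Fintype.sum_prod_type']
  refine Fintype.sum_equiv ⟨fun x => ⟨x.2.2.1, x.2.2.2, x.1, x.2.1⟩,
    fun x => ⟨x.2.2.1, x.2.2.2, x.1, x.2.1⟩, fun _ => rfl, fun _ => rfl⟩ _ _ fun x => ?_
  simp only [Equiv.coe_fn_mk]
  rw [hG, hG x.2.1, hq]

/-- The trace identity is applied to one pair of indices at a time. The inner product is defined
with the standard basis of the model space, but the argument needs frames given by trivializations.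
-/
theorem twoFormInner_basis_change (b' : Module.Basis (Fin n) ℝ T)
    (α α' : T [⋀^Fin 2]→ₗ[ℝ] ExteriorAlgebra ℝ V) :
    twoFormInner b' (fun u w => h u w) q α α' = twoFormInner b (fun u w => h u w) q α α' := by
  have bil : ∀ (α : T [⋀^Fin 2]→ₗ[ℝ] ExteriorAlgebra ℝ V), ∃ B : T →ₗ[ℝ] T →ₗ[ℝ] V,
      ∀ s t, B s t = ExteriorAlgebra.ιInv (α ![s, t]) := by
    intro α
    refine ⟨LinearMap.mk₂ ℝ (fun s t => ExteriorAlgebra.ιInv (α ![s, t])) ?_ ?_ ?_ ?_,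
      fun _ _ => rfl⟩
    · intro s s' t
      rw [← map_add]; congr 1
      exact α.toMultilinearMap.cons_add ![t] s s'
    · intro r s t
      rw [← map_smul]; congr 1
      exact α.toMultilinearMap.cons_smul ![t] r s
    · intro s t t'
      rw [← map_add]; congr 1
      exact (α.curryLeft s).toMultilinearMap.cons_add ![] t t'
    · intro r s t
      rw [← map_smul]; congr 1
      exact (α.curryLeft s).toMultilinearMap.cons_smul ![] r t
  obtain ⟨B, hB⟩ := bil α
  obtain ⟨B', hB'⟩ := bil α'
  rw [twoFormInner_eq, twoFormInner_eq]
  congr 1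
  simp only [← hB, ← hB']
  have re : ∀ b : Module.Basis (Fin n) ℝ T, ∑ a, ∑ d, ∑ c, ∑ k,
      (gram b h)⁻¹ a c * (gram b h)⁻¹ d k * q (B (b a) (b d)) (B' (b c) (b k)) =
      ∑ a, ∑ c, (gram b h)⁻¹ a c * ∑ d, ∑ k, (gram b h)⁻¹ d k *
        q (B (b a) (b d)) (B' (b c) (b k)) := by
    intro b
    refine Finset.sum_congr rfl fun a _ => ?_
    rw [Finset.sum_comm]
    simp only [Finset.mul_sum, mul_assoc]
  have inner : ∀ s t : T, ∑ d, ∑ k, (gram b' h)⁻¹ d k * q (B s (b' d)) (B' t (b' k)) =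
      ∑ d, ∑ k, (gram b h)⁻¹ d k * q (B s (b d)) (B' t (b k)) := fun s t =>
    sum_inv_gram_basis_change b b' h (q.compl₁₂ (B s) (B' t))
  rw [re, re]
  simp only [inner]
  have := sum_inv_gram_basis_change b b' h (∑ d, ∑ k, (gram b h)⁻¹ d k •
    q.compl₁₂ (B.flip (b d)) (B'.flip (b k)))
  simpa only [LinearMap.sum_apply, LinearMap.smul_apply, LinearMap.compl₁₂_apply,
    LinearMap.flip_apply, smul_eq_mul] using this

/-- The inner product of two-forms multiplied by `2 det²`: a polynomial in the components. -/
def scaledInner (b : Fin n → T) (h : T →ₗ[ℝ] T →ₗ[ℝ] ℝ) (q : V →ₗ[ℝ] V →ₗ[ℝ] ℝ)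
    (α α' : T [⋀^Fin 2]→ₗ[ℝ] ExteriorAlgebra ℝ V) : ℝ :=
  ∑ a, ∑ d, ∑ c, ∑ k, (gram b h).adjugate a c * (gram b h).adjugate d k *
    q (ExteriorAlgebra.ιInv (α ![b a, b d])) (ExteriorAlgebra.ιInv (α' ![b c, b k]))

/-- Adjugates in place of inverse Gram matrices only rescale the inner product, and they leave an
expression polynomial in the components, so that smoothness involves no division. -/
theorem twoFormInner_eq_scaledInner (α α' : T [⋀^Fin 2]→ₗ[ℝ] ExteriorAlgebra ℝ V) :
    twoFormInner b (fun u w => h u w) q α α' =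
      1 / 2 * ((gram b h).det⁻¹) ^ 2 * scaledInner b h q α α' := by
  rw [twoFormInner_eq, scaledInner, mul_assoc]
  congr 1
  simp only [Finset.mul_sum, Matrix.inv_def, Matrix.smul_apply, Ring.inverse_eq_inv', smul_eq_mul]
  refine Finset.sum_congr rfl fun a _ => Finset.sum_congr rfl fun d _ =>
    Finset.sum_congr rfl fun c _ => Finset.sum_congr rfl fun k _ => by ring

end Metric

/-! ### Raising the indices of a two-form in 𝒯 -/

section DualTensor

variable {p : ℕ} {T V : Type*} [AddCommGroup T] [Module ℝ T] [AddCommGroup V] [Module ℝ V]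

/-- The tensor `K^{cdA}` of the functional `α ↦ scaledInner α θ`. -/
def dualTensor {n : ℕ} (b : Fin n → T) (f : Fin (n + 1) → V)
    (h : T →ₗ[ℝ] T →ₗ[ℝ] ℝ) (q : V →ₗ[ℝ] V →ₗ[ℝ] ℝ) (θ : T [⋀^Fin 2]→ₗ[ℝ] ExteriorAlgebra ℝ V)
    (c d : Fin n) (A : Fin (n + 1)) : ℝ :=
  ∑ k, ∑ l, (gram b h).adjugate c k * (gram b h).adjugate d l *
    q (f A) (ExteriorAlgebra.ιInv (θ ![b k, b l]))

variable {n : ℕ} (b : Module.Basis (Fin n) ℝ T) (f : Module.Basis (Fin (n + 1)) ℝ V)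
  (h : T →ₗ[ℝ] T →ₗ[ℝ] ℝ) (q : V →ₗ[ℝ] V →ₗ[ℝ] ℝ)
  (θ : T [⋀^Fin 2]→ₗ[ℝ] ExteriorAlgebra ℝ V)

theorem sum_dualTensor_mul (α : T [⋀^Fin 2]→ₗ[ℝ] ExteriorAlgebra ℝ V) :
    ∑ c, ∑ d, ∑ A, dualTensor b f h q θ c d A *
      f.coord A (ExteriorAlgebra.ιInv (α ![b c, b d])) = scaledInner b h q α θ := by
  refine Finset.sum_congr rfl fun c _ => Finset.sum_congr rfl fun d _ => ?_
  simp only [dualTensor, Finset.sum_mul]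
  rw [Finset.sum_comm]
  refine Finset.sum_congr rfl fun k _ => ?_
  rw [Finset.sum_comm]
  refine Finset.sum_congr rfl fun l _ => ?_
  conv_rhs => rw [← f.sum_repr (ExteriorAlgebra.ιInv (α ![b c, b d]))]
  simp only [map_sum, map_smul, LinearMap.sum_apply, LinearMap.smul_apply, smul_eq_mul,
    Finset.mul_sum, Module.Basis.coord_apply]
  exact Finset.sum_congr rfl fun A _ => by ring

theorem dualTensor_antisymm (c d : Fin n) (A : Fin (n + 1)) :
    dualTensor b f h q θ d c A = -dualTensor b f h q θ c d A := by
  rw [dualTensor, dualTensor, Finset.sum_comm, ← Finset.sum_neg_distrib]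
  refine Finset.sum_congr rfl fun k _ => ?_
  rw [← Finset.sum_neg_distrib]
  refine Finset.sum_congr rfl fun l _ => ?_
  have : θ ![b l, b k] = -θ ![b k, b l] := by
    rw [← θ.map_swap ![b k, b l] (i := 0) (j := 1) (by simp)]
    congr 1
    funext i
    fin_cases i <;> simp
  rw [this, map_neg, map_neg]
  ring

variable {e : T →ₗ[ℝ] V} {τ : Fin n → Fin n → T}

/-- The values of θ are tangential and hence orthogonal to the last vector in the auxiliary metric.
-/
theorem dualTensor_last (hτ : ∀ c d, θ ![b c, b d] = ExteriorAlgebra.ι ℝ (e (τ c d)))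
    (hq : ∀ u, q (f (Fin.last n)) (e u) = 0) (c d : Fin n) :
    dualTensor b f h q θ c d (Fin.last n) = 0 := by
  refine Finset.sum_eq_zero fun k _ => Finset.sum_eq_zero fun l _ => ?_
  rw [hτ, ExteriorAlgebra.ι_leftInverse, hq, mul_zero]

/-- Since e is isometric, lowering the value index and raising the form index c cancel up to the
Gram determinant, because adj(G) G = det G. What remains is the trace of θ. -/
theorem dualTensor_trace (hf : ∀ c, f (Fin.castSucc c) = e (b c))
    (hτ : ∀ c d, θ ![b c, b d] = ExteriorAlgebra.ι ℝ (e (τ c d)))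
    (hs : ∀ s t, h s t = h t s) (hq : ∀ u w, q (e u) (e w) = h u w)
    (htr : ∀ d, ∑ c, b.coord c (τ c d) = 0) (d : Fin n) :
    ∑ c, dualTensor b f h q θ c d (Fin.castSucc c) = 0 := by
  have h1 : ∀ c k l, (gram b h).adjugate c k * (gram b h).adjugate d l *
      q (f (Fin.castSucc c)) (ExteriorAlgebra.ιInv (θ ![b k, b l])) =
      ∑ i, (gram b h).adjugate d l * b.coord i (τ k l) *
        ((gram b h).adjugate c k * gram b h c i) := by
    intro c k l
    rw [hτ, ExteriorAlgebra.ι_leftInverse, hf, hq]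
    conv_lhs => rw [← b.sum_repr (τ k l)]
    simp only [map_sum, map_smul, smul_eq_mul, Finset.mul_sum, gram, Matrix.of_apply,
      Module.Basis.coord_apply]
    exact Finset.sum_congr rfl fun i _ => by ring
  have h2 : ∀ k i, ∑ c, (gram b h).adjugate c k * gram b h c i =
      (gram b h).det * (1 : Matrix (Fin n) (Fin n) ℝ) k i := by
    intro k i
    have h3 : (gram b h).adjugate.transpose = (gram b h).adjugate := by
      rw [Matrix.adjugate_transpose, gram_transpose _ hs]
    have h4 := congrFun (congrFun (Matrix.adjugate_mul (gram b h)) k) i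
    rw [Matrix.mul_apply, Matrix.smul_apply, smul_eq_mul] at h4
    rw [← h4]
    refine Finset.sum_congr rfl fun c _ => ?_
    conv_rhs => rw [← h3]
    rfl
  simp only [dualTensor, h1]
  rw [Finset.sum_comm]
  have h5 : ∀ k, ∑ c, ∑ l, ∑ i, (gram b h).adjugate d l * b.coord i (τ k l) *
        ((gram b h).adjugate c k * gram b h c i) =
      ∑ l, (gram b h).adjugate d l * (gram b h).det * b.coord k (τ k l) := by
    intro k
    rw [Finset.sum_comm]
    refine Finset.sum_congr rfl fun l _ => ?_
    rw [Finset.sum_comm]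
    simp only [← Finset.mul_sum, h2, Matrix.one_apply]
    simp
    ring
  simp only [h5]
  rw [Finset.sum_comm]
  simp only [← Finset.mul_sum, htr]
  simp

theorem contractRight_ι_mul_ι (u w : V) (d : Module.Dual ℝ V) :
    CliffordAlgebra.contractRight (ExteriorAlgebra.ι ℝ u * ExteriorAlgebra.ι ℝ w) d =
      ExteriorAlgebra.ι ℝ (d w • u - d u • w) := by
  have h1 := CliffordAlgebra.contractRight_mul_ι (Q := (0 : QuadraticForm ℝ V)) d w
    (ExteriorAlgebra.ι ℝ u)
  have h2 : CliffordAlgebra.contractRight (ExteriorAlgebra.ι ℝ u) d =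
      algebraMap ℝ (ExteriorAlgebra ℝ V) (d u) :=
    CliffordAlgebra.contractRight_ι (Q := (0 : QuadraticForm ℝ V)) d u
  refine h1.trans ?_
  rw [h2, map_sub, map_smul, map_smul, Algebra.smul_def (d u)]

/-- Orthogonality to the brackets of trace-free tensors with `e`. -/
theorem dualTensor_symm (hf : ∀ c, f (Fin.castSucc c) = e (b c))
    (hτ : ∀ c d, θ ![b c, b d] = ExteriorAlgebra.ι ℝ (e (τ c d)))
    (hs : ∀ s t, h s t = h t s) (hq : ∀ u w, q (e u) (e w) = h u w)
    (htr : ∀ d, ∑ c, b.coord c (τ c d) = 0)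
    (η : V →ₗ[ℝ] V →ₗ[ℝ] ℝ) (hη : ∀ u w, η u w = η w u)
    (ho : ∀ φ s t, scaledInner b h q (altProd 1 1 (CliffordAlgebra.contractRight :
        ExteriorAlgebra ℝ V →ₗ[ℝ] Module.Dual ℝ V →ₗ[ℝ] ExteriorAlgebra ℝ V)
        (oneForm (traceFree n e φ s t)) (oneForm (η ∘ₗ e))) θ = 0) (k s t : Fin n) :
    ∑ d, dualTensor b f h q θ k d (Fin.castSucc s) * η (e (b d)) (e (b t)) =
      ∑ d, dualTensor b f h q θ k d (Fin.castSucc t) * η (e (b d)) (e (b s)) := by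
  set K := dualTensor b f h q θ with hK
  have hanti : ∀ c d A, K d c A = -K c d A := dualTensor_antisymm b f h q θ
  have ht : ∀ d, ∑ c, K c d (Fin.castSucc c) = 0 := dualTensor_trace b f h q θ hf hτ hs hq htr
  set g : Fin n → Fin n → ℝ := fun c d => η (e (b c)) (e (b d)) with hg
  have hgs : ∀ c d, g c d = g d c := fun c d => hη _ _
  set Φ : Fin n → Fin n → V := fun c d => (b.coord k (b c)) • (g t d • e (b s) - g s d • e (b t)) -
    ((n : ℝ) - 1)⁻¹ • ((b.coord k (b s)) • (g t d • e (b c) - g c d • e (b t)) -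
      (b.coord k (b t)) • (g s d • e (b c) - g c d • e (b s))) with hΦ
  have h1 := ho (b.coord k) (b s) (b t)
  rw [← sum_dualTensor_mul b f] at h1
  have h2 : ∀ c d, ExteriorAlgebra.ιInv (altProd 1 1 (CliffordAlgebra.contractRight :
        ExteriorAlgebra ℝ V →ₗ[ℝ] Module.Dual ℝ V →ₗ[ℝ] ExteriorAlgebra ℝ V)
        (oneForm (traceFree n e (b.coord k) (b s) (b t))) (oneForm (η ∘ₗ e)) ![b c, b d]) =
      Φ c d - Φ d c := by
    intro c d
    have h3 : ∀ c d, CliffordAlgebra.contractRight (traceFree n e (b.coord k) (b s) (b t) (b c))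
        ((η ∘ₗ e) (b d)) = ExteriorAlgebra.ι ℝ (Φ c d) := by
      intro c d
      have hh : ∀ c, (η ∘ₗ e) (b d) (e (b c)) = g c d := fun c => hη _ _
      simp only [traceFree_apply, map_sub, map_smul, LinearMap.sub_apply, LinearMap.smul_apply,
        contractRight_ι_mul_ι, hh, hΦ]
    rw [altProd_one_one_apply]
    change ExteriorAlgebra.ιInv (CliffordAlgebra.contractRight (traceFree n e (b.coord k) (b s) (b t) (b c))
        ((η ∘ₗ e) (b d)) - CliffordAlgebra.contractRight (traceFree n e (b.coord k) (b s) (b t) (b d))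
        ((η ∘ₗ e) (b c))) = _
    rw [h3, h3, ← map_sub, ExteriorAlgebra.ι_leftInverse]
  -- As K is antisymmetric, the two terms of the antisymmetrized bracket contribute equally.
  have h4 : ∑ c, ∑ d, ∑ A, K c d A * f.coord A (Φ c d) = 0 := by
    simp only [h2, map_sub, mul_sub, Finset.sum_sub_distrib] at h1
    have h5 : ∑ c, ∑ d, ∑ A, K c d A * f.coord A (Φ d c) =
        -∑ c, ∑ d, ∑ A, K c d A * f.coord A (Φ c d) := by
      rw [Finset.sum_comm]
      simp only [← Finset.sum_neg_distrib]
      exact Finset.sum_congr rfl fun c _ => Finset.sum_congr rfl fun d _ =>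
        Finset.sum_congr rfl fun A _ => by rw [hanti c d]; ring
    have h1' : ∑ c, ∑ d, ∑ A, K c d A * f.coord A (Φ c d) -
      ∑ c, ∑ d, ∑ A, K c d A * f.coord A (Φ d c) = 0 := h1
    rw [h5] at h1'
    linarith
  have h6 : ∀ c d (j : Fin n), ∑ A, K c d A * f.coord A (e (b j)) = K c d (Fin.castSucc j) := by
    intro c d j
    rw [← hf]
    simp [Finsupp.single_apply]
  have h7 : ∀ c d, ∑ A, K c d A * f.coord A (Φ c d) =
      b.coord k (b c) * (K c d (Fin.castSucc s) * g t d - K c d (Fin.castSucc t) * g s d) -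
      ((n : ℝ) - 1)⁻¹ * (b.coord k (b s) * (K c d (Fin.castSucc c) * g t d -
        K c d (Fin.castSucc t) * g c d) - b.coord k (b t) * (K c d (Fin.castSucc c) * g s d -
        K c d (Fin.castSucc s) * g c d)) := by
    intro c d
    simp only [← h6, hΦ, map_sub, map_smul, smul_eq_mul, Finset.sum_mul, Finset.mul_sum,
      ← Finset.sum_sub_distrib]
    exact Finset.sum_congr rfl fun A _ => by ring
  -- The trace correction of the test element contributes nothing: its pieces are either traces of K
  -- (`h8`) or contractions of the antisymmetric K with the symmetric η(e, e) (`h9`). The leading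
  -- term alone is the asserted symmetry.
  have h8 : ∀ j, ∑ c, ∑ d, K c d (Fin.castSucc c) * g j d = 0 := by
    intro j
    rw [Finset.sum_comm]
    simp only [← Finset.sum_mul, ht, zero_mul, Finset.sum_const_zero]
  have h9 : ∀ j, ∑ c, ∑ d, K c d (Fin.castSucc j) * g c d = 0 := by
    intro j
    have : ∑ c, ∑ d, K c d (Fin.castSucc j) * g c d = -∑ c, ∑ d, K c d (Fin.castSucc j) * g c d := by
      conv_lhs => rw [Finset.sum_comm]
      simp only [← Finset.sum_neg_distrib]
      exact Finset.sum_congr rfl fun c _ => Finset.sum_congr rfl fun d _ => by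
        rw [hanti c d, hgs d c]; ring
    linarith
  simp only [h7, Finset.sum_sub_distrib, ← Finset.mul_sum, h8, h9] at h4
  simp only [Module.Basis.coord_apply, Module.Basis.repr_self, Finsupp.single_apply] at h4
  simp at h4
  have h10 : ∀ i j, ∑ d, K k d (Fin.castSucc i) * η (e (b d)) (e (b j)) =
      ∑ d, K k d (Fin.castSucc i) * g j d := fun i j =>
    Finset.sum_congr rfl fun d _ => by rw [hgs j d]
  rw [h10, h10]
  linarith

end DualTensor

/-! ### Smooth functions with values in an exterior algebra -/

section SmoothExterior

variable {E₀ : Type*} [NormedAddCommGroup E₀] [NormedSpace ℝ E₀] {H₀ : Type*} [TopologicalSpace H₀]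
  {I : ModelWithCorners ℝ E₀ H₀} {M : Type*} [TopologicalSpace M] [ChartedSpace H₀ M]
variable {F F' : Type*} [NormedAddCommGroup F] [NormedSpace ℝ F] [FiniteDimensional ℝ F]
  [NormedAddCommGroup F'] [NormedSpace ℝ F'] [FiniteDimensional ℝ F']

/-- A function with values in an exterior algebra is smooth if all its components are. -/
def ExtSmoothAt (I : ModelWithCorners ℝ E₀ H₀) (a : M → ExteriorAlgebra ℝ F) (x : M) : Prop :=
  ∀ l : ExteriorAlgebra ℝ F →ₗ[ℝ] ℝ, ContMDiffAt I 𝓘(ℝ, ℝ) ∞ (fun y => l (a y)) x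

theorem contMDiffAt_linear_comp {a : M → F} {x : M} (ha : ContMDiffAt I 𝓘(ℝ, F) ∞ a x)
    (l : F →ₗ[ℝ] F') : ContMDiffAt I 𝓘(ℝ, F') ∞ (fun y => l (a y)) x :=
  (LinearMap.toContinuousLinearMap l).contMDiff.contMDiffAt.comp x ha

theorem contMDiffAt_of_forall_dual {a : M → F} {x : M}
    (ha : ∀ l : F →ₗ[ℝ] ℝ, ContMDiffAt I 𝓘(ℝ, ℝ) ∞ (fun y => l (a y)) x) :
    ContMDiffAt I 𝓘(ℝ, F) ∞ a x := by
  have b := Module.finBasis ℝ F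
  have h : a = fun y => ∑ k, b.coord k (a y) • b k := by
    funext y; simp [b.sum_repr]
  rw [h]
  exact contMDiffAt_finsetSum fun k _ => (ha (b.coord k)).smul contMDiffAt_const

namespace ExtSmoothAt

variable {a a' : M → ExteriorAlgebra ℝ F} {x : M}

theorem congr_of_eventuallyEq (h : ExtSmoothAt I a x) (h' : a' =ᶠ[𝓝 x] a) : ExtSmoothAt I a' x :=
  fun l => (h l).congr_of_eventuallyEq (h'.fun_comp l)

theorem const (w : ExteriorAlgebra ℝ F) : ExtSmoothAt I (fun _ : M => w) x :=
  fun _ => contMDiffAt_const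

theorem add (h : ExtSmoothAt I a x) (h' : ExtSmoothAt I a' x) :
    ExtSmoothAt I (fun y => a y + a' y) x := fun l => by
  simp only [map_add]; exact (h l).add (h' l)

theorem sub (h : ExtSmoothAt I a x) (h' : ExtSmoothAt I a' x) :
    ExtSmoothAt I (fun y => a y - a' y) x := fun l => by
  simp only [map_sub]; exact (h l).sub (h' l)

theorem smul {r : M → ℝ} (hr : ContMDiffAt I 𝓘(ℝ, ℝ) ∞ r x) (h : ExtSmoothAt I a x) :
    ExtSmoothAt I (fun y => r y • a y) x := fun l => by
  simp only [map_smul, smul_eq_mul]; exact hr.mul (h l)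

theorem sum {ι : Type*} {s : Finset ι} {g : ι → M → ExteriorAlgebra ℝ F}
    (h : ∀ k ∈ s, ExtSmoothAt I (g k) x) : ExtSmoothAt I (fun y => ∑ k ∈ s, g k y) x := fun l => by
  simp only [map_sum]
  exact contMDiffAt_finsetSum fun k hk => h k hk l

/-- A finite basis of the exterior algebra of a finite-dimensional space. -/
theorem _root_.PalatiniCartan.exists_exterior_basis (F : Type*) [AddCommGroup F] [Module ℝ F]
    [FiniteDimensional ℝ F] : ∃ n : ℕ, Nonempty (Module.Basis (Finset (Fin n)) ℝ (ExteriorAlgebra ℝ F)) :=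
  ⟨_, ⟨(Module.finBasis ℝ F).ExteriorAlgebra⟩⟩

theorem mul (h : ExtSmoothAt I a x) (h' : ExtSmoothAt I a' x) :
    ExtSmoothAt I (fun y => a y * a' y) x := by
  obtain ⟨n, ⟨B⟩⟩ := exists_exterior_basis F
  have e : (fun y => a y * a' y) =
      fun y => ∑ s, ∑ t, (B.coord s (a y) * B.coord t (a' y)) • (B s * B t) := by
    funext y
    conv_lhs => rw [← B.sum_repr (a y), ← B.sum_repr (a' y)]
    rw [Finset.sum_mul_sum]
    simp only [smul_mul_smul_comm, Module.Basis.coord_apply]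
  rw [e]
  exact sum fun s _ => sum fun t _ => smul ((h (B.coord s)).mul (h' (B.coord t))) (const _)

theorem ι_comp {u : M → F} (hu : ContMDiffAt I 𝓘(ℝ, F) ∞ u x) :
    ExtSmoothAt I (fun y => ExteriorAlgebra.ι ℝ (u y)) x := fun l =>
  contMDiffAt_linear_comp hu (l ∘ₗ ExteriorAlgebra.ι ℝ)

theorem map_const {G : M → F →ₗ[ℝ] F'} (hG : ∀ u, ContMDiffAt I 𝓘(ℝ, F') ∞ (fun y => G y u) x)
    (w : ExteriorAlgebra ℝ F) : ExtSmoothAt I (fun y => ExteriorAlgebra.map (G y) w) x := by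
  induction w using ExteriorAlgebra.induction with
  | algebraMap r => simpa only [AlgHom.commutes] using const _
  | ι u => simpa only [ExteriorAlgebra.map_apply_ι] using ι_comp (hG u)
  | mul a b ha hb => simpa only [map_mul] using ha.mul hb
  | add a b ha hb => simpa only [map_add] using ha.add hb

theorem map {G : M → F →ₗ[ℝ] F'} (hG : ∀ u, ContMDiffAt I 𝓘(ℝ, F') ∞ (fun y => G y u) x)
    (h : ExtSmoothAt I a x) : ExtSmoothAt I (fun y => ExteriorAlgebra.map (G y) (a y)) x := by
  obtain ⟨n, ⟨B⟩⟩ := exists_exterior_basis F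
  have e : (fun y => ExteriorAlgebra.map (G y) (a y)) =
      fun y => ∑ s, B.coord s (a y) • ExteriorAlgebra.map (G y) (B s) := by
    funext y
    conv_lhs => rw [← B.sum_repr (a y)]
    simp only [map_sum, map_smul, Module.Basis.coord_apply]
  rw [e]
  exact sum fun s _ => smul (h _) (map_const hG _)

end ExtSmoothAt

end SmoothExterior

/-! ### Smooth sections and form fields in trivializations -/

section Fields

variable {m : ℕ} {M : Type*} [TopologicalSpace M] [ChartedSpace (BaseModel m) M]
  [IsManifold (𝓡 (m + 3)) ∞ M]
  {V : M → Type*} [∀ x, AddCommGroup (V x)] [∀ x, Module ℝ (V x)] [∀ x, TopologicalSpace (V x)]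
  [TopologicalSpace (TotalSpace (FibreModel m) V)] [FiberBundle (FibreModel m) V]
  [VectorBundle ℝ (FibreModel m) V]

variable (m) in
/-- The trivialization of the tangent bundle at a point. -/
abbrev tangentTriv (x₀ : M) : Trivialization (BaseModel m)
    (TotalSpace.proj : TotalSpace (BaseModel m) (TangentSpace (𝓡 (m + 3)) : M → Type _) → M) :=
  trivializationAt (BaseModel m) (TangentSpace (𝓡 (m + 3)) : M → Type _) x₀

variable (V) in
/-- The common domain of the trivializations of the two bundles at a point. -/
def trivDomain (x₀ : M) : Set M :=
  (tangentTriv m x₀).baseSet ∩ (trivializationAt (FibreModel m) V x₀).baseSet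

theorem isOpen_trivDomain (x₀ : M) : IsOpen (trivDomain (m := m) V x₀) :=
  (tangentTriv m x₀).open_baseSet.inter (trivializationAt (FibreModel m) V x₀).open_baseSet

theorem mem_trivDomain (x₀ : M) : x₀ ∈ trivDomain (m := m) V x₀ :=
  ⟨mem_baseSet_trivializationAt _ _ _, mem_baseSet_trivializationAt _ _ _⟩

/-- Smooth sections of `V`. -/
abbrev SectionSmoothAt (s : ∀ x, V x) (x : M) : Prop :=
  ContMDiffAt (𝓡 (m + 3)) ((𝓡 (m + 3)).prod 𝓘(ℝ, FibreModel m)) ∞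
    (fun y => TotalSpace.mk' (FibreModel m) y (s y)) x

/-- Smooth vector fields. -/
abbrev FieldSmoothAt (s : ∀ x : M, TangentSpace (𝓡 (m + 3)) x) (x : M) : Prop :=
  ContMDiffAt (𝓡 (m + 3)) ((𝓡 (m + 3)).prod 𝓘(ℝ, BaseModel m)) ∞
    (fun y => TotalSpace.mk' (BaseModel m) y (s y)) x

theorem fieldSmoothAt_iff (s : ∀ x : M, TangentSpace (𝓡 (m + 3)) x) {x₀ x : M}
    (hx : x ∈ (tangentTriv m x₀).baseSet) : FieldSmoothAt s x ↔
      ContMDiffAt (𝓡 (m + 3)) 𝓘(ℝ, BaseModel m) ∞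
        (fun y => (tangentTriv m x₀).linearMapAt ℝ y (s y)) x := by
  rw [FieldSmoothAt, (tangentTriv m x₀).contMDiffAt_section_iff hx]
  refine Filter.EventuallyEq.contMDiffAt_iff ?_
  filter_upwards [(tangentTriv m x₀).open_baseSet.mem_nhds hx] with y hy
  rw [Trivialization.coe_linearMapAt_of_mem _ hy]

theorem fieldSmoothAt_symmL {x₀ x : M} (hx : x ∈ (tangentTriv m x₀).baseSet) (v : BaseModel m) :
    FieldSmoothAt (fun y => (tangentTriv m x₀).symmL ℝ y v) x := by
  rw [fieldSmoothAt_iff _ hx]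
  refine (contMDiffAt_const (c := v)).congr_of_eventuallyEq ?_
  filter_upwards [(tangentTriv m x₀).open_baseSet.mem_nhds hx] with y hy
  exact Trivialization.linearMapAt_symmₗ _ hy v

theorem isSmoothField_iff {i : ℕ} {φ : FormField m V i} : IsSmoothField φ ↔
    ∀ (x₀ : M) (v : Fin i → BaseModel m), ∀ x ∈ trivDomain (m := m) V x₀,
      ExtSmoothAt (𝓡 (m + 3)) (fun y => ExteriorAlgebra.map
        ((trivializationAt (FibreModel m) V x₀).linearMapAt ℝ y)
        (φ y fun k => (tangentTriv m x₀).symmL ℝ y (v k))) x := by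
  refine ⟨fun h x₀ v x hx l => ?_, fun h x₀ v l x hx => ?_⟩
  · exact (h x₀ v l x hx).contMDiffAt ((isOpen_trivDomain x₀).mem_nhds hx)
  · exact (h x₀ v x hx l).contMDiffWithinAt

variable [ContMDiffVectorBundle ∞ (FibreModel m) V (𝓡 (m + 3))]

theorem sectionSmoothAt_iff (s : ∀ x, V x) {x₀ x : M}
    (hx : x ∈ (trivializationAt (FibreModel m) V x₀).baseSet) : SectionSmoothAt (m := m) s x ↔
      ContMDiffAt (𝓡 (m + 3)) 𝓘(ℝ, FibreModel m) ∞
        (fun y => (trivializationAt (FibreModel m) V x₀).linearMapAt ℝ y (s y)) x := by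
  rw [SectionSmoothAt, (trivializationAt (FibreModel m) V x₀).contMDiffAt_section_iff hx]
  refine Filter.EventuallyEq.contMDiffAt_iff ?_
  filter_upwards [(trivializationAt (FibreModel m) V x₀).open_baseSet.mem_nhds hx] with y hy
  rw [Trivialization.coe_linearMapAt_of_mem _ hy]

theorem sectionSmoothAt_symmL {x₀ x : M} (hx : x ∈ (trivializationAt (FibreModel m) V x₀).baseSet)
    (v : FibreModel m) :
    SectionSmoothAt (m := m) (fun y => (trivializationAt (FibreModel m) V x₀).symmL ℝ y v) x := by
  rw [sectionSmoothAt_iff _ hx]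
  refine (contMDiffAt_const (c := v)).congr_of_eventuallyEq ?_
  filter_upwards [(trivializationAt (FibreModel m) V x₀).open_baseSet.mem_nhds hx] with y hy
  exact Trivialization.linearMapAt_symmₗ _ hy v

/-- The components of degree one of a smooth field are smooth sections. -/
theorem IsSmoothField.sectionSmoothAt {i : ℕ} {φ : FormField m V i} (h : IsSmoothField φ) {x₀ x : M}
    (hx : x ∈ trivDomain (m := m) V x₀) (v : Fin i → BaseModel m) :
    SectionSmoothAt (m := m) (fun y => ExteriorAlgebra.ιInv
      (φ y fun k => (tangentTriv m x₀).symmL ℝ y (v k))) x := by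
  rw [sectionSmoothAt_iff _ hx.2]
  refine contMDiffAt_of_forall_dual fun l => ?_
  refine (isSmoothField_iff.mp h x₀ v x hx (l ∘ₗ ExteriorAlgebra.ιInv)).congr_of_eventuallyEq ?_
  refine Filter.Eventually.of_forall fun y => ?_
  have := LinearMap.congr_fun (ExteriorAlgebra.ιInv_comp_map
    ((trivializationAt (FibreModel m) V x₀).linearMapAt ℝ y))
    (φ y fun k => (tangentTriv m x₀).symmL ℝ y (v k))
  exact congrArg l this.symm

/-- Smoothness of a field that is supported in the domain of a trivialization. -/
theorem isSmoothField_of_support {i : ℕ} {φ : FormField m V i} {x₀ : M} {K : Set M}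
    (hK : IsClosed K) (hKU : K ⊆ trivDomain (m := m) V x₀) (h0 : ∀ x, x ∉ K → φ x = 0)
    (h : ∀ (v : Fin i → BaseModel m), ∀ x ∈ trivDomain (m := m) V x₀,
      ExtSmoothAt (𝓡 (m + 3)) (fun y => ExteriorAlgebra.map
        ((trivializationAt (FibreModel m) V x₀).linearMapAt ℝ y)
        (φ y fun k => (tangentTriv m x₀).symmL ℝ y (v k))) x) : IsSmoothField φ := by
  rw [isSmoothField_iff]
  intro x₁ v x hx
  by_cases hxK : x ∈ K
  swap
  · refine (ExtSmoothAt.const 0).congr_of_eventuallyEq ?_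
    filter_upwards [hK.isOpen_compl.mem_nhds hxK] with y hy
    rw [h0 y hy]; simp
  have hx0 := hKU hxK
  set B := (EuclideanSpace.basisFun (Fin (m + 3)) ℝ).toBasis
  -- Transition coefficients between the tangent trivializations at x₁ and x₀. Multilinearity in the
  -- form arguments, together with the change of trivialization of V, carries smoothness from x₀ to
  -- x₁.
  set g : Fin i → Fin (m + 3) → M → ℝ := fun k c y =>
    B.coord c ((tangentTriv m x₀).linearMapAt ℝ y ((tangentTriv m x₁).symmL ℝ y (v k))) with hg
  have hgs : ∀ k c, ContMDiffAt (𝓡 (m + 3)) 𝓘(ℝ, ℝ) ∞ (g k c) x := fun k c =>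
    contMDiffAt_linear_comp ((fieldSmoothAt_iff _ hx0.1).mp (fieldSmoothAt_symmL hx.1 _)) _
  have main : ExtSmoothAt (𝓡 (m + 3)) (fun y => ∑ c : Fin i → Fin (m + 3), (∏ k, g k (c k) y) •
      ExteriorAlgebra.map ((trivializationAt (FibreModel m) V x₁).linearMapAt ℝ y ∘ₗ
        ((trivializationAt (FibreModel m) V x₀).symmL ℝ y).toLinearMap)
      (ExteriorAlgebra.map ((trivializationAt (FibreModel m) V x₀).linearMapAt ℝ y)
        (φ y fun k => (tangentTriv m x₀).symmL ℝ y (B (c k))))) x := by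
    refine ExtSmoothAt.sum fun c _ => ExtSmoothAt.smul ?_ (ExtSmoothAt.map (fun u => ?_) (h _ x hx0))
    · exact contMDiffAt_finsetProd fun k _ => hgs k (c k)
    · exact (sectionSmoothAt_iff _ hx.2).mp (sectionSmoothAt_symmL hx0.2 u)
  refine main.congr_of_eventuallyEq ?_
  filter_upwards [(isOpen_trivDomain x₀).mem_nhds hx0] with y hy
  have h1 : ∀ k, (tangentTriv m x₁).symmL ℝ y (v k) =
      ∑ c, g k c y • (tangentTriv m x₀).symmL ℝ y (B c) := by
    intro k
    rw [← Trivialization.symmₗ_linearMapAt (R := ℝ) _ hy.1 ((tangentTriv m x₁).symmL ℝ y (v k))]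
    conv_lhs => rw [← B.sum_repr ((tangentTriv m x₀).linearMapAt ℝ y
      ((tangentTriv m x₁).symmL ℝ y (v k)))]
    rw [map_sum]
    simp only [map_smul]
    rfl
  have h2 : (fun k => (tangentTriv m x₁).symmL ℝ y (v k)) =
    fun k => ∑ c, g k c y • (tangentTriv m x₀).symmL ℝ y (B c) := funext h1
  have h3 : ∀ (a : ExteriorAlgebra ℝ (V y)), ExteriorAlgebra.map
      ((trivializationAt (FibreModel m) V x₁).linearMapAt ℝ y ∘ₗ
        ((trivializationAt (FibreModel m) V x₀).symmL ℝ y).toLinearMap)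
      (ExteriorAlgebra.map ((trivializationAt (FibreModel m) V x₀).linearMapAt ℝ y) a) =
      ExteriorAlgebra.map ((trivializationAt (FibreModel m) V x₁).linearMapAt ℝ y) a := by
    intro a
    rw [← AlgHom.comp_apply, ExteriorAlgebra.map_comp_map]
    congr 2
    refine LinearMap.ext fun u => ?_
    exact congrArg ((trivializationAt (FibreModel m) V x₁).linearMapAt ℝ y)
      (Trivialization.symmₗ_linearMapAt (R := ℝ) _ hy.2 u)
  simp only [h3, h2]
  rw [← AlternatingMap.coe_multilinearMap, MultilinearMap.map_sum, map_sum]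
  refine Finset.sum_congr rfl fun c _ => ?_
  rw [MultilinearMap.map_smul_univ, map_smul]

end Fields

/-! ### Symbols of wedge products of fields -/

section FieldAlgebra

variable {m : ℕ} {M : Type*} [TopologicalSpace M] [ChartedSpace (BaseModel m) M]
  [IsManifold (𝓡 (m + 3)) ∞ M]
  {V : M → Type*} [∀ x, AddCommGroup (V x)] [∀ x, Module ℝ (V x)] [∀ x, TopologicalSpace (V x)]
  [TopologicalSpace (TotalSpace (FibreModel m) V)] [FiberBundle (FibreModel m) V]
  [VectorBundle ℝ (FibreModel m) V]

theorem wedge_apply (i j k : ℕ) (α : FormField m V i) (β : FormField m V k) (x : M) :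
    wedge i j k α β x = (-1 : ℝ) ^ (j * k) •
      altProd i k (LinearMap.mul ℝ (ExteriorAlgebra ℝ (V x))) (α x) (β x) := rfl

theorem bracket_apply (η : ∀ x : M, V x →ₗ[ℝ] V x →ₗ[ℝ] ℝ)
    (φ : ∀ x : M, TangentSpace (𝓡 (m + 3)) x →ₗ[ℝ] V x) (i : ℕ) (A : FormField m V i) (x : M) :
    bracket η φ i A x = altProd i 1 (CliffordAlgebra.contractRight :
        ExteriorAlgebra ℝ (V x) →ₗ[ℝ] Module.Dual ℝ (V x) →ₗ[ℝ] ExteriorAlgebra ℝ (V x))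
      (A x) (oneForm (η x ∘ₗ φ x)) := rfl

theorem wedge_mem {i j k l : ℕ} {α : FormField m V i} {β : FormField m V k} {x : M}
    (hα : ∀ t, α x t ∈ ⋀[ℝ]^j (V x)) (hβ : ∀ t, β x t ∈ ⋀[ℝ]^l (V x)) (t) :
    wedge i j k α β x t ∈ ⋀[ℝ]^(j + l) (V x) := by
  rw [wedge_apply, AlternatingMap.smul_apply]
  exact Submodule.smul_mem _ _ (altProd_mem _ _ _ _
    (fun s t => mul_mem_exteriorPower (hα s) (hβ t)) t)

theorem symb_wedge {n : ℕ} {i j k : ℕ} {α : FormField m V i} (β : FormField m V k) {x : M}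
    (b : Module.Basis (Fin n) ℝ (TangentSpace (𝓡 (m + 3)) x))
    (hα : ∀ t, α x t ∈ ⋀[ℝ]^j (V x)) :
    symb b (wedge i j k α β x) = symb b (α x) * symb b (β x) := by
  rw [wedge_apply, symb_mul b hα]

variable (e : ∀ x : M, TangentSpace (𝓡 (m + 3)) x →ₗ[ℝ] V x)

theorem vecForm_mem (x : M) (t) : vecForm e x t ∈ ⋀[ℝ]^1 (V x) :=
  ι_mem_exteriorPower_one _

theorem wedgePow_mem {i j : ℕ} (k : ℕ) {A : FormField m V i} {x : M}
    (hA : ∀ t, A x t ∈ ⋀[ℝ]^j (V x)) (t) :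
    wedgePow e i j k A x t ∈ ⋀[ℝ]^(j + k) (V x) := by
  induction k with
  | zero => exact hA t
  | succ k ih => exact wedge_mem (i := i + k) (j := j + k) (k := 1) (l := 1) ih (vecForm_mem e x) t

theorem symb_wedgePow {n : ℕ} {i j : ℕ} (k : ℕ) {A : FormField m V i} {x : M}
    (b : Module.Basis (Fin n) ℝ (TangentSpace (𝓡 (m + 3)) x)) (hA : ∀ t, A x t ∈ ⋀[ℝ]^j (V x)) :
    symb b (wedgePow e i j k A x) = symb b (A x) * coframeSymb b (e x) ^ k := by
  induction k with
  | zero => rw [pow_zero, mul_one]; rfl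
  | succ k ih =>
    have h := symb_wedge (i := i + k) (j := j + k) (k := 1) (vecForm e) b (wedgePow_mem e k hA)
    rw [pow_succ, ← mul_assoc, ← ih, ← symb_oneForm_ι]
    exact h

end FieldAlgebra

section Kernels

variable {m : ℕ} {M : Type*} [TopologicalSpace M] [ChartedSpace (BaseModel m) M]
  [IsManifold (𝓡 (m + 3)) ∞ M]
  {V : M → Type*} [∀ x, AddCommGroup (V x)] [∀ x, Module ℝ (V x)] [∀ x, TopologicalSpace (V x)]
  [TopologicalSpace (TotalSpace (FibreModel m) V)] [FiberBundle (FibreModel m) V]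
  [VectorBundle ℝ (FibreModel m) V]
  [∀ x, IsTopologicalAddGroup (V x)] [∀ x, ContinuousSMul ℝ (V x)]

namespace BoundaryCoframe

variable (C : BoundaryCoframe m V)

theorem ηlin_apply (x : M) (u w : V x) : C.ηlin x u w = C.η x u w := rfl

theorem mem_kerW_of_symb {n i j k : ℕ} {A : FormField m V i} (hA : A ∈ Omega m V i j)
    (b : ∀ x : M, Module.Basis (Fin n) ℝ (TangentSpace (𝓡 (m + 3)) x))
    (h : ∀ x, symb (b x) (A x) * coframeSymb (b x) (C.e x) ^ k = 0) : A ∈ C.kerW i j k := by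
  refine ⟨hA, LinearMap.mem_ker.mpr (funext fun x => symb_injective (b x) ?_)⟩
  rw [symb_wedgePow C.e k (b x) (hA.1 x), h, Pi.zero_apply, map_zero]

theorem symb_of_mem_kerW {n i j k : ℕ} {A : FormField m V i} (hA : A ∈ C.kerW i j k) {x : M}
    (b : Module.Basis (Fin n) ℝ (TangentSpace (𝓡 (m + 3)) x)) :
    symb b (A x) * coframeSymb b (C.e x) ^ k = 0 := by
  rw [← symb_wedgePow C.e k b (hA.1.1 x), LinearMap.mem_ker.mp hA.2, Pi.zero_apply, map_zero]

end BoundaryCoframe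

end Kernels

/-! ### Smoothness of determinants, adjugates and bilinear expressions -/

section SmoothMatrix

variable {E₀ : Type*} [NormedAddCommGroup E₀] [NormedSpace ℝ E₀] {H₀ : Type*} [TopologicalSpace H₀]
  {I : ModelWithCorners ℝ E₀ H₀} {M : Type*} [TopologicalSpace M] [ChartedSpace H₀ M]

theorem contMDiffAt_det {n : ℕ} {A : M → Matrix (Fin n) (Fin n) ℝ} {x : M}
    (h : ∀ i j, ContMDiffAt I 𝓘(ℝ, ℝ) ∞ (fun y => A y i j) x) :
    ContMDiffAt I 𝓘(ℝ, ℝ) ∞ (fun y => (A y).det) x := by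
  simp only [Matrix.det_apply]
  refine contMDiffAt_finsetSum fun σ _ => ?_
  simp only [Units.smul_def, ← Int.cast_smul_eq_zsmul ℝ, smul_eq_mul]
  exact contMDiffAt_const.mul (contMDiffAt_finsetProd fun k _ => h (σ k) k)

theorem contMDiffAt_adjugate {n : ℕ} {A : M → Matrix (Fin n) (Fin n) ℝ} {x : M}
    (h : ∀ i j, ContMDiffAt I 𝓘(ℝ, ℝ) ∞ (fun y => A y i j) x) (i j : Fin n) :
    ContMDiffAt I 𝓘(ℝ, ℝ) ∞ (fun y => (A y).adjugate i j) x := by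
  simp only [Matrix.adjugate_apply]
  refine contMDiffAt_det fun k l => ?_
  by_cases hk : k = j
  · subst hk
    simp only [Matrix.updateRow_self]
    exact contMDiffAt_const
  · simp only [Matrix.updateRow_ne hk]
    exact h k l

end SmoothMatrix

section Bilinear

variable {m : ℕ} {M : Type*} [TopologicalSpace M] [ChartedSpace (BaseModel m) M]
  {F : Type*} [NormedAddCommGroup F] [NormedSpace ℝ F]
  {V : M → Type*} [∀ x, AddCommGroup (V x)] [∀ x, Module ℝ (V x)] [∀ x, TopologicalSpace (V x)]
  [TopologicalSpace (TotalSpace F V)] [FiberBundle F V] [VectorBundle ℝ F V]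
  [∀ x, IsTopologicalAddGroup (V x)] [∀ x, ContinuousSMul ℝ (V x)]

theorem contMDiffAt_bilinear {B : ∀ x : M, V x →L[ℝ] V x →L[ℝ] ℝ}
    (hB : ContMDiff (𝓡 (m + 3)) ((𝓡 (m + 3)).prod 𝓘(ℝ, F →L[ℝ] F →L[ℝ] ℝ)) ∞
      (fun x => TotalSpace.mk' (F →L[ℝ] F →L[ℝ] ℝ) x (B x))) {s t : ∀ x, V x} {x : M}
    (hs : ContMDiffAt (𝓡 (m + 3)) ((𝓡 (m + 3)).prod 𝓘(ℝ, F)) ∞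
      (fun y => TotalSpace.mk' F y (s y)) x)
    (ht : ContMDiffAt (𝓡 (m + 3)) ((𝓡 (m + 3)).prod 𝓘(ℝ, F)) ∞
      (fun y => TotalSpace.mk' F y (t y)) x) :
    ContMDiffAt (𝓡 (m + 3)) 𝓘(ℝ, ℝ) ∞ (fun y => B y (s y) (t y)) x := by
  have : ContMDiffAt (𝓡 (m + 3)) ((𝓡 (m + 3)).prod 𝓘(ℝ)) ∞
      (fun y => TotalSpace.mk' ℝ (E := Bundle.Trivial M ℝ) y (B y (s y) (t y))) x := by
    apply ContMDiffAt.clm_bundle_apply₂ (F₁ := F) (F₂ := F)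
    · exact hB.contMDiffAt
    · exact hs
    · exact ht
  simp only [contMDiffAt_totalSpace] at this
  exact this.2

end Bilinear

/-! ### Frames of the tangent bundle -/

section Frames

variable {m : ℕ} {M : Type*} [TopologicalSpace M] [ChartedSpace (BaseModel m) M]
  [IsManifold (𝓡 (m + 3)) ∞ M]

/-- The frame of the tangent bundle given by a trivialization. -/
def frameT (x₀ x : M) (c : Fin (m + 3)) : TangentSpace (𝓡 (m + 3)) x :=
  (tangentTriv m x₀).symmL ℝ x (EuclideanSpace.single c (1 : ℝ))

/-- The frame of the tangent bundle given by a trivialization, as a basis. -/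
def tangentFrame {x₀ x : M} (hx : x ∈ (tangentTriv m x₀).baseSet) :
    Module.Basis (Fin (m + 3)) ℝ (TangentSpace (𝓡 (m + 3)) x) :=
  (EuclideanSpace.basisFun (Fin (m + 3)) ℝ).toBasis.map
    ((tangentTriv m x₀).linearEquivAt ℝ x hx).symm

theorem symmL_eq_linearEquivAt_symm {x₀ x : M} (hx : x ∈ (tangentTriv m x₀).baseSet)
    (v : BaseModel m) : (tangentTriv m x₀).symmL ℝ x v =
      ((tangentTriv m x₀).linearEquivAt ℝ x hx).symm v := by
  rw [LinearEquiv.eq_symm_apply]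
  have h := Trivialization.linearMapAt_symmₗ (R := ℝ) _ hx v
  rwa [Trivialization.linearMapAt_def_of_mem _ hx] at h

theorem coe_tangentFrame {x₀ x : M} (hx : x ∈ (tangentTriv m x₀).baseSet) :
    ⇑(tangentFrame hx) = frameT x₀ x := by
  funext c
  rw [tangentFrame, Module.Basis.map_apply, OrthonormalBasis.coe_toBasis,
    EuclideanSpace.basisFun_apply, ← symmL_eq_linearEquivAt_symm]
  rfl

/-- On vectors with constant components in the trivialization, the volume form of the moving frame
is constant. The form part of the dual form thus needs no smoothness argument. -/
theorem tangentFrame_det {x₀ x : M} (hx : x ∈ (tangentTriv m x₀).baseSet)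
    (v : Fin (m + 3) → BaseModel m) :
    (tangentFrame hx).det (fun k => (tangentTriv m x₀).symmL ℝ x (v k)) =
      (EuclideanSpace.basisFun (Fin (m + 3)) ℝ).toBasis.det v := by
  rw [tangentFrame, Module.Basis.det_map]
  congr 1
  funext k
  rw [Function.comp_apply, symmL_eq_linearEquivAt_symm hx]
  exact ((tangentTriv m x₀).linearEquivAt ℝ x hx).apply_symm_apply (v k)

theorem tangentFrame_detContr {x₀ x : M} (hx : x ∈ (tangentTriv m x₀).baseSet) (c d : Fin (m + 3))
    (v : Fin (m + 1) → BaseModel m) :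
    detContr (p := m + 1) (tangentFrame hx) c d
      (fun k => (tangentTriv m x₀).symmL ℝ x (v k)) =
      detContr (p := m + 1) (EuclideanSpace.basisFun (Fin (m + 3)) ℝ).toBasis c d v := by
  rw [detContr, detContr]
  simp only [AlternatingMap.curryLeft_apply_apply]
  rw [← tangentFrame_det hx]
  congr 1
  rw [coe_tangentFrame]
  funext k
  refine Fin.cases ?_ (fun k => ?_) k
  · simp [frameT]
  · refine Fin.cases ?_ (fun k => ?_) k
    · simp [frameT]
    · simp

theorem fieldSmoothAt_frameT {x₀ x : M} (hx : x ∈ (tangentTriv m x₀).baseSet) (c : Fin (m + 3)) :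
    FieldSmoothAt (fun y => frameT x₀ y c) x := fieldSmoothAt_symmL hx _

end Frames

/-- The contracted volume elements of a moving frame are images of those of one fixed basis, so
their smoothness follows from that of the frame. -/
theorem volContr_map {U U' : Type*} [AddCommGroup U] [Module ℝ U] [AddCommGroup U'] [Module ℝ U']
    {p : ℕ} (f : Module.Basis (Fin (p + 3)) ℝ U) (f' : Module.Basis (Fin (p + 3)) ℝ U')
    (A : Fin (p + 3)) :
    ExteriorAlgebra.map (f.constr ℝ f') (volContr f A) = volContr f' A := by
  have h1 : f'.coord A ∘ₗ f.constr ℝ f' = f.coord A := by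
    refine f.ext fun k => ?_
    simp [Finsupp.single_apply]
  have h2 : ExteriorAlgebra.map (f.constr ℝ f') (ExteriorAlgebra.ιMulti ℝ (p + 3) f) =
      ExteriorAlgebra.ιMulti ℝ (p + 3) f' := by
    rw [ExteriorAlgebra.map_apply_ιMulti]
    congr 1
    funext k
    simp
  rw [volContr, volContr, ← h2, contractRight_map, h1]

/-! ### Frames of V consisting of the image of a tangent frame and e_n -/

section AdaptedFrames

variable {m : ℕ} {M : Type*} [TopologicalSpace M] [ChartedSpace (BaseModel m) M]
  [IsManifold (𝓡 (m + 3)) ∞ M]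
  {V : M → Type*} [∀ x, AddCommGroup (V x)] [∀ x, Module ℝ (V x)] [∀ x, TopologicalSpace (V x)]
  [TopologicalSpace (TotalSpace (FibreModel m) V)] [FiberBundle (FibreModel m) V]
  [VectorBundle ℝ (FibreModel m) V]
  [∀ x, IsTopologicalAddGroup (V x)] [∀ x, ContinuousSMul ℝ (V x)]

theorem BoundaryCoframe.finrank_fibre (C : BoundaryCoframe m V) (x : M) :
    Module.finrank ℝ (V x) = m + 4 := by
  obtain ⟨b, -⟩ := C.η_lorentz x
  simpa using Module.finrank_eq_card_basis b

namespace AdaptedMetric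

variable {C : BoundaryCoframe m V} {P : NullSplitting C} (Q : AdaptedMetric P)

/-- The image of a frame of the tangent space, completed by the transversal section. -/
def adaptedFrame {x : M} (b : Fin (m + 3) → TangentSpace (𝓡 (m + 3)) x) : Fin (m + 4) → V x :=
  Fin.snoc (fun k => C.e x (b k)) (Q.en x)

theorem linearIndependent_adaptedFrame {x : M}
    (b : Module.Basis (Fin (m + 3)) ℝ (TangentSpace (𝓡 (m + 3)) x)) :
    LinearIndependent ℝ (Q.adaptedFrame b) := by
  refine LinearIndependent.finSnoc (b.linearIndependent.map' (C.e x)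
    (LinearMap.ker_eq_bot.mpr (C.e_injective x))) fun h => Q.en_transversal x ?_
  refine Submodule.span_le.mpr ?_ h
  rintro _ ⟨k, rfl⟩
  exact ⟨b k, rfl⟩

/-- The image of a basis of the tangent space, completed by the transversal section. -/
def adaptedBasis {x : M} (b : Module.Basis (Fin (m + 3)) ℝ (TangentSpace (𝓡 (m + 3)) x)) :
    Module.Basis (Fin (m + 4)) ℝ (V x) :=
  basisOfLinearIndependentOfCardEqFinrank (Q.linearIndependent_adaptedFrame b)
    (by rw [C.finrank_fibre, Fintype.card_fin])

theorem coe_adaptedBasis {x : M}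
    (b : Module.Basis (Fin (m + 3)) ℝ (TangentSpace (𝓡 (m + 3)) x)) :
    ⇑(Q.adaptedBasis b) = Q.adaptedFrame b :=
  coe_basisOfLinearIndependentOfCardEqFinrank _ _

theorem adaptedBasis_castSucc {x : M}
    (b : Module.Basis (Fin (m + 3)) ℝ (TangentSpace (𝓡 (m + 3)) x)) (c : Fin (m + 3)) :
    Q.adaptedBasis b (Fin.castSucc c) = C.e x (b c) := by
  rw [coe_adaptedBasis, adaptedFrame, Fin.snoc_castSucc]

theorem adaptedBasis_last {x : M}
    (b : Module.Basis (Fin (m + 3)) ℝ (TangentSpace (𝓡 (m + 3)) x)) :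
    Q.adaptedBasis b (Fin.last (m + 3)) = Q.en x := by
  rw [coe_adaptedBasis, adaptedFrame, Fin.snoc_last]

variable [ContMDiffVectorBundle ∞ (FibreModel m) V (𝓡 (m + 3))]

theorem sectionSmoothAt_adaptedFrame {x₀ x : M} (hx : x ∈ trivDomain (m := m) V x₀)
    (A : Fin (m + 4)) : SectionSmoothAt (m := m) (fun y => Q.adaptedFrame (frameT x₀ y) A) x := by
  refine Fin.lastCases ?_ (fun c => ?_) A
  · simpa only [adaptedFrame, Fin.snoc_last] using Q.en_smooth x
  · simp only [adaptedFrame, Fin.snoc_castSucc]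
    have h := IsSmoothField.sectionSmoothAt C.e_smooth.2 hx
      (fun _ => EuclideanSpace.single c (1 : ℝ))
    have h' : (fun y => ExteriorAlgebra.ιInv (vecForm C.e y fun _ =>
        (tangentTriv m x₀).symmL ℝ y (EuclideanSpace.single c (1 : ℝ)))) =
        fun y => C.e y (frameT x₀ y c) := by
      funext y
      exact ExteriorAlgebra.ι_leftInverse _
    rwa [h'] at h

end AdaptedMetric

/-- The components of a smooth two-form with values of degree one are smooth sections. -/
theorem sectionSmoothAt_two [ContMDiffVectorBundle ∞ (FibreModel m) V (𝓡 (m + 3))]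
    {α : FormField m V 2} (hα : IsSmoothField α) {x₀ x : M} (hx : x ∈ trivDomain (m := m) V x₀)
    (c d : Fin (m + 3)) : SectionSmoothAt (m := m)
      (fun y => ExteriorAlgebra.ιInv (α y ![frameT x₀ y c, frameT x₀ y d])) x := by
  have h := hα.sectionSmoothAt hx
    ![EuclideanSpace.single c (1 : ℝ), EuclideanSpace.single d (1 : ℝ)]
  have h' : ∀ y, (fun k => (tangentTriv m x₀).symmL ℝ y
      ((![EuclideanSpace.single c (1 : ℝ), EuclideanSpace.single d (1 : ℝ)] :
        Fin 2 → BaseModel m) k)) = ![frameT x₀ y c, frameT x₀ y d] := by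
    intro y; funext k; fin_cases k <;> rfl
  simp only [h'] at h
  exact h

end AdaptedFrames

theorem gram_det_ne_zero {T : Type*} [AddCommGroup T] [Module ℝ T] {n : ℕ}
    (b : Module.Basis (Fin n) ℝ T) (h : T →ₗ[ℝ] T →ₗ[ℝ] ℝ) (hp : ∀ t, t ≠ 0 → ∃ s, h s t ≠ 0) :
    (gram b h).det ≠ 0 := by
  intro h0
  obtain ⟨v, hv, hv0⟩ := Matrix.exists_mulVec_eq_zero_iff.mpr h0
  have h1 : ∀ a, h (b a) (∑ c, v c • b c) = 0 := fun a => by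
    have := congrFun hv0 a
    simpa [Matrix.mulVec, dotProduct, gram, mul_comm] using this
  obtain ⟨s, hs⟩ := hp (∑ c, v c • b c) fun h2 => hv <| funext fun c =>
    Fintype.linearIndependent_iff.mp b.linearIndependent v h2 c
  refine hs ?_
  have h2 : h.flip (∑ c, v c • b c) = 0 := b.ext h1
  exact LinearMap.congr_fun h2 s

/-! ### Extension of test elements, vanishing of β on H, symmetries of the coefficients -/

section

variable {m : ℕ} {M : Type*} [TopologicalSpace M] [ChartedSpace (BaseModel m) M]
  [IsManifold (𝓡 (m + 3)) ∞ M]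
  {V : M → Type*} [∀ x, AddCommGroup (V x)] [∀ x, Module ℝ (V x)] [∀ x, TopologicalSpace (V x)]
  [TopologicalSpace (TotalSpace (FibreModel m) V)] [FiberBundle (FibreModel m) V]
  [VectorBundle ℝ (FibreModel m) V]
  [∀ x, IsTopologicalAddGroup (V x)] [∀ x, ContinuousSMul ℝ (V x)]
  [ContMDiffVectorBundle ∞ (FibreModel m) V (𝓡 (m + 3))]

/-- The standard basis of the tangent spaces. -/
def stdFrame (x : M) : Module.Basis (Fin (m + 3)) ℝ (TangentSpace (𝓡 (m + 3)) x) :=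
  (EuclideanSpace.basisFun (Fin (m + 3)) ℝ).toBasis

theorem exists_bump [T2Space M] (x₀ : M) : ∃ χ : M → ℝ,
    ContMDiff (𝓡 (m + 3)) 𝓘(ℝ, ℝ) ∞ χ ∧ HasCompactSupport χ ∧
    tsupport χ ⊆ trivDomain (m := m) V x₀ ∧ χ x₀ = 1 ∧ ∀ x, 0 ≤ χ x := by
  obtain ⟨χ, -, hχ⟩ := (SmoothBumpFunction.nhds_basis_tsupport (I := 𝓡 (m + 3)) x₀).mem_iff.mp
    ((isOpen_trivDomain (m := m) (V := V) x₀).mem_nhds (mem_trivDomain x₀))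
  exact ⟨χ, χ.contMDiff, χ.hasCompactSupport, hχ, χ.eq_one, fun _ => χ.nonneg⟩

namespace BoundaryCoframe

variable (C : BoundaryCoframe m V)

theorem sectionSmoothAt_e {x₀ x : M} (hx : x ∈ trivDomain (m := m) V x₀) (s : BaseModel m) :
    SectionSmoothAt (m := m) (fun y => C.e y ((tangentTriv m x₀).symmL ℝ y s)) x := by
  have h := IsSmoothField.sectionSmoothAt C.e_smooth.2 hx (fun _ => s)
  have h' : (fun y => ExteriorAlgebra.ιInv (vecForm C.e y fun _ =>
      (tangentTriv m x₀).symmL ℝ y s)) = fun y => C.e y ((tangentTriv m x₀).symmL ℝ y s) := by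
    funext y
    exact ExteriorAlgebra.ι_leftInverse _
  rwa [h'] at h

theorem extSmoothAt_e {x₀ x : M} (hx : x ∈ trivDomain (m := m) V x₀) (s : BaseModel m) :
    ExtSmoothAt (𝓡 (m + 3)) (fun y => ExteriorAlgebra.ι ℝ
      ((trivializationAt (FibreModel m) V x₀).linearMapAt ℝ y
        (C.e y ((tangentTriv m x₀).symmL ℝ y s)))) x :=
  .ι_comp ((sectionSmoothAt_iff _ hx.2).mp (C.sectionSmoothAt_e hx s))

/-- The pointwise trace-free elements extend to elements of the kernel of `W_{N-3}`. -/
theorem exists_mem_kerW [T2Space M] (x : M) (φ : Module.Dual ℝ (TangentSpace (𝓡 (m + 3)) x))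
    (s t : TangentSpace (𝓡 (m + 3)) x) :
    ∃ v ∈ C.kerW 1 2 (m + 1), v x = oneForm (traceFree (m + 3) (C.e x) φ s t) := by
  obtain ⟨χ, hχ, -, hχU, hχ1, -⟩ := exists_bump (m := m) (V := V) x
  have hxU := mem_trivDomain (m := m) (V := V) x
  set tr := tangentTriv m x
  -- The definitions of 𝒥 and of β test against globally defined smooth fields. The data at x are
  -- therefore frozen in the trivialization and cut off by χ; trace-freeness holds at every point,
  -- so the extension stays in the kernel.
  set s₀ := tr.linearMapAt ℝ x s with hs₀
  set t₀ := tr.linearMapAt ℝ x t with ht₀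
  set φ₀ : Module.Dual ℝ (BaseModel m) := φ ∘ₗ (tr.symmL ℝ x).toLinearMap with hφ₀
  have hinv : ∀ u, tr.symmL ℝ x (tr.linearMapAt ℝ x u) = u := fun u =>
    Trivialization.symmₗ_linearMapAt (R := ℝ) _ hxU.1 u
  set w : FormField m V 1 := fun y => oneForm (traceFree (m + 3) (C.e y)
    (φ₀ ∘ₗ tr.linearMapAt ℝ y) (tr.symmL ℝ y s₀) (tr.symmL ℝ y t₀)) with hw
  have hval : ∀ (y : M) (r : Fin 1 → _), (χ y • w y) r ∈ ⋀[ℝ]^2 (V y) := fun y r =>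
    Submodule.smul_mem _ _ (traceFree_mem (C.e y) (m + 3) _ _ _ (r 0))
  refine ⟨fun y => χ y • w y, C.mem_kerW_of_symb ⟨hval, ?_⟩ stdFrame fun y => ?_, ?_⟩
  · refine isSmoothField_of_support (isClosed_tsupport χ) hχU (fun y hy => ?_) fun u y hy => ?_
    · rw [image_eq_zero_of_notMem_tsupport hy, zero_smul]
    · have hcoef : ContMDiffAt (𝓡 (m + 3)) 𝓘(ℝ, ℝ) ∞
          (fun z => φ₀ (tr.linearMapAt ℝ z (tr.symmL ℝ z (u 0)))) y :=
        contMDiffAt_linear_comp ((fieldSmoothAt_iff _ hy.1).mp (fieldSmoothAt_symmL hy.1 (u 0))) φ₀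
      have hcs : ∀ r : BaseModel m, ContMDiffAt (𝓡 (m + 3)) 𝓘(ℝ, ℝ) ∞
          (fun z => φ₀ (tr.linearMapAt ℝ z (tr.symmL ℝ z r))) y := fun r =>
        contMDiffAt_linear_comp ((fieldSmoothAt_iff _ hy.1).mp (fieldSmoothAt_symmL hy.1 r)) φ₀
      have E := C.extSmoothAt_e hy
      have key := ExtSmoothAt.smul (hχ y) (((E s₀).mul (E t₀)).smul (hcs (u 0)) |>.sub
        ((((E (u 0)).mul (E t₀)).smul (hcs s₀) |>.sub (((E (u 0)).mul (E s₀)).smul (hcs t₀))).smul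
          (contMDiffAt_const (c := (((m + 3 : ℕ) : ℝ) - 1)⁻¹))))
      refine key.congr_of_eventuallyEq (Filter.Eventually.of_forall fun z => ?_)
      change ExteriorAlgebra.map _ (χ z • traceFree (m + 3) (C.e z) _ _ _ _) = _
      rw [traceFree_apply]
      simp only [map_smul, map_sub, map_mul, ExteriorAlgebra.map_apply_ι]
      rfl
  · rw [map_smul, smul_mul_assoc, hw, symb_traceFree_mul (stdFrame y) (C.e y) (by omega), smul_zero]
  · change χ x • w x = _
    rw [hχ1, one_smul, hw]
    simp only [hs₀, ht₀, hinv]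
    congr 2
    refine LinearMap.ext fun u => ?_
    exact congrArg φ (hinv u)

end BoundaryCoframe

namespace AdaptedMetric

variable {C : BoundaryCoframe m V} {P : NullSplitting C} (Q : AdaptedMetric P)

/-- The metric of the base as a bilinear form. -/
def baseLin (x : M) :
    TangentSpace (𝓡 (m + 3)) x →ₗ[ℝ] TangentSpace (𝓡 (m + 3)) x →ₗ[ℝ] ℝ :=
  ContinuousLinearMap.coeLM ℝ ∘ₗ (Q.base.inner x).toLinearMap

/-- The metric of the fibres as a bilinear form. -/
def fibreLin (x : M) : V x →ₗ[ℝ] V x →ₗ[ℝ] ℝ :=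
  ContinuousLinearMap.coeLM ℝ ∘ₗ (Q.fibre.inner x).toLinearMap

theorem baseLin_symm (x : M) (s t) : Q.baseLin x s t = Q.baseLin x t s := Q.base.symm x s t

theorem fibreLin_symm (x : M) (s t) : Q.fibreLin x s t = Q.fibreLin x t s := Q.fibre.symm x s t

theorem baseLin_pos (x : M) {t} (ht : t ≠ 0) : 0 < Q.baseLin x t t := Q.base.pos x t ht

theorem inner_eq (α α' : FormField m V 2) (x : M)
    (b : Module.Basis (Fin (m + 3)) ℝ (TangentSpace (𝓡 (m + 3)) x)) : Q.inner α α' x =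
      twoFormInner b (fun u w => Q.baseLin x u w) (Q.fibreLin x) (α x) (α' x) :=
  twoFormInner_basis_change b (Q.baseLin x) (Q.fibreLin x) (stdFrame x) (α x) (α' x)

theorem inner_comm (α α' : FormField m V 2) (x : M) : Q.inner α α' x = Q.inner α' α x := by
  rw [Q.inner_eq α α' x (stdFrame x), Q.inner_eq α' α x (stdFrame x)]
  exact twoFormInner_comm _ _ _ (Q.baseLin_symm x) (Q.fibreLin_symm x) _ _

theorem gram_det_ne_zero {x : M} (b : Module.Basis (Fin (m + 3)) ℝ (TangentSpace (𝓡 (m + 3)) x)) :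
    (gram b (Q.baseLin x)).det ≠ 0 :=
  PalatiniCartan.gram_det_ne_zero b _ fun t ht => ⟨t, (Q.baseLin_pos x ht).ne'⟩

theorem inner_eq_zero_iff {α α' : FormField m V 2} {x : M}
    (b : Module.Basis (Fin (m + 3)) ℝ (TangentSpace (𝓡 (m + 3)) x)) : Q.inner α α' x = 0 ↔
      scaledInner b (Q.baseLin x) (Q.fibreLin x) (α x) (α' x) = 0 := by
  rw [Q.inner_eq _ _ _ b, twoFormInner_eq_scaledInner]
  have := Q.gram_det_ne_zero b
  simp [this]

/-- A basis of a tangent space that begins with the null vector and is completed in `H`. -/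
theorem _root_.PalatiniCartan.NullSplitting.exists_adapted_basis (P : NullSplitting C) (x : M) :
    ∃ b : Module.Basis (Fin (m + 3)) ℝ (TangentSpace (𝓡 (m + 3)) x), b 0 = P.X x ∧
      ∀ k, k ≠ 0 → b k ∈ P.H x := by
  have : FiniteDimensional ℝ (TangentSpace (𝓡 (m + 3)) x) :=
    (stdFrame x).finiteDimensional_of_finite
  have hc := P.H_isCompl x
  have h1 := Submodule.finrank_add_eq_of_isCompl hc
  rw [finrank_span_singleton (P.X_ne_zero x), Module.finrank_eq_card_basis (stdFrame x),
    Fintype.card_fin] at h1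
  let bH := Module.finBasisOfFinrankEq ℝ (P.H x) (n := m + 2) (by omega)
  refine ⟨Module.Basis.mkFinCons (P.X x) bH (fun c u hu h0 => ?_) fun z => ?_, ?_, ?_⟩
  · have h2 : c • P.X x ∈ P.H x := by
      rw [eq_neg_of_add_eq_zero_left h0]; exact neg_mem hu
    have h3 := Submodule.disjoint_def.mp hc.disjoint (c • P.X x)
      (Submodule.smul_mem _ _ (Submodule.mem_span_singleton_self _)) h2
    exact (smul_eq_zero.mp h3).resolve_right (P.X_ne_zero x)
  · obtain ⟨y, hy, w, hw, rfl⟩ := Submodule.mem_sup.mp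
      (hc.sup_eq_top ▸ Submodule.mem_top : z ∈ _)
    obtain ⟨c, rfl⟩ := Submodule.mem_span_singleton.mp hy
    refine ⟨-c, ?_⟩
    have : c • P.X x + w + -c • P.X x = w := by rw [neg_smul]; abel
    rwa [this]
  · simp
  · intro k hk
    obtain ⟨j, rfl⟩ := Fin.exists_succ_eq.mpr hk
    simp

/-- In a basis consisting of X and vectors of H, vanishing on H means that multiplication by the
covector dual to X kills the symbol. Testing the normalization on extended trace-free elements then
gives β = 0 on the basis vectors in H. -/
theorem beta_eq_zero [T2Space M] (Q : AdaptedMetric P) (x : M) {u : TangentSpace (𝓡 (m + 3)) x} (hu : u ∈ P.H x) :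
    P.β x u = 0 := by
  obtain ⟨b, hb0, hb⟩ := P.exists_adapted_basis x
  have hβ : ∀ j, j ≠ 0 → P.β x (b j) = 0 := by
    refine eq_zero_of_covec_mul_eq_zero b (C.e x) (p := m) rfl (Q.adaptedBasis b)
      (Q.adaptedBasis_castSucc b) 0 (P.β x) fun φ s t => ?_
    obtain ⟨v, hv, hvx⟩ := C.exists_mem_kerW x φ s t
    have h1 := covec_mul_symb_eq_zero_of_vanish b (wedge (1 + m) (1 + m) 1
      (wedgePow C.e 1 1 m (vecForm fun y => C.e y - (P.β y).smulRight (C.e y (P.X y)))) v x) 0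
      fun c hc => P.β_normalized v hv x (b ∘ c) fun k => hb _ (hc k)
    rw [symb_wedge _ b (wedgePow_mem _ m (vecForm_mem _ x)),
      symb_wedgePow _ m b (vecForm_mem _ x), hvx] at h1
    rw [hb0, ← symb_oneForm_ι]
    exact h1
  have h2 := b.sum_repr u
  rw [Fin.sum_univ_succ, hb0] at h2
  -- The X-component of u lies in H as well as in the line of X, hence is zero.
  have h3 : b.repr u 0 • P.X x ∈ P.H x := by
    rw [eq_sub_of_add_eq h2]
    exact sub_mem hu (sum_mem fun k _ => Submodule.smul_mem _ _ (hb _ (Fin.succ_ne_zero k)))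
  have h4 := Submodule.disjoint_def.mp (P.H_isCompl x).disjoint _
    (Submodule.smul_mem _ _ (Submodule.mem_span_singleton_self _)) h3
  rw [h4, zero_add] at h2
  rw [← h2, map_sum]
  exact Finset.sum_eq_zero fun k _ => by rw [map_smul, hβ _ (Fin.succ_ne_zero k), smul_zero]

/-- ẽ kills X and agrees with e on H, so its values lie in e(H), to which e_n is orthogonal. -/
theorem eta_eTilde_en [T2Space M] (x : M) (u : TangentSpace (𝓡 (m + 3)) x) :
    C.η x (P.eTilde x u) (Q.en x) = 0 := by
  obtain ⟨y, hy, w, hw, rfl⟩ := Submodule.mem_sup.mp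
    ((P.H_isCompl x).sup_eq_top ▸ Submodule.mem_top : u ∈ _)
  obtain ⟨c, rfl⟩ := Submodule.mem_span_singleton.mp hy
  have h : P.eTilde x (c • P.X x + w) = C.e x w := by
    simp [NullSplitting.eTilde, P.β_X, Q.beta_eq_zero x hw]
  rw [h, C.η_symm, Q.en_orthogonal x w hw]

/-- ẽ differs from e by multiples of e(X), which is η-orthogonal to e(TM). -/
theorem eta_eTilde_e (P : NullSplitting C) (x : M) (u w : TangentSpace (𝓡 (m + 3)) x) :
    C.η x (P.eTilde x u) (C.e x w) = C.η x (C.e x u) (C.e x w) := by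
  have h := P.X_null x w
  rw [BoundaryCoframe.g] at h
  simp [NullSplitting.eTilde, h]

/-- The coefficients of the element of `𝒮` that corresponds to an element of `𝒯`. -/
def coeffs (θ : FormField m V 2) {x : M} (b : Fin (m + 3) → TangentSpace (𝓡 (m + 3)) x) :
    Fin (m + 3) → Fin (m + 3) → Fin (m + 4) → ℝ :=
  dualTensor b (Q.adaptedFrame b) (Q.baseLin x) (Q.fibreLin x) (θ x)

variable {Q} {θ : FormField m V 2} {x : M}
  (b : Module.Basis (Fin (m + 3)) ℝ (TangentSpace (𝓡 (m + 3)) x))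

theorem coeffs_antisymm (c d : Fin (m + 3)) (A : Fin (m + 4)) :
    Q.coeffs θ b d c A = -Q.coeffs θ b c d A := by
  have := dualTensor_antisymm b (Q.adaptedBasis b) (Q.baseLin x) (Q.fibreLin x) (θ x) c d A
  rwa [coe_adaptedBasis] at this

theorem exists_of_mem_T (hθ : θ ∈ Q.T) :
    ∃ τ : Fin (m + 3) → Fin (m + 3) → TangentSpace (𝓡 (m + 3)) x,
      (∀ c d, θ x ![b c, b d] = ExteriorAlgebra.ι ℝ (C.e x (τ c d))) ∧
        ∀ d, ∑ c, b.coord c (τ c d) = 0 :=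
  two_form_of_symb_mul_eq_zero b (C.e x) (Q.adaptedBasis b) (p := m + 1) rfl (C.e_injective x)
    (Q.adaptedBasis_castSucc b) (θ x) (hθ.1.1.1 x) (C.symb_of_mem_kerW hθ.1 b)

theorem coeffs_last (hθ : θ ∈ Q.T) (c d : Fin (m + 3)) :
    Q.coeffs θ b c d (Fin.last (m + 3)) = 0 := by
  obtain ⟨τ, hτ, -⟩ := exists_of_mem_T b hθ
  have := dualTensor_last b (Q.adaptedBasis b) (Q.baseLin x) (Q.fibreLin x) (θ x) hτ
    (fun u => by
      rw [adaptedBasis_last, fibreLin_symm]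
      exact Q.fibre_en x u) c d
  rwa [coe_adaptedBasis] at this

theorem coeffs_trace (hθ : θ ∈ Q.T) (d : Fin (m + 3)) :
    ∑ c, Q.coeffs θ b c d (Fin.castSucc c) = 0 := by
  obtain ⟨τ, hτ, htr⟩ := exists_of_mem_T b hθ
  have := dualTensor_trace b (Q.adaptedBasis b) (Q.baseLin x) (Q.fibreLin x) (θ x)
    (Q.adaptedBasis_castSucc b) hτ (Q.baseLin_symm x) (fun u w => Q.fibre_e x u w) htr d
  rwa [coe_adaptedBasis] at this

theorem coeffs_symm_castSucc [T2Space M] (hθ : θ ∈ Q.T) (k s t : Fin (m + 3)) :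
    ∑ d, Q.coeffs θ b k d (Fin.castSucc s) * C.η x (C.e x (b d)) (C.e x (b t)) =
      ∑ d, Q.coeffs θ b k d (Fin.castSucc t) * C.η x (C.e x (b d)) (C.e x (b s)) := by
  obtain ⟨τ, hτ, htr⟩ := exists_of_mem_T b hθ
  have := dualTensor_symm b (Q.adaptedBasis b) (Q.baseLin x) (Q.fibreLin x) (θ x)
    (Q.adaptedBasis_castSucc b) hτ (Q.baseLin_symm x) (fun u w => Q.fibre_e x u w) htr
    (C.ηlin x) (C.η_symm x) (fun φ s t => by
      obtain ⟨v, hv, hvx⟩ := C.exists_mem_kerW x φ s t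
      have h := hθ.2.2 _ (Submodule.mem_map_of_mem hv) x
      rw [Q.inner_comm, Q.inner_eq_zero_iff b, bracket_apply, hvx] at h
      exact h) k s t
  rwa [coe_adaptedBasis] at this

theorem coeffs_symm [T2Space M] (hθ : θ ∈ Q.T) (c : Fin (m + 3)) (A B : Fin (m + 4)) :
    ∑ d, Q.coeffs θ b c d A * C.η x (P.eTilde x (b d)) (Q.adaptedBasis b B) =
      ∑ d, Q.coeffs θ b c d B * C.η x (P.eTilde x (b d)) (Q.adaptedBasis b A) := by
  -- In the mixed cases one side vanishes because K has no e_n component, the other because η(ẽ,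
  -- e_n) = 0.
  refine Fin.lastCases ?_ (fun s => ?_) A <;> refine Fin.lastCases ?_ (fun t => ?_) B
  · rfl
  · simp only [adaptedBasis_last, eta_eTilde_en, coeffs_last b hθ, zero_mul, mul_zero]
  · simp only [adaptedBasis_last, eta_eTilde_en, coeffs_last b hθ, zero_mul, mul_zero]
  · simp only [adaptedBasis_castSucc, eta_eTilde_e]
    exact coeffs_symm_castSucc b hθ c s t

end AdaptedMetric

end

/-- Collects all dependence on the point in scalar coefficients and in a linear map out of a fixed
space; smoothness of the dual form is read off from this expression. -/
theorem map_dualForm {T V V₀ U : Type*} [AddCommGroup T] [Module ℝ T] [AddCommGroup V] [Module ℝ V]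
    [AddCommGroup V₀] [Module ℝ V₀] [AddCommGroup U] [Module ℝ U] {p : ℕ}
    (b : Module.Basis (Fin (p + 2)) ℝ T) (f : Module.Basis (Fin (p + 3)) ℝ V)
    (f₀ : Module.Basis (Fin (p + 3)) ℝ V₀) {K : Fin (p + 2) → Fin (p + 2) → Fin (p + 3) → ℝ}
    (l : V →ₗ[ℝ] U) (t : Fin p → T) :
    ExteriorAlgebra.map l (dualForm b f K t) = ∑ c, ∑ d, ∑ A, (K c d A * detContr b c d t) •
      ExteriorAlgebra.map (l ∘ₗ f₀.constr ℝ f) (volContr f₀ A) := by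
  rw [dualForm]
  simp only [alternatingMap_sum_apply, AlternatingMap.smul_apply, tensorForm_apply, map_sum,
    map_smul]
  refine Finset.sum_congr rfl fun c _ => Finset.sum_congr rfl fun d _ =>
    Finset.sum_congr rfl fun A _ => ?_
  rw [smul_smul, ← ExteriorAlgebra.map_comp_map, AlgHom.comp_apply, volContr_map]

/-! ### Local elements of 𝒮 built from elements of 𝒯 -/

section

variable {m : ℕ} {M : Type*} [TopologicalSpace M] [ChartedSpace (BaseModel m) M]
  [IsManifold (𝓡 (m + 3)) ∞ M]
  {V : M → Type*} [∀ x, AddCommGroup (V x)] [∀ x, Module ℝ (V x)] [∀ x, TopologicalSpace (V x)]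
  [TopologicalSpace (TotalSpace (FibreModel m) V)] [FiberBundle (FibreModel m) V]
  [VectorBundle ℝ (FibreModel m) V]
  [∀ x, IsTopologicalAddGroup (V x)] [∀ x, ContinuousSMul ℝ (V x)]
  [ContMDiffVectorBundle ∞ (FibreModel m) V (𝓡 (m + 3))]

namespace AdaptedMetric

variable {C : BoundaryCoframe m V} {P : NullSplitting C} (Q : AdaptedMetric P)

/-- The scaled inner product in the frame of a trivialization. -/
def localInner (x₀ : M) (α θ : FormField m V 2) (x : M) : ℝ :=
  scaledInner (frameT x₀ x) (Q.baseLin x) (Q.fibreLin x) (α x) (θ x)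

open Classical in
/-- The multiple by a function `a` of the local form with values in `⋀^{N-1} V` that corresponds
to `θ`, extended by zero. -/
def localDual (x₀ : M) (θ : FormField m V 2) (a : M → ℝ) : FormField m V (m + 1) := fun x =>
  if h : x ∈ trivDomain (m := m) V x₀ then
    a x • dualForm (p := m + 1) (tangentFrame h.1) (Q.adaptedBasis (tangentFrame h.1))
      (Q.coeffs θ (frameT x₀ x))
  else 0

theorem localDual_apply {x₀ x : M} (h : x ∈ trivDomain (m := m) V x₀) (θ : FormField m V 2)
    (a : M → ℝ) : Q.localDual x₀ θ a x =
      a x • dualForm (p := m + 1) (tangentFrame h.1) (Q.adaptedBasis (tangentFrame h.1))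
        (Q.coeffs θ (frameT x₀ x)) := dif_pos h

theorem localDual_eq_zero {x₀ x : M} (θ : FormField m V 2) {a : M → ℝ} (h : a x = 0) :
    Q.localDual x₀ θ a x = 0 := by
  unfold localDual
  split_ifs
  · rw [h, zero_smul]
  · rfl

theorem localDual_eq_zero_of_notMem {x₀ x : M} (θ : FormField m V 2) {a : M → ℝ}
    (h : x ∉ trivDomain (m := m) V x₀) : Q.localDual x₀ θ a x = 0 := dif_neg h

section Smooth

variable {Q} {x₀ x : M}

theorem contMDiffAt_adjugate_gram (hx : x ∈ trivDomain (m := m) V x₀) (c d : Fin (m + 3)) :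
    ContMDiffAt (𝓡 (m + 3)) 𝓘(ℝ, ℝ) ∞
      (fun y => (gram (frameT x₀ y) (Q.baseLin y)).adjugate c d) x :=
  contMDiffAt_adjugate (fun i j => contMDiffAt_bilinear Q.base.contMDiff
    (fieldSmoothAt_frameT hx.1 i) (fieldSmoothAt_frameT hx.1 j)) c d

theorem contMDiffAt_coeffs {θ : FormField m V 2} (hθ : IsSmoothField θ)
    (hx : x ∈ trivDomain (m := m) V x₀) (c d : Fin (m + 3)) (A : Fin (m + 4)) :
    ContMDiffAt (𝓡 (m + 3)) 𝓘(ℝ, ℝ) ∞ (fun y => Q.coeffs θ (frameT x₀ y) c d A) x := by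
  simp only [coeffs, dualTensor]
  exact contMDiffAt_finsetSum fun k _ => contMDiffAt_finsetSum fun l _ =>
    ((contMDiffAt_adjugate_gram hx c k).mul (contMDiffAt_adjugate_gram hx d l)).mul
      (contMDiffAt_bilinear Q.fibre.contMDiff (Q.sectionSmoothAt_adaptedFrame hx A)
        (sectionSmoothAt_two hθ hx k l))

theorem contMDiffAt_localInner {α θ : FormField m V 2} (hα : IsSmoothField α)
    (hθ : IsSmoothField θ) (hx : x ∈ trivDomain (m := m) V x₀) :
    ContMDiffAt (𝓡 (m + 3)) 𝓘(ℝ, ℝ) ∞ (Q.localInner x₀ α θ) x := by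
  unfold localInner scaledInner
  exact contMDiffAt_finsetSum fun a _ => contMDiffAt_finsetSum fun d _ =>
    contMDiffAt_finsetSum fun c _ => contMDiffAt_finsetSum fun k _ =>
    ((contMDiffAt_adjugate_gram hx a c).mul (contMDiffAt_adjugate_gram hx d k)).mul
      (contMDiffAt_bilinear Q.fibre.contMDiff (sectionSmoothAt_two hα hx a d)
        (sectionSmoothAt_two hθ hx c k))

end Smooth

theorem localDual_mem_exteriorPower (x₀ x : M) (θ : FormField m V 2) (a : M → ℝ) (t) :
    Q.localDual x₀ θ a x t ∈ ⋀[ℝ]^(m + 3) (V x) := by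
  by_cases h : x ∈ trivDomain (m := m) V x₀
  · rw [Q.localDual_apply h, AlternatingMap.smul_apply]
    exact Submodule.smul_mem _ _ (dualForm_mem _ _ t)
  · rw [Q.localDual_eq_zero_of_notMem θ h]
    exact zero_mem _

theorem map_localDual {x₀ y : M} (hy : y ∈ trivDomain (m := m) V x₀) (θ : FormField m V 2)
    (a : M → ℝ) {U : Type*} [AddCommGroup U] [Module ℝ U] (l : V y →ₗ[ℝ] U)
    (v : Fin (m + 1) → BaseModel m) :
    ExteriorAlgebra.map l (Q.localDual x₀ θ a y fun k => (tangentTriv m x₀).symmL ℝ y (v k)) =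
      a y • ∑ c : Fin (m + 3), ∑ d : Fin (m + 3), ∑ A : Fin (m + 4),
        (Q.coeffs θ (frameT x₀ y) c d A *
          detContr (p := m + 1) (EuclideanSpace.basisFun (Fin (m + 3)) ℝ).toBasis c d v) •
        ExteriorAlgebra.map (l ∘ₗ (EuclideanSpace.basisFun (Fin (m + 4)) ℝ).toBasis.constr ℝ
          (Q.adaptedFrame (frameT x₀ y)))
          (volContr (p := m + 1) (EuclideanSpace.basisFun (Fin (m + 4)) ℝ).toBasis A) := by
  rw [Q.localDual_apply hy, AlternatingMap.smul_apply, map_smul]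
  have h := map_dualForm (p := m + 1) (tangentFrame hy.1) (Q.adaptedBasis (tangentFrame hy.1))
    (EuclideanSpace.basisFun (Fin (m + 4)) ℝ).toBasis (K := Q.coeffs θ (frameT x₀ y)) l
    (fun k => (tangentTriv m x₀).symmL ℝ y (v k))
  simp only [tangentFrame_detContr hy.1, coe_adaptedBasis, coe_tangentFrame] at h
  exact congrArg (a y • ·) h

theorem localDual_mem_Omega {x₀ : M} {θ : FormField m V 2} (hθ : IsSmoothField θ) {a : M → ℝ}
    {K : Set M} (hK : IsClosed K) (hKU : K ⊆ trivDomain (m := m) V x₀) (h0 : ∀ x ∉ K, a x = 0)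
    (ha : ∀ x ∈ trivDomain (m := m) V x₀, ContMDiffAt (𝓡 (m + 3)) 𝓘(ℝ, ℝ) ∞ a x) :
    Q.localDual x₀ θ a ∈ Omega m V (m + 1) (m + 3) := by
  refine ⟨fun x t => Q.localDual_mem_exteriorPower x₀ x θ a t, isSmoothField_of_support hK hKU
    (fun x hx => Q.localDual_eq_zero θ (h0 x hx)) fun v x hx => ?_⟩
  have hG : ∀ u : FibreModel m, ContMDiffAt (𝓡 (m + 3)) 𝓘(ℝ, FibreModel m) ∞
      (fun y => ((trivializationAt (FibreModel m) V x₀).linearMapAt ℝ y ∘ₗ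
        (EuclideanSpace.basisFun (Fin (m + 4)) ℝ).toBasis.constr ℝ
          (Q.adaptedFrame (frameT x₀ y))) u) x := by
    intro u
    simp only [LinearMap.comp_apply, Module.Basis.constr_apply_fintype, map_sum, map_smul]
    exact contMDiffAt_finsetSum fun A _ => contMDiffAt_linear_comp
      ((sectionSmoothAt_iff _ hx.2).mp (Q.sectionSmoothAt_adaptedFrame hx A))
      ((EuclideanSpace.basisFun (Fin (m + 4)) ℝ).toBasis.equivFun u A • LinearMap.id)
  refine (ExtSmoothAt.smul (ha x hx) (ExtSmoothAt.sum fun c _ => ExtSmoothAt.sum fun d _ =>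
    ExtSmoothAt.sum fun A _ => ExtSmoothAt.smul ((contMDiffAt_coeffs hθ hx c d A).mul
      contMDiffAt_const) (ExtSmoothAt.map_const hG _))).congr_of_eventuallyEq
    (Filter.eventually_of_mem ((isOpen_trivDomain x₀).mem_nhds hx) fun y hy =>
      Q.map_localDual hy θ a _ v)

/-- Both equations are linear over functions, so the factor a is harmless. The first uses that the
coefficients are trace-free, the second their symmetry `coeffs_symm`. -/
theorem localDual_mem_S [T2Space M] {x₀ : M} {θ : FormField m V 2} (hθ : θ ∈ Q.T) {a : M → ℝ}
    {K : Set M} (hK : IsClosed K) (hKU : K ⊆ trivDomain (m := m) V x₀) (h0 : ∀ x ∉ K, a x = 0)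
    (ha : ∀ x ∈ trivDomain (m := m) V x₀, ContMDiffAt (𝓡 (m + 3)) 𝓘(ℝ, ℝ) ∞ a x) :
    Q.localDual x₀ θ a ∈ P.S := by
  refine ⟨⟨Q.localDual_mem_Omega hθ.1.1.2 hK hKU h0 ha, ?_⟩, ?_⟩
  · refine LinearMap.mem_ker.mpr (funext fun x => ?_)
    change wedge (m + 1) (m + 3) 1 (Q.localDual x₀ θ a) (vecForm C.e) x = 0
    rw [wedge_apply]
    by_cases hx : x ∈ trivDomain (m := m) V x₀
    · rw [Q.localDual_apply hx, map_smul, LinearMap.smul_apply]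
      have h := dualForm_wedge_eq_zero (p := m + 1) (tangentFrame hx.1)
        (Q.adaptedBasis (tangentFrame hx.1)) (C.e x) (Q.adaptedBasis_castSucc (tangentFrame hx.1))
        (K := Q.coeffs θ (frameT x₀ x)) (by
          rw [← coe_tangentFrame hx.1]; exact coeffs_antisymm _) (by
          rw [← coe_tangentFrame hx.1]; exact coeffs_trace _ hθ)
      erw [h]
      rw [smul_zero, smul_zero]
    · rw [Q.localDual_eq_zero_of_notMem θ hx, map_zero, LinearMap.zero_apply, smul_zero]
  · refine LinearMap.mem_ker.mpr (funext fun x => ?_)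
    rw [bracket_apply]
    by_cases hx : x ∈ trivDomain (m := m) V x₀
    · rw [Q.localDual_apply hx, map_smul, LinearMap.smul_apply]
      have h := dualForm_bracket_eq_zero (p := m + 1) (tangentFrame hx.1)
        (Q.adaptedBasis (tangentFrame hx.1)) (C.ηlin x ∘ₗ P.eTilde x)
        (K := Q.coeffs θ (frameT x₀ x)) (by
          rw [← coe_tangentFrame hx.1]; exact coeffs_antisymm _) (by
          rw [← coe_tangentFrame hx.1]; exact coeffs_symm _ hθ)
      erw [h]
      rw [smul_zero]; rfl
    · rw [Q.localDual_eq_zero_of_notMem θ hx, map_zero, LinearMap.zero_apply]; rfl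

/-- This is the duality: the constructed form represents the functional α ↦ ⟨α, θ⟩, up to a nonzero
factor and multiplication by a. -/
theorem wedge_localDual {x₀ x : M} (hx : x ∈ trivDomain (m := m) V x₀) (θ : FormField m V 2)
    (a : M → ℝ) {α : FormField m V 2} (hα : ∀ t, α x t ∈ ⋀[ℝ]^1 (V x)) :
    wedge (m + 1) (m + 3) 2 (Q.localDual x₀ θ a) α x = (a x * Q.localInner x₀ α θ x) •
      tensorForm (tangentFrame hx.1).det
        (ExteriorAlgebra.ιMulti ℝ (m + 4) (Q.adaptedBasis (tangentFrame hx.1))) := by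
  rw [wedge_apply, Q.localDual_apply hx, map_smul, LinearMap.smul_apply,
    (Even.mul_left even_two (m + 3)).neg_one_pow, one_smul]
  have h := dualForm_wedge_two (p := m + 1) (tangentFrame hx.1)
    (Q.adaptedBasis (tangentFrame hx.1)) (K := Q.coeffs θ (frameT x₀ x)) (α x) hα
  have h2 := sum_dualTensor_mul (tangentFrame hx.1) (Q.adaptedBasis (tangentFrame hx.1))
    (Q.baseLin x) (Q.fibreLin x) (θ x) (α x)
  rw [coe_adaptedBasis, coe_tangentFrame] at h2
  simp only [coe_tangentFrame] at h
  rw [mul_smul, localInner, ← h2]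
  exact congrArg (a x • ·) h

end AdaptedMetric

end

/-! ### Densities, and nonnegative densities with vanishing integral -/

theorem alternatingMap_eq_det_smul {T A : Type*} [AddCommGroup T] [Module ℝ T] [AddCommGroup A]
    [Module ℝ A] {n : ℕ} (b : Module.Basis (Fin n) ℝ T) (f : T [⋀^Fin n]→ₗ[ℝ] A) (v : Fin n → T) :
    f v = b.det v • f b := by
  have h : f = tensorForm b.det (f b) := by
    refine b.ext_alternating fun c hc => ?_
    let σ := Equiv.ofBijective c (Finite.injective_iff_bijective.mp hc)
    have h1 : (fun k => b (c k)) = b ∘ σ := rfl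
    rw [h1, AlternatingMap.map_perm, tensorForm_apply, AlternatingMap.map_perm, b.det_self,
      smul_assoc, one_smul]
  exact DFunLike.congr_fun h v

theorem topCoeff_smul {U : Type*} [AddCommGroup U] [Module ℝ U] {n : ℕ} {b : Fin n → U}
    (hb : ExteriorAlgebra.ιMulti ℝ n b ≠ 0) (c : ℝ) :
    topCoeff b (c • ExteriorAlgebra.ιMulti ℝ n b) = c := by
  have h : ∃ c' : ℝ, c • ExteriorAlgebra.ιMulti ℝ n b = c' • ExteriorAlgebra.ιMulti ℝ n b := ⟨c, rfl⟩
  rw [topCoeff, dif_pos h]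
  exact (smul_left_injective ℝ hb h.choose_spec).symm

section

variable {m : ℕ} {M : Type*} [TopologicalSpace M] [ChartedSpace (BaseModel m) M]
  [IsManifold (𝓡 (m + 3)) ∞ M]
  {V : M → Type*} [∀ x, AddCommGroup (V x)] [∀ x, Module ℝ (V x)] [∀ x, TopologicalSpace (V x)]
  [TopologicalSpace (TotalSpace (FibreModel m) V)] [FiberBundle (FibreModel m) V]
  [VectorBundle ℝ (FibreModel m) V]
  [∀ x, IsTopologicalAddGroup (V x)] [∀ x, ContinuousSMul ℝ (V x)]
  [ContMDiffVectorBundle ∞ (FibreModel m) V (𝓡 (m + 3))]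

namespace BoundaryCoframe

variable (C : BoundaryCoframe m V)

theorem sectionSmoothAt_e_field {s : ∀ x : M, TangentSpace (𝓡 (m + 3)) x} {x : M}
    (hs : FieldSmoothAt s x) : SectionSmoothAt (m := m) (fun y => C.e y (s y)) x := by
  have hx := mem_trivDomain (m := m) (V := V) x
  rw [sectionSmoothAt_iff _ hx.2]
  set B := (EuclideanSpace.basisFun (Fin (m + 3)) ℝ).toBasis
  have key : ContMDiffAt (𝓡 (m + 3)) 𝓘(ℝ, FibreModel m) ∞
      (fun y => ∑ d, B.coord d ((tangentTriv m x).linearMapAt ℝ y (s y)) •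
        (trivializationAt (FibreModel m) V x).linearMapAt ℝ y
          (C.e y ((tangentTriv m x).symmL ℝ y (B d)))) x :=
    contMDiffAt_finsetSum fun d _ =>
      (contMDiffAt_linear_comp ((fieldSmoothAt_iff _ hx.1).mp hs) (B.coord d)).smul
        ((sectionSmoothAt_iff _ hx.2).mp (C.sectionSmoothAt_e hx (B d)))
  refine key.congr_of_eventuallyEq ?_
  filter_upwards [(isOpen_trivDomain x).mem_nhds hx] with y hy
  have h1 : (tangentTriv m x).symmL ℝ y ((tangentTriv m x).linearMapAt ℝ y (s y)) = s y :=
    Trivialization.symmₗ_linearMapAt (R := ℝ) _ hy.1 (s y)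
  conv_lhs => rw [← h1, ← B.sum_repr ((tangentTriv m x).linearMapAt ℝ y (s y))]
  simp only [map_sum, map_smul]
  rfl

theorem gram_eta_det_ne_zero {x : M} (f : Module.Basis (Fin (m + 4)) ℝ (V x)) :
    (gram f (C.ηlin x)).det ≠ 0 := by
  refine gram_det_ne_zero f _ fun t ht => ?_
  obtain ⟨b, hb⟩ := C.η_lorentz x
  obtain ⟨i, hi⟩ : ∃ i, b.repr t i ≠ 0 := by
    by_contra! h
    exact ht (b.ext_elem fun i => by simp [h i])
  refine ⟨b i, ?_⟩
  have h1 : C.ηlin x (b i) t = b.repr t i * C.η x (b i) (b i) := by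
    conv_lhs => rw [← b.sum_repr t, map_sum]
    rw [Finset.sum_eq_single i]
    · rw [map_smul, smul_eq_mul, ηlin_apply]
    · intro j _ hj
      rw [map_smul, ηlin_apply, hb, if_neg (Ne.symm hj), smul_zero]
    · simp
  rw [h1, hb, if_pos rfl]
  refine mul_ne_zero hi ?_
  split_ifs <;> norm_num

end BoundaryCoframe

namespace AdaptedMetric

variable {C : BoundaryCoframe m V} {P : NullSplitting C} (Q : AdaptedMetric P)

theorem ιMulti_adaptedFrame {x : M} (b : Module.Basis (Fin (m + 3)) ℝ (TangentSpace (𝓡 (m + 3)) x))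
    (v : Fin (m + 3) → TangentSpace (𝓡 (m + 3)) x) :
    ExteriorAlgebra.ιMulti ℝ (m + 4) (Q.adaptedFrame v) =
      b.det v • ExteriorAlgebra.ιMulti ℝ (m + 4) (Q.adaptedFrame b) := by
  have h : ∀ w : Fin (m + 3) → TangentSpace (𝓡 (m + 3)) x,
      ExteriorAlgebra.ιMulti ℝ (m + 4) (Q.adaptedFrame w) =
        ((LinearMap.mulRight ℝ (ExteriorAlgebra.ι ℝ (Q.en x))).compAlternatingMap
          ((ExteriorAlgebra.ιMulti ℝ (m + 3)).compLinearMap (C.e x))) w := by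
    intro w
    rw [ιMulti_succ_last (k := m + 3), adaptedFrame, Fin.init_snoc, Fin.snoc_last]
    rfl
  rw [h, h]
  exact alternatingMap_eq_det_smul b _ v

/-- The `η`-volume of the adapted frame that belongs to the chart at a point. -/
def volumeWeight (i x : M) : ℝ :=
  √|(Matrix.of fun a b => C.η x (Q.adaptedFrame (frameT i x) a) (Q.adaptedFrame (frameT i x) b)).det|

theorem density_eq (φ : FormField m V (m + 3)) (i x : M) : Q.density φ i x =
    topCoeff (Q.adaptedFrame (frameT i x)) (φ x (frameT i x)) * Q.volumeWeight i x := rfl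

theorem volumeWeight_pos {i x : M} (hx : x ∈ (tangentTriv m i).baseSet) :
    0 < Q.volumeWeight i x := by
  refine Real.sqrt_pos.mpr (abs_pos.mpr ?_)
  have := C.gram_eta_det_ne_zero (Q.adaptedBasis (tangentFrame hx))
  rwa [coe_adaptedBasis, coe_tangentFrame] at this

theorem continuousAt_volumeWeight {i x : M} (hx : x ∈ (tangentTriv m i).baseSet) :
    ContinuousAt (Q.volumeWeight i) x := by
  have hf : ∀ A, SectionSmoothAt (m := m) (fun y => Q.adaptedFrame (frameT i y) A) x := by
    intro A
    refine Fin.lastCases ?_ (fun c => ?_) A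
    · simpa only [adaptedFrame, Fin.snoc_last] using Q.en_smooth x
    · simp only [adaptedFrame, Fin.snoc_castSucc]
      exact C.sectionSmoothAt_e_field (fieldSmoothAt_frameT hx c)
  exact (Real.continuous_sqrt.comp continuous_abs).continuousAt.comp
    (contMDiffAt_det (I := 𝓡 (m + 3)) (A := fun y => Matrix.of fun a b =>
      C.η y (Q.adaptedFrame (frameT i y) a) (Q.adaptedFrame (frameT i y) b))
      fun a b => contMDiffAt_bilinear C.η_smooth (hf a) (hf b)).continuousAt

/-- Passing from b to the coordinate frame multiplies the value of φ and the product of the adapted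
frame by the same determinant. The coefficient c is therefore the same in all charts. -/
theorem density_of_eq {φ : FormField m V (m + 3)} {i x : M} (hx : x ∈ (tangentTriv m i).baseSet)
    (b : Module.Basis (Fin (m + 3)) ℝ (TangentSpace (𝓡 (m + 3)) x)) {c : ℝ}
    (h : φ x = c • tensorForm b.det (ExteriorAlgebra.ιMulti ℝ (m + 4) (Q.adaptedFrame b))) :
    Q.density φ i x = c * Q.volumeWeight i x := by
  rw [density_eq, h, AlternatingMap.smul_apply, tensorForm_apply, ← ιMulti_adaptedFrame,
    topCoeff_smul]
  have := ιMulti_basis_ne_zero (Q.adaptedBasis (tangentFrame hx))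
  rwa [coe_adaptedBasis, coe_tangentFrame] at this

variable [T2Space M] [SigmaCompactSpace M]

/-- A form with a nonnegative continuous coefficient and vanishing integral is zero. -/
theorem coefficient_eq_zero_of_integral_eq_zero {φ : FormField m V (m + 3)} {c : M → ℝ}
    (hc : Continuous c) (hc0 : ∀ x, 0 ≤ c x) (hcs : HasCompactSupport c)
    (hd : ∀ i, ∀ x ∈ (tangentTriv m i).baseSet, Q.density φ i x = c x * Q.volumeWeight i x)
    (hint : Q.integral φ = 0) (x : M) : c x = 0 := by
  set ρ := (SmoothPartitionOfUnity.exists_isSubordinate_chartAt_source (𝓡 (m + 3)) M).choose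
    with hρ
  have hsub : ρ.IsSubordinate fun x => (chartAt (BaseModel m) x).source :=
    (SmoothPartitionOfUnity.exists_isSubordinate_chartAt_source (𝓡 (m + 3)) M).choose_spec
  set G : M → M → ℝ := fun i y => ρ i y * (c y * Q.volumeWeight i y) with hG
  have hbase : ∀ i : M, (tangentTriv m i).baseSet = (chartAt (BaseModel m) i).source := fun i =>
    TangentBundle.trivializationAt_baseSet i
  have hGc : ∀ i, ∀ y ∈ (chartAt (BaseModel m) i).source, ContinuousAt (G i) y := fun i y hy =>
    (ρ i).2.continuous.continuousAt.mul
      (hc.continuousAt.mul (Q.continuousAt_volumeWeight (by rwa [hbase])))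
  have hG0 : ∀ i y, 0 ≤ G i y := fun i y =>
    mul_nonneg (ρ.nonneg i y) (mul_nonneg (hc0 y) (Real.sqrt_nonneg _))
  have hcont : ∀ i, ContinuousOn (fun z => G i ((chartAt (BaseModel m) i).symm z))
      (chartAt (BaseModel m) i).target := fun i z hz =>
    ((hGc i _ ((chartAt (BaseModel m) i).map_target hz)).comp
      ((chartAt (BaseModel m) i).continuousAt_symm hz)).continuousWithinAt
  have hintble : ∀ i, IntegrableOn (fun z => G i ((chartAt (BaseModel m) i).symm z))
      (chartAt (BaseModel m) i).target := by
    intro i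
    -- The chart target need not be bounded; integrability comes from a compact subset outside which
    -- the integrand vanishes.
    set K := chartAt (BaseModel m) i '' (tsupport (ρ i) ∩ tsupport c) with hK
    have hKc : IsCompact K := (hcs.isCompact.inter_left (isClosed_tsupport _)).image_of_continuousOn
      ((chartAt (BaseModel m) i).continuousOn.mono fun y hy => hsub i hy.1)
    have hKt : K ⊆ (chartAt (BaseModel m) i).target := by
      rintro _ ⟨y, hy, rfl⟩
      exact (chartAt (BaseModel m) i).map_source (hsub i hy.1)
    refine (((hcont i).mono hKt).integrableOn_compact hKc).of_forall_sdiff_eq_zero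
      (chartAt (BaseModel m) i).open_target.measurableSet fun z hz => ?_
    by_contra hne
    refine hz.2 ⟨(chartAt (BaseModel m) i).symm z, ⟨?_, ?_⟩,
      (chartAt (BaseModel m) i).right_inv hz.1⟩
    · exact subset_tsupport _ (left_ne_zero_of_mul hne)
    · exact subset_tsupport _ (left_ne_zero_of_mul (right_ne_zero_of_mul hne))
  set J : M → ℝ := fun i => ∫ z in (chartAt (BaseModel m) i).target,
    G i ((chartAt (BaseModel m) i).symm z) with hJ
  have hJ0 : ∀ i, 0 ≤ J i := fun i => integral_nonneg fun z => hG0 i _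
  have hsum : ∑ᶠ i, J i = 0 := by
    rw [← hint, integral]
    refine finsum_congr fun i => setIntegral_congr_fun
      (chartAt (BaseModel m) i).open_target.measurableSet fun z hz => ?_
    have := hd i ((chartAt (BaseModel m) i).symm z)
      (by rw [hbase]; exact (chartAt (BaseModel m) i).map_target hz)
    simp only [hG, this]
    rfl
  -- A `finsum` with infinite support is zero by default, so its vanishing says nothing before
  -- finiteness is known. Local finiteness of the partition of unity on the compact support of c
  -- provides it.
  have hfin : (Function.support J).Finite := by
    refine (ρ.locallyFinite.finite_nonempty_inter_compact hcs.isCompact).subset fun i hi => ?_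
    by_contra hne
    refine hi (setIntegral_eq_zero_of_forall_eq_zero fun z _ => ?_)
    by_contra hz
    exact hne ⟨_, left_ne_zero_of_mul hz,
      subset_tsupport _ (left_ne_zero_of_mul (right_ne_zero_of_mul hz))⟩
  have hJz : ∀ i, J i = 0 := by
    intro i
    by_contra hi
    rw [finsum_eq_sum J hfin, Finset.sum_eq_zero_iff_of_nonneg fun i _ => hJ0 i] at hsum
    exact hi (hsum i (hfin.mem_toFinset.mpr hi))
  obtain ⟨i, hi⟩ := ρ.exists_pos_of_mem (mem_univ x)
  have hxs : x ∈ (chartAt (BaseModel m) i).source := hsub i (subset_tsupport _ hi.ne')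
  -- The integrand vanishes almost everywhere, hence everywhere on the open target by continuity. At
  -- x the factors other than c are positive.
  have hae := (setIntegral_eq_zero_iff_of_nonneg_ae (Filter.Eventually.of_forall fun z => hG0 i _)
    (hintble i)).mp (hJz i)
  have heq := Measure.eqOn_open_of_ae_eq hae (chartAt (BaseModel m) i).open_target (hcont i)
    continuousOn_const
  have hx := heq ((chartAt (BaseModel m) i).map_source hxs)
  simp only [(chartAt (BaseModel m) i).left_inv hxs, Pi.zero_apply] at hx
  have h2 := (mul_eq_zero.mp hx).resolve_left hi.ne'
  exact (mul_eq_zero.mp h2).resolve_right (Q.volumeWeight_pos (by rwa [hbase])).ne'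

end AdaptedMetric

end

/-! ### Positive definiteness of the inner product of two-forms -/

theorem exists_orthogonal_basis {T : Type*} [AddCommGroup T] [Module ℝ T] {n : ℕ}
    (b : Module.Basis (Fin n) ℝ T) (h : T →ₗ[ℝ] T →ₗ[ℝ] ℝ) (hs : ∀ s t, h s t = h t s) :
    ∃ b' : Module.Basis (Fin n) ℝ T, ∀ i j, i ≠ j → h (b' i) (b' j) = 0 := by
  have : FiniteDimensional ℝ T := b.finiteDimensional_of_finite
  have : Invertible (2 : ℝ) := invertibleOfNonzero two_ne_zero
  obtain ⟨v, hv⟩ := LinearMap.BilinForm.exists_orthogonal_basis (B := h) ⟨fun s t => hs s t⟩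
  have hn : Module.finrank ℝ T = n := by simpa using Module.finrank_eq_card_basis b
  refine ⟨v.reindex (finCongr hn), fun i j hij => ?_⟩
  simp only [Module.Basis.reindex_apply]
  exact hv fun h => hij ((finCongr hn).symm.injective h)

theorem eq_zero_of_twoFormInner_self {T U : Type*} [AddCommGroup T] [Module ℝ T] [AddCommGroup U]
    [Module ℝ U] {n : ℕ} (b : Module.Basis (Fin n) ℝ T) (h : T →ₗ[ℝ] T →ₗ[ℝ] ℝ)
    (hs : ∀ s t, h s t = h t s) (hp : ∀ t, t ≠ 0 → 0 < h t t) (q : U →ₗ[ℝ] U →ₗ[ℝ] ℝ)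
    (hq : ∀ u, u ≠ 0 → 0 < q u u) (α : T [⋀^Fin 2]→ₗ[ℝ] ExteriorAlgebra ℝ U)
    (hα : ∀ t, α t ∈ ⋀[ℝ]^1 U) (h0 : twoFormInner b (fun u w => h u w) q α α = 0) : α = 0 := by
  -- An orthogonal basis makes the Gram matrix diagonal, so the inner product becomes a sum of
  -- nonnegative terms.
  obtain ⟨b', hb'⟩ := exists_orthogonal_basis b h hs
  rw [← twoFormInner_basis_change b h q b'] at h0
  set d : Fin n → ℝ := fun a => h (b' a) (b' a) with hd
  have hd0 : ∀ a, 0 < d a := fun a => hp _ (b'.ne_zero a)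
  have hG : (Matrix.of fun a c => h (b' a) (b' c)) = Matrix.diagonal d := by
    ext i j
    by_cases hij : i = j
    · subst hij; simp [hd]
    · simp [Matrix.diagonal_apply_ne _ hij, hb' i j hij]
  have hGi : (Matrix.of fun a c => h (b' a) (b' c))⁻¹ = Matrix.diagonal fun a => (d a)⁻¹ := by
    rw [hG]
    refine Matrix.inv_eq_right_inv ?_
    rw [Matrix.diagonal_mul_diagonal, ← Matrix.diagonal_one]
    congr 1
    funext a
    exact mul_inv_cancel₀ (hd0 a).ne'
  have hq0 : ∀ u, 0 ≤ q u u := fun u => by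
    by_cases hu : u = 0
    · simp [hu]
    · exact (hq u hu).le
  have h1 : ∑ a, ∑ c, (d a)⁻¹ * (d c)⁻¹ * q (ExteriorAlgebra.ιInv (α ![b' a, b' c]))
      (ExteriorAlgebra.ιInv (α ![b' a, b' c])) = 0 := by
    simp only [twoFormInner] at h0
    rw [hGi] at h0
    simp only [Matrix.diagonal_apply, ite_mul, zero_mul, mul_ite, mul_zero, Finset.sum_ite_eq,
      Finset.mem_univ, if_true] at h0
    simpa using h0
  have hnn : ∀ a c, 0 ≤ (d a)⁻¹ * (d c)⁻¹ * q (ExteriorAlgebra.ιInv (α ![b' a, b' c]))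
      (ExteriorAlgebra.ιInv (α ![b' a, b' c])) := fun a c =>
    mul_nonneg (mul_nonneg (inv_nonneg.mpr (hd0 a).le) (inv_nonneg.mpr (hd0 c).le)) (hq0 _)
  rw [Finset.sum_eq_zero_iff_of_nonneg fun a _ => Finset.sum_nonneg fun c _ => hnn a c] at h1
  refine b'.ext_alternating fun v _ => ?_
  have h2 := (Finset.sum_eq_zero_iff_of_nonneg fun c _ => hnn (v 0) c).mp
    (h1 (v 0) (Finset.mem_univ _)) (v 1) (Finset.mem_univ _)
  have h3 : ExteriorAlgebra.ιInv (α ![b' (v 0), b' (v 1)]) = 0 := by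
    by_contra hne
    exact (mul_pos (mul_pos (inv_pos.mpr (hd0 _)) (inv_pos.mpr (hd0 _))) (hq _ hne)).ne' h2
  have h4 : (fun i => b' (v i)) = ![b' (v 0), b' (v 1)] := by
    funext i; fin_cases i <;> rfl
  rw [h4]
  have h5 : α ![b' (v 0), b' (v 1)] ∈
      LinearMap.range (ExteriorAlgebra.ι ℝ : U →ₗ[ℝ] _) ^ 1 := hα _
  rw [pow_one] at h5
  obtain ⟨u, hu⟩ := h5
  rw [← hu] at h3 ⊢
  rw [show ExteriorAlgebra.ιInv (ExteriorAlgebra.ι ℝ u) = u from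
    ExteriorAlgebra.ι_leftInverse u] at h3
  rw [h3, map_zero]; rfl

/-! ### Orthogonality of α to 𝒯 -/

section

variable {m : ℕ} {M : Type*} [TopologicalSpace M] [ChartedSpace (BaseModel m) M]
  [IsManifold (𝓡 (m + 3)) ∞ M]
  {V : M → Type*} [∀ x, AddCommGroup (V x)] [∀ x, Module ℝ (V x)] [∀ x, TopologicalSpace (V x)]
  [TopologicalSpace (TotalSpace (FibreModel m) V)] [FiberBundle (FibreModel m) V]
  [VectorBundle ℝ (FibreModel m) V]
  [∀ x, IsTopologicalAddGroup (V x)] [∀ x, ContinuousSMul ℝ (V x)]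
  [ContMDiffVectorBundle ∞ (FibreModel m) V (𝓡 (m + 3))]
  [T2Space M] [SigmaCompactSpace M]

namespace AdaptedMetric

variable {C : BoundaryCoframe m V} {P : NullSplitting C} {Q : AdaptedMetric P}

theorem inner_eq_zero_of_integral {α θ : FormField m V 2} (hα : α ∈ Omega m V 2 1)
    (hθ : θ ∈ Q.T)
    (h : ∀ τ ∈ P.S, CompactlySupported τ → Q.integral (wedge (m + 1) (m + 3) 2 τ α) = 0)
    (x₀ : M) : Q.inner α θ x₀ = 0 := by
  obtain ⟨χ, hχ, hχc, hχU, hχ1, hχ0⟩ := exists_bump (m := m) (V := V) x₀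
  set L := Q.localInner x₀ α θ with hL
  have hLs : ∀ x ∈ trivDomain (m := m) V x₀, ContMDiffAt (𝓡 (m + 3)) 𝓘(ℝ, ℝ) ∞ L x :=
    fun x hx => contMDiffAt_localInner hα.2 hθ.1.1.2 hx
  have hz : ∀ x ∉ tsupport χ, χ x = 0 := fun x hx => image_eq_zero_of_notMem_tsupport hx
  -- Including the inner product L in the factor makes the coefficient of τ ∧ α equal to χ L², which
  -- is nonnegative.
  set a : M → ℝ := fun x => χ x * L x with ha
  have hτ : Q.localDual x₀ θ a ∈ P.S := Q.localDual_mem_S hθ (isClosed_tsupport χ) hχU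
    (fun x hx => by rw [ha]; simp [hz x hx]) fun x hx => (hχ x).mul (hLs x hx)
  have hτc : CompactlySupported (Q.localDual x₀ θ a) := by
    refine hχc.isCompact.of_isClosed_subset isClosed_closure
      (closure_minimal (fun x hx => ?_) (isClosed_tsupport χ))
    by_contra hne
    exact hx (Q.localDual_eq_zero θ (by rw [ha]; simp [hz x hne]))
  have hzero := Q.coefficient_eq_zero_of_integral_eq_zero (c := fun x => χ x * L x ^ 2) ?_
    (fun x => mul_nonneg (hχ0 x) (sq_nonneg _)) hχc.mul_right (fun i x hx => ?_) (h _ hτ hτc) x₀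
  · have hL0 : L x₀ = 0 := by simpa [hχ1] using hzero
    have hx₀ := (mem_trivDomain (m := m) (V := V) x₀).1
    rw [Q.inner_eq_zero_iff (tangentFrame hx₀), coe_tangentFrame]
    exact hL0
  · refine continuous_iff_continuousAt.mpr fun x => ?_
    by_cases hx : x ∈ tsupport χ
    · exact hχ.continuous.continuousAt.mul ((hLs x (hχU hx)).continuousAt.pow 2)
    · refine (continuousAt_const (y := (0 : ℝ))).congr ?_
      filter_upwards [(isClosed_tsupport χ).isOpen_compl.mem_nhds hx] with y hy
      rw [hz y hy, zero_mul]
  · by_cases hxU : x ∈ trivDomain (m := m) V x₀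
    · refine Q.density_of_eq hx (tangentFrame hxU.1) ?_
      rw [Q.wedge_localDual hxU θ a (hα.1 x), ← hL, coe_adaptedBasis]
      congr 1
      rw [ha]; ring
    -- Outside the trivialization domain both the form and χ vanish, and any basis will do.
    · refine Q.density_of_eq hx (stdFrame x) ?_
      rw [hz x fun hx' => hxU (hχU hx'), zero_mul, zero_smul, wedge_apply,
        Q.localDual_eq_zero_of_notMem θ hxU, map_zero, LinearMap.zero_apply, smul_zero]

theorem eq_zero_of_inner_self {θ : FormField m V 2} (hθ : θ ∈ Omega m V 2 1)
    (h : ∀ x, Q.inner θ θ x = 0) : θ = 0 := by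
  funext x
  refine eq_zero_of_twoFormInner_self (stdFrame x) (Q.baseLin x) (Q.baseLin_symm x)
    (fun t ht => Q.baseLin_pos x ht) (Q.fibreLin x) (fun u hu => Q.fibre.pos x u hu) (θ x)
    (hθ.1 x) ?_
  rw [← Q.inner_eq]
  exact h x

theorem inner_sub (α θ θ' : FormField m V 2) (x : M) :
    Q.inner (α - θ) θ' x = Q.inner α θ' x - Q.inner θ θ' x := by
  have h1 : Q.inner (α - θ + θ) θ' x = Q.inner (α - θ) θ' x + Q.inner θ θ' x :=
    twoFormInner_add _ _ _ _ _ _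
  rw [sub_add_cancel] at h1
  linarith

end AdaptedMetric

end

end PalatiniCartan
end

open PalatiniCartan in
theorem mainTheorem6 (m : ℕ) {M : Type*} [TopologicalSpace M] [T2Space M] [SigmaCompactSpace M]
    [ChartedSpace (BaseModel m) M] [IsManifold (𝓡 (m + 3)) ∞ M]
    (V : M → Type*) [∀ x, AddCommGroup (V x)] [∀ x, Module ℝ (V x)]
    [∀ x, TopologicalSpace (V x)] [∀ x, IsTopologicalAddGroup (V x)]
    [∀ x, ContinuousSMul ℝ (V x)]
    [TopologicalSpace (TotalSpace (FibreModel m) V)] [FiberBundle (FibreModel m) V]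
    [VectorBundle ℝ (FibreModel m) V] [ContMDiffVectorBundle ∞ (FibreModel m) V (𝓡 (m + 3))]
    (C : BoundaryCoframe m V) (P : NullSplitting C) (Q : AdaptedMetric P) :
    (∀ α ∈ Omega m V 2 1,
      (∀ τ ∈ P.S, CompactlySupported τ → Q.integral (wedge (m + 1) (m + 3) 2 τ α) = 0) →
      ∀ θ, Q.IsProjT α θ ↔ θ = 0) ∧
    (∀ θ ∈ Q.T,
      (∀ τ ∈ P.S, CompactlySupported τ → Q.integral (wedge (m + 1) (m + 3) 2 τ θ) = 0) →
      θ = 0) := by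
  -- A projection θ of α can serve as its own test element: ⟨α - θ, θ⟩ = 0 and ⟨α, θ⟩ = 0 give ⟨θ,
  -- θ⟩ = 0.
  have key : ∀ α ∈ Omega m V 2 1,
      (∀ τ ∈ P.S, CompactlySupported τ → Q.integral (wedge (m + 1) (m + 3) 2 τ α) = 0) →
      ∀ θ ∈ Q.T, (∀ x, Q.inner (α - θ) θ x = 0) → θ = 0 := fun α hα h θ hθ h0 =>
    AdaptedMetric.eq_zero_of_inner_self hθ.1.1 fun x => by
      have h1 := h0 x
      rw [AdaptedMetric.inner_sub, AdaptedMetric.inner_eq_zero_of_integral hα hθ h x] at h1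
      linarith
  refine ⟨fun α hα h θ => ⟨fun hp => key α hα h θ hp.1 (hp.2 θ hp.1), ?_⟩, fun θ hθ h =>
    AdaptedMetric.eq_zero_of_inner_self hθ.1.1
      (AdaptedMetric.inner_eq_zero_of_integral hθ.1.1 hθ h)⟩
  rintro rfl
  refine ⟨zero_mem _, fun θ' hθ' x => ?_⟩
  rw [sub_zero]
  exact AdaptedMetric.inner_eq_zero_of_integral hα hθ' h x
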